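/- **Setting.** For $a\in\mathbb C$ let $(a)_k=a(a+1)\cdots(a+k-1)$, $(a)_0=1$. Let $z,z'\in\mathbb C$ be such that $(z)_k(z')_k$ and $(-z)_k(-z')_k$ are real and strictly positive for all $k=1,2,\dots$, put $t=zz'>0$, and let $0<\xi<1$. Let $F(a,b;c;w)$ be the Gauss hypergeometric function (the Gauss series, continued analytically from $0$ along the straight segment to $w$). With the signs $\pm$ taken consistently, put $$\psi_\pm(u)=t^{1/2}\xi^{u+1/2}(1-\xi)^{\pm(z+z')}\frac{\Gamma(u+1\pm z)\Gamma(u+1\pm z')}{\Gamma(1\pm z)\Gamma(1\pm z')\Gamma(u+1)^2},$$ $$R_\pm(u)=\psi_\pm(u)\,F\!\left(\mp z,\mp z';u+1;\tfrac{\xi}{\xi-1}\right),\qquad S_\pm(u)=\frac{t^{1/2}\xi^{1/2}\psi_\pm(u)}{1-\xi}\,\frac{F\!\left(1\mp z,1\mp z';u+2;\frac{\xi}{\xi-1}\right)}{u+1},$$ $$P_\pm(u)=\psi_\pm(u)^{-1/2}R_\pm(u),\qquad Q_\pm(u)=\psi_\pm(u)^{-1/2}S_\pm(u).$$ Let $\mathbb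 Z_+=\{0,1,2,\dots\}$ and identify $\mathbb Z'=\mathbb Z+\frac12$ with $\mathbb Z_+\sqcup\mathbb Z_+$ by $\pm(k+\frac12)\leftrightarrow k$, so that $\ell^2(\mathbb Z')=\ell^2(\mathbb Z_+)\oplus\ell^2(\mathbb Z_+)$. Let $L$ be the matrix $$L=\begin{bmatrix}0&\Psi_+^{1/2}W\Psi_-^{1/2}\\-\Psi_-^{1/2}W\Psi_+^{1/2}&0\end{bmatrix},\qquad \Psi_\pm=\operatorname{diag}\left\{\frac{t^{1/2}\xi^{k+1/2}(1-\xi)^{\pm(z+z')}(1\pm z)_k(1\pm z')_k}{k!\,k!}\right\}_{k\ge0},\quad W(k,l)=\frac1{k+l+1}.$$ For a Young diagram $\lambda$ with $n$ boxes and Frobenius coordinates $(p_1,\dots,p_d\,|\,q_1,\dots,q_d)$ let $$M_{z,z'}(\lambda)=\frac{n!}{(t)_n}\,t^d\prod_{i=1}^d\frac{(z+1)_{p_i}(z'+1)_{p_i}(-z+1)_{q_i}(-z'+1)_{q_i}}{(p_i!)^2(q_i!)^2}\,{\det}^2\!\left[\frac1{p_i+q_j+1}\right]_{1\le i,j\le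 d},$$ $$M_{z,z',\xi}(\lambda)=M_{z,z'}(\lambda)\,(1-\xi)^t\,\frac{(t)_n}{n!}\,\xi^n .$$ Let $\mathcal P_{z,z',\xi}$ be the point process on $\mathbb Z'$ given by the random configuration $X(\lambda)=\{p_i+\frac12\}_{i=1}^d\cup\{-q_i-\frac12\}_{i=1}^d$, where $\lambda$ is distributed according to $M_{z,z',\xi}$ on the set of all Young diagrams. **Theorem 3.3.** The hypergeometric functions above are well defined, $\psi_\pm(k)$ is real and positive for $k\in\mathbb Z_+$, and $P_\pm,Q_\pm$ are differentiable at the points of $\mathbb Z_+$. Let $K$ be the kernel with the blocks $$K_{++}(k,l)=\frac{P_+(k)Q_+(l)-Q_+(k)P_+(l)}{k-l},\qquad K_{+-}(k,l)=\frac{P_+(k)P_-(l)+Q_+(k)Q_-(l)}{k+l+1},$$ $$K_{-+}(k,l)=-\frac{P_-(k)P_+(l)+Q_-(k)Q_+(l)}{k+l+1},\qquad K_{--}(k,l)=\frac{P_-(k)Q_-(l)-Q_-(k)P_-(l)}{k-l}$$ ($k,l\in\mathbb Z_+$), where for $k=l$ the expressions $K_{++}$ and $K_{--}$ are understood by L'Hospital's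 rule, i.e. as the limits as $u\to k$ of the same quotients with $l$ replaced by $u$. Then $L$ and $K$ are the matrices of bounded operators in $\ell^2(\mathbb Z_+)\oplus\ell^2(\mathbb Z_+)$, the operator $1+L$ is invertible, and $$K=L(1+L)^{-1}.$$ Moreover, $M_{z,z',\xi}$ is a probability distribution with strictly positive weights, and the correlation functions of $\mathcal P_{z,z',\xi}$ are given by the kernel $K$: for every finite $X\subset\mathbb Z'$, $$\operatorname{Prob}\{X\subseteq X(\lambda)\}=\det[K(x,y)]_{x,y\in X}.$$ -/

import Mathlib

open Filter Topology

noncomputable section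

namespace HypKernel

/-! ### Parameters -/

/-- The Pochhammer symbol `(a)_k = a (a + 1) ⋯ (a + k - 1)`. -/
def poch (a : ℂ) (k : ℕ) : ℂ := (ascPochhammer ℂ k).eval a

/-- The standing assumption on `z, z'`: the numbers `(z)_k (z')_k` and `(-z)_k (-z')_k` are real
and strictly positive for `k = 1, 2, …`. -/
def Admissible (z z' : ℂ) : Prop :=
  ∀ k : ℕ, 1 ≤ k →
    ((poch z k * poch z' k).im = 0 ∧ 0 < (poch z k * poch z' k).re) ∧
    ((poch (-z) k * poch (-z') k).im = 0 ∧ 0 < (poch (-z) k * poch (-z') k).re)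

/-! ### The Gauss hypergeometric function -/

/-- `g` is analytic in a neighbourhood of the straight segment from `0` to `w` and coincides near
`0` with the Gauss series `∑ (a)_n (b)_n / ((c)_n n!) xⁿ`. -/
def IsGaussBranch (a b c w : ℂ) (g : ℂ → ℂ) : Prop :=
  AnalyticOnNhd ℂ g (segment ℝ 0 w) ∧ g =ᶠ[𝓝 0] fun x : ℂ => ₂F₁ a b c x

open Classical in
/-- The Gauss hypergeometric function `F(a, b; c; w)` (principal branch): the value at `w` of the
analytic continuation of the Gauss series along the straight segment from `0` to `w`. The slit
plane `ℂ ∖ [1, ∞)` is star-shaped about `0`, so that the continuation exists at each of its points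
(for `c ≠ 0, -1, -2, …`); elsewhere the value may be a junk value. -/
def gaussF (a b c w : ℂ) : ℂ :=
  if h : ∃ g : ℂ → ℂ, IsGaussBranch a b c w g then h.choose w else 0

/-- The value of `gaussF` does not depend on the choice of the branch. -/
theorem IsGaussBranch.gaussF_eq {a b c w : ℂ} {g : ℂ → ℂ} (hg : IsGaussBranch a b c w g) :
    gaussF a b c w = g w := by
  have h : ∃ g : ℂ → ℂ, IsGaussBranch a b c w g := ⟨g, hg⟩
  have h1 : gaussF a b c w = h.choose w := dif_pos h
  rw [h1]
  exact h.choose_spec.1.eqOn_of_preconnected_of_eventuallyEq hg.1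
    (convex_segment (0 : ℂ) w).isPreconnected (left_mem_segment ℝ 0 w)
    (h.choose_spec.2.trans hg.2.symm) (right_mem_segment ℝ 0 w)

/-! ### The functions `ψ_±, R_±, S_±, P_±, Q_±`

The sign `±` is the argument `s`, which is used for the values `s = 1` and `s = -1` only.
Powers are principal ones; the functions are used at and near the points `u = 0, 1, 2, …` only, where
`ψ_±` is positive. -/

/-- `ψ_±(u) = t^{1/2} ξ^{u+1/2} (1-ξ)^{±(z+z')} Γ(u+1±z) Γ(u+1±z') / (Γ(1±z) Γ(1±z') Γ(u+1)²)`
with `t = z z'`. -/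
def psi (z z' : ℂ) (ξ : ℝ) (s u : ℂ) : ℂ :=
  (z * z') ^ (1 / 2 : ℂ) * (ξ : ℂ) ^ (u + 1 / 2) * (1 - (ξ : ℂ)) ^ (s * (z + z')) *
    (Complex.Gamma (u + 1 + s * z) * Complex.Gamma (u + 1 + s * z')) /
    (Complex.Gamma (1 + s * z) * Complex.Gamma (1 + s * z') *
      Complex.Gamma (u + 1) * Complex.Gamma (u + 1))

/-- `R_±(u) = ψ_±(u) F(∓z, ∓z'; u + 1; ξ / (ξ - 1))`. -/
def funR (z z' : ℂ) (ξ : ℝ) (s u : ℂ) : ℂ :=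
  psi z z' ξ s u * gaussF (-(s * z)) (-(s * z')) (u + 1) ((ξ : ℂ) / ((ξ : ℂ) - 1))

/-- `S_±(u) = t^{1/2} ξ^{1/2} ψ_±(u) / (1 - ξ) · F(1 ∓ z, 1 ∓ z'; u + 2; ξ / (ξ - 1)) / (u + 1)`. -/
def funS (z z' : ℂ) (ξ : ℝ) (s u : ℂ) : ℂ :=
  (z * z') ^ (1 / 2 : ℂ) * (ξ : ℂ) ^ (1 / 2 : ℂ) * psi z z' ξ s u / (1 - (ξ : ℂ)) *
    (gaussF (1 - s * z) (1 - s * z') (u + 2) ((ξ : ℂ) / ((ξ : ℂ) - 1)) / (u + 1))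

/-- `P_±(u) = ψ_±(u)^{-1/2} R_±(u)`. -/
def funP (z z' : ℂ) (ξ : ℝ) (s u : ℂ) : ℂ :=
  psi z z' ξ s u ^ (-(1 / 2) : ℂ) * funR z z' ξ s u

/-- `Q_±(u) = ψ_±(u)^{-1/2} S_±(u)`. -/
def funQ (z z' : ℂ) (ξ : ℝ) (s u : ℂ) : ℂ :=
  psi z z' ξ s u ^ (-(1 / 2) : ℂ) * funS z z' ξ s u

/-! ### The lattice and the two kernels -/

/-- The lattice `ℤ' = ℤ + 1/2 = ℤ'_+ ⊔ ℤ'_-` with both halves identified with `{0, 1, 2, …}`: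
`Sum.inl k` is the half-integer `k + 1/2` and `Sum.inr k` is `-(k + 1/2)`. -/
abbrev HalfInt : Type := ℕ ⊕ ℕ

/-- The Hilbert space `ℓ²(ℤ') = ℓ²(ℤ_+) ⊕ ℓ²(ℤ_+)`. -/
abbrev Ell2 : Type := lp (fun _ : HalfInt => ℂ) 2

/-- The matrix entry `T(x, y)` of an operator `T` in `ℓ²(ℤ')`, in the standard basis. -/
def entry (T : Ell2 →L[ℂ] Ell2) (x y : HalfInt) : ℂ :=
  (T (lp.single 2 y (1 : ℂ))) x

/-- The `k`-th diagonal entry of the diagonal matrix `Ψ_±`: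
`t^{1/2} ξ^{k+1/2} (1-ξ)^{±(z+z')} (1±z)_k (1±z')_k / (k! k!)`. -/
def Psi (z z' : ℂ) (ξ : ℝ) (s : ℂ) (k : ℕ) : ℂ :=
  (z * z') ^ (1 / 2 : ℂ) * (ξ : ℂ) ^ ((k : ℂ) + 1 / 2) * (1 - (ξ : ℂ)) ^ (s * (z + z')) *
    (poch (1 + s * z) k * poch (1 + s * z') k) / ((k.factorial : ℂ) * (k.factorial : ℂ))

/-- The matrix `W(k, l) = 1 / (k + l + 1)`. -/
def W (k l : ℕ) : ℂ := 1 / ((k : ℂ) + l + 1)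

/-- The matrix `L` with the blocks `L_{++} = L_{--} = 0`, `L_{+-} = Ψ_+^{1/2} W Ψ_-^{1/2}` and
`L_{-+} = -Ψ_-^{1/2} W Ψ_+^{1/2}`. -/
def matL (z z' : ℂ) (ξ : ℝ) : HalfInt → HalfInt → ℂ
  | .inl _, .inl _ => 0
  | .inl k, .inr l => Psi z z' ξ 1 k ^ (1 / 2 : ℂ) * W k l * Psi z z' ξ (-1) l ^ (1 / 2 : ℂ)
  | .inr k, .inl l => -(Psi z z' ξ (-1) k ^ (1 / 2 : ℂ) * W k l * Psi z z' ξ 1 l ^ (1 / 2 : ℂ))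
  | .inr _, .inr _ => 0

/-- The quotient `(P_±(k) Q_±(u) - Q_±(k) P_±(u)) / (k - u)`. -/
def diagQuot (z z' : ℂ) (ξ : ℝ) (s k u : ℂ) : ℂ :=
  (funP z z' ξ s k * funQ z z' ξ s u - funQ z z' ξ s k * funP z z' ξ s u) / (k - u)

/-- The blocks `K_{++}` (`s = 1`) and `K_{--}` (`s = -1`). On the diagonal the quotient is
understood by L'Hospital's rule, that is, as `P'(k) Q(k) - P(k) Q'(k)`. -/
def diagBlock (z z' : ℂ) (ξ : ℝ) (s : ℂ) (k l : ℕ) : ℂ :=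
  if k = l then
    deriv (funP z z' ξ s) k * funQ z z' ξ s k - funP z z' ξ s k * deriv (funQ z z' ξ s) k
  else diagQuot z z' ξ s k l

/-- The hypergeometric kernel. -/
def hypKernel (z z' : ℂ) (ξ : ℝ) : HalfInt → HalfInt → ℂ
  | .inl k, .inl l => diagBlock z z' ξ 1 k l
  | .inl k, .inr l =>
      (funP z z' ξ 1 k * funP z z' ξ (-1) l + funQ z z' ξ 1 k * funQ z z' ξ (-1) l) /
        ((k : ℂ) + l + 1)
  | .inr k, .inl l =>
      -((funP z z' ξ (-1) k * funP z z' ξ 1 l + funQ z z' ξ (-1) k * funQ z z' ξ 1 l) /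
        ((k : ℂ) + l + 1))
  | .inr k, .inr l => diagBlock z z' ξ (-1) k l

/-! ### The point process -/

/-- The number `d(λ)` of diagonal boxes of a Young diagram. -/
def diagLen (lam : YoungDiagram) : ℕ := (lam.cells.filter fun c => c.1 = c.2).card

/-- The Frobenius coordinate `p_{i+1}`: the number of boxes in row `i` to the right of the diagonal
box `(i, i)` (rows and columns are numbered from `0`; used for `i < d(λ)`). -/
def frobP (lam : YoungDiagram) (i : ℕ) : ℕ := lam.rowLen i - (i + 1)

/-- The Frobenius coordinate `q_{i+1}`: the number of boxes in column `i` below the diagonal box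
`(i, i)` (used for `i < d(λ)`). -/
def frobQ (lam : YoungDiagram) (i : ℕ) : ℕ := lam.colLen i - (i + 1)

/-- The configuration `{p_i + 1/2} ∪ {-q_i - 1/2}` in `ℤ'` that corresponds to `λ`. -/
def config (lam : YoungDiagram) : Finset HalfInt :=
  ((Finset.range (diagLen lam)).image (frobP lam)).disjSum
    ((Finset.range (diagLen lam)).image (frobQ lam))

/-- `M_{z,z'}(λ) = n! / (t)_n · t^d ∏_i ((z+1)_{p_i} (z'+1)_{p_i} (-z+1)_{q_i} (-z'+1)_{q_i})
/ (p_i!² q_i!²) · det² [1 / (p_i + q_j + 1)]`, where `n = |λ|`, `t = z z'`. -/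
def zMeasure (z z' : ℂ) (lam : YoungDiagram) : ℂ :=
  (lam.card.factorial : ℂ) / poch (z * z') lam.card * (z * z') ^ diagLen lam *
    (∏ i ∈ Finset.range (diagLen lam),
      (poch (z + 1) (frobP lam i) * poch (z' + 1) (frobP lam i) *
        poch (-z + 1) (frobQ lam i) * poch (-z' + 1) (frobQ lam i)) /
      (((frobP lam i).factorial : ℂ) ^ 2 * ((frobQ lam i).factorial : ℂ) ^ 2)) *
    (Matrix.of fun i j : Fin (diagLen lam) =>
      1 / ((frobP lam i : ℂ) + (frobQ lam j : ℂ) + 1)).det ^ 2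

/-- The negative binomial weight `(1-ξ)^t (t)_n / n! · ξⁿ`. -/
def negBinomial (t : ℂ) (ξ : ℝ) (n : ℕ) : ℂ :=
  (1 - (ξ : ℂ)) ^ t * (poch t n / (n.factorial : ℂ)) * (ξ : ℂ) ^ n

/-- The mixed measure `M_{z,z',ξ}(λ)` on the set of all Young diagrams. The point process
`P_{z,z',ξ}` on `ℤ'` is the random configuration `config λ`, where `λ` has this distribution. -/
def mixedMeasure (z z' : ℂ) (ξ : ℝ) (lam : YoungDiagram) : ℂ :=
  zMeasure z z' lam * negBinomial (z * z') ξ lam.card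

end HypKernel

end

/-!
The proof rests on two facts: the kernel `K` solves `K + L K = L`, and the weights of the mixed
measure are, up to the factor `(1 - ξ)^t`, the principal minors of `L`.

*The kernel.* Put `w = ξ / (ξ - 1)`. By Pfaff's transformation `F(a, b; c; w)` is a convergent
series in `ξ`. Its coefficients are rational functions of `c`, and summing their partial fractions
gives expansions of `F(a, b; c; w)` in the simple fractions `1 / (c + j)`, whose residues are
again hypergeometric functions (`hasSum_resF_div`, `hasSum_resG_div`). For the functions in the
theorem this says that `F_±, G_±`, the cofactors of `ψ_±` in `R_±, S_±`, satisfy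
`1 - F_±(u) = ∑_j Ψ_∓(j) G_∓(j) / (u + j + 1)` and `G_±(u) = ∑_j Ψ_∓(j) F_∓(j) / (u + j + 1)`
(`dualPair`). Two pairs of sequences with such relations are a `DualPair`. From these relations
alone, if `A` and `B` denote the off-diagonal blocks `L_{+-}` and `K_{+-}`, one gets
`K_{++} = A Bᵗ`, `K_{--} = Aᵗ B` and `B + A K_{--} = A`, hence `K + L K = L`
(`DualPair.hasSum_blockMat_mul_skewMat`); the last identity becomes one of rank-one sums after
multiplication by `k + l + 1`. The diagonal entries are the derivatives of the expansions, which
are the l'Hospital values. The operator `L` is skew-adjoint, so `1 + L` is invertible.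

*The point process.* Frobenius coordinates identify Young diagrams with the finite sets `Y ⊆ ℤ'`
that have as many positive as negative points. The minor `det L_Y` vanishes for all other sets;
for the set of a diagram `λ` it is the product of the `Ψ`'s with the square of a Cauchy
determinant, that is, a positive weight times `ξ^{|λ|}` (`minor_matL_config`). For finite sections
`∑_{Y ⊇ X} det L_Y = det (1 + L) det K_X` is linear algebra. The passage to the limit
(`hasSum_minor_of_subset`) uses that the minors are nonnegative with bounded sums, and that the
finite resolvents of a skew-adjoint operator converge entrywise, by a Galerkin estimate. Thus
`∑_{Y ⊇ X} det L_Y = Z det K_X` with `Z = ∑_Y det L_Y`.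

*The normalisation.* The expectation of `|λ| = ∑_{x ∈ X(λ)} |x|` equals `∑_x |x| K(x, x)`, and by
the relations above this trace is the sum `∑_k Ψ_+(k) G_+(k)` of residues, which is
`t ξ / (1 - ξ)`. As a function of `ξ` the sum `Z = ∑_λ w_λ ξ^{|λ|}` therefore satisfies
`ξ Z' = t ξ (1 - ξ)⁻¹ Z` and `Z(0) = 1`, so that `Z = (1 - ξ)⁻ᵗ`
(`one_sub_rpow_mul_partitionFun`).
-/

open Filter Topology
open Finset.HasAntidiagonal (antidiagonal)

noncomputable section

namespace HypKernel

/-! ### Pochhammer symbols -/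

@[simp] lemma poch_zero (a : ℂ) : poch a 0 = 1 := by simp [poch]

lemma poch_succ (a : ℂ) (n : ℕ) : poch a (n + 1) = poch a n * (a + n) := by
  simp [poch, ascPochhammer_succ_eval]

lemma poch_add (a : ℂ) (m n : ℕ) : poch a (m + n) = poch a m * poch (a + m) n := by
  induction n with
  | zero => simp
  | succ n ih => rw [← add_assoc, poch_succ, ih, poch_succ]; push_cast; ring

lemma poch_succ_left (a : ℂ) (n : ℕ) : poch a (n + 1) = a * poch (a + 1) n := by
  rw [add_comm, poch_add, poch_succ]; simp

lemma poch_one (n : ℕ) : poch 1 n = n.factorial := by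
  induction n with
  | zero => simp
  | succ n ih => rw [poch_succ, ih, Nat.factorial_succ]; push_cast; ring

lemma poch_two (n : ℕ) : poch 2 n = (n + 1).factorial := by
  rw [← poch_one, poch_succ_left]; norm_num

lemma poch_ne_zero {c : ℂ} (hc : ∀ n : ℕ, c ≠ -(n : ℂ)) (n : ℕ) : poch c n ≠ 0 := by
  induction n with
  | zero => simp
  | succ n ih =>
    rw [poch_succ]
    exact mul_ne_zero ih fun h => hc n (eq_neg_of_add_eq_zero_left h)

lemma fact_ne (n : ℕ) : (n.factorial : ℂ) ≠ 0 := by exact_mod_cast n.factorial_ne_zero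

/-- Reversing the order of the factors: `(1 - x - n)_n = (-1)^n (x)_n`. -/
lemma poch_reflect (x : ℂ) (n : ℕ) : poch (1 - x - n) n = (-1) ^ n * poch x n := by
  induction n with
  | zero => simp
  | succ n ih =>
    rw [poch_succ_left, show 1 - x - ((n + 1 : ℕ) : ℂ) + 1 = 1 - x - n by push_cast; ring, ih,
      poch_succ]
    push_cast; ring

/-- The Chu–Vandermonde convolution. -/
lemma sum_poch_mul_poch (x y : ℂ) (n : ℕ) :
    ∑ p ∈ antidiagonal n,
      (poch x p.1 / p.1.factorial) * (poch y p.2 / p.2.factorial) =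
      poch (x + y) n / n.factorial := by
  have key : ∀ (x : ℂ) (j : ℕ), ((j : ℂ) + 1) * (poch x (j + 1) / (j + 1).factorial) =
      (x + j) * (poch x j / j.factorial) := by
    intro x j
    rw [poch_succ, Nat.factorial_succ]
    have h1 := fact_ne j
    have h2 : (j : ℂ) + 1 ≠ 0 := by exact_mod_cast j.succ_ne_zero
    push_cast; field_simp
  induction n with
  | zero => simp
  | succ n ih =>
    have hn : (n : ℂ) + 1 ≠ 0 := by exact_mod_cast n.succ_ne_zero
    apply mul_left_cancel₀ hn
    rw [key, ← ih]
    have e : ((n : ℂ) + 1) * ∑ p ∈ antidiagonal (n + 1),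
        (poch x p.1 / p.1.factorial) * (poch y p.2 / p.2.factorial) =
        (∑ p ∈ antidiagonal (n + 1),
          ((p.1 : ℂ) * (poch x p.1 / p.1.factorial)) * (poch y p.2 / p.2.factorial)) +
        ∑ p ∈ antidiagonal (n + 1),
          (poch x p.1 / p.1.factorial) * ((p.2 : ℂ) * (poch y p.2 / p.2.factorial)) := by
      rw [Finset.mul_sum, ← Finset.sum_add_distrib]
      refine Finset.sum_congr rfl fun p hp => ?_
      rw [Finset.HasAntidiagonal.mem_antidiagonal] at hp
      have : (n : ℂ) + 1 = p.1 + p.2 := by exact_mod_cast hp.symm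
      rw [this]; ring
    rw [e, Finset.Nat.sum_antidiagonal_succ, Finset.Nat.sum_antidiagonal_succ', Finset.mul_sum]
    simp only [Nat.cast_zero, zero_mul, mul_zero, zero_add, Nat.cast_add, Nat.cast_one, key]
    rw [← Finset.sum_add_distrib]
    refine Finset.sum_congr rfl fun p hp => ?_
    rw [Finset.HasAntidiagonal.mem_antidiagonal] at hp
    have : (n : ℂ) = p.1 + p.2 := by exact_mod_cast hp.symm
    rw [this]; ring

/-- The finite sum behind Pfaff's transformation. -/
lemma sum_neg_one_poch_div (b c : ℂ) (hc : ∀ n : ℕ, c ≠ -(n : ℂ)) (N : ℕ) :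
    ∑ p ∈ antidiagonal N,
      (-1) ^ p.1 * (poch b p.1 / poch c p.1) / (p.1.factorial * p.2.factorial) =
      poch (c - b) N / (poch c N * N.factorial) := by
  have h := sum_poch_mul_poch b (1 - c - N) N
  have h2 : poch (b + (1 - c - N)) N = (-1) ^ N * poch (c - b) N := by
    rw [← poch_reflect]; congr 1; ring
  have hN := poch_ne_zero hc N
  rw [h2] at h
  have hs : ((-1 : ℂ) ^ N) * (-1) ^ N = 1 := by rw [← mul_pow]; simp
  have : poch (c - b) N / (poch c N * N.factorial) =
      (-1) ^ N / poch c N * ((-1) ^ N * poch (c - b) N / N.factorial) := by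
    have := fact_ne N
    field_simp
    linear_combination (-poch (c - b) N) * hs
  rw [this, ← h, Finset.mul_sum]
  refine Finset.sum_congr rfl fun p hp => ?_
  rw [Finset.HasAntidiagonal.mem_antidiagonal] at hp
  have hp1 := poch_ne_zero hc p.1
  have h3 : poch (1 - c - N) p.2 = (-1) ^ p.2 * poch (c + p.1) p.2 := by
    rw [← poch_reflect]; congr 1; rw [← hp]; push_cast; ring
  have h4 : poch c N = poch c p.1 * poch (c + p.1) p.2 := by rw [← hp, poch_add]
  have h5 : poch (c + p.1) p.2 ≠ 0 := by
    intro h; rw [h4, h, mul_zero] at hN; exact hN rfl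
  rw [h3, h4, ← hp, pow_add]
  have := fact_ne p.1
  have := fact_ne p.2
  have hs : ((-1 : ℂ) ^ p.2) * (-1) ^ p.2 = 1 := by rw [← mul_pow]; simp
  field_simp
  linear_combination (-poch b p.1) * hs

/-- Partial fractions of `(c + β)_n / (c)_{n+1}`. -/
lemma poch_div_poch_partialFraction (β c : ℂ) (hc : ∀ n : ℕ, c ≠ -(n : ℂ)) (n : ℕ) :
    poch (c + β) n / poch c (n + 1) =
      ∑ p ∈ antidiagonal n, (poch (1 - β) p.1 / p.1.factorial) *
        (poch β p.2 / p.2.factorial) / (c + p.1) := by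
  have hcj : ∀ j : ℕ, c + j ≠ 0 := fun j h => hc j (eq_neg_of_add_eq_zero_left h)
  have hsum : ∀ n : ℕ, ∑ p ∈ antidiagonal n, (poch (1 - β) p.1 / p.1.factorial) *
        (poch β p.2 / p.2.factorial) = 1 := by
    intro n
    rw [sum_poch_mul_poch, sub_add_cancel, poch_one, div_self (fact_ne n)]
  induction n with
  | zero => simp [poch_succ]
  | succ n ih =>
    have h1 : poch (c + β) (n + 1) / poch c (n + 1 + 1) =
        (c + β + n) / (c + (n + 1 : ℕ)) * (poch (c + β) n / poch c (n + 1)) := by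
      rw [poch_succ, poch_succ c (n + 1)]
      have := hcj (n + 1)
      have := poch_ne_zero hc (n + 1)
      field_simp
    rw [h1, ih]
    -- Multiply by `c + n + 1` and write `(c + n + 1) / (c + j) = 1 + (n + 1 - j) / (c + j)`,
    -- `(c + β + n) / (c + j) = 1 + (β + n - j) / (c + j)`: the terms with a pole match.
    have e1 : (c + (n + 1 : ℕ)) * ∑ p ∈ antidiagonal (n + 1),
        (poch (1 - β) p.1 / p.1.factorial) * (poch β p.2 / p.2.factorial) / (c + p.1) =
        1 + ∑ p ∈ antidiagonal (n + 1), (poch (1 - β) p.1 / p.1.factorial) *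
          ((p.2 : ℂ) * (poch β p.2 / p.2.factorial)) / (c + p.1) := by
      refine Eq.trans ?_ (congrArg (· + _) (hsum (n + 1)))
      rw [Finset.mul_sum, ← Finset.sum_add_distrib]
      refine Finset.sum_congr rfl fun p hp => ?_
      rw [Finset.HasAntidiagonal.mem_antidiagonal] at hp
      have := hcj p.1
      rw [← hp]; push_cast; field_simp; ring
    have e2 : (c + β + n) * ∑ p ∈ antidiagonal n,
        (poch (1 - β) p.1 / p.1.factorial) * (poch β p.2 / p.2.factorial) / (c + p.1) =
        1 + ∑ p ∈ antidiagonal n, (poch (1 - β) p.1 / p.1.factorial) *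
          ((β + p.2) * (poch β p.2 / p.2.factorial)) / (c + p.1) := by
      refine Eq.trans ?_ (congrArg (· + _) (hsum n))
      rw [Finset.mul_sum, ← Finset.sum_add_distrib]
      refine Finset.sum_congr rfl fun p hp => ?_
      rw [Finset.HasAntidiagonal.mem_antidiagonal] at hp
      have := hcj p.1
      rw [← hp]; push_cast; field_simp; ring
    have e3 : ∑ p ∈ antidiagonal (n + 1), (poch (1 - β) p.1 / p.1.factorial) *
          ((p.2 : ℂ) * (poch β p.2 / p.2.factorial)) / (c + p.1) =
        ∑ p ∈ antidiagonal n, (poch (1 - β) p.1 / p.1.factorial) *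
          ((β + p.2) * (poch β p.2 / p.2.factorial)) / (c + p.1) := by
      rw [Finset.Nat.sum_antidiagonal_succ']
      simp only [Nat.cast_zero, zero_mul, mul_zero, zero_div, zero_add]
      refine Finset.sum_congr rfl fun p _ => ?_
      rw [poch_succ, Nat.factorial_succ]
      have h1 := fact_ne p.2
      have h2 : (p.2 : ℂ) + 1 ≠ 0 := by exact_mod_cast p.2.succ_ne_zero
      push_cast; congr 2; field_simp
    have := hcj (n + 1)
    rw [div_mul_eq_mul_div, div_eq_iff this, mul_comm _ (c + ((n + 1 : ℕ) : ℂ)), e1, e2, e3]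

/-- Partial fractions of `(c - b)_{n+1} / (c)_{n+1}`. -/
lemma poch_sub_div_poch_partialFraction (b c : ℂ) (hc : ∀ n : ℕ, c ≠ -(n : ℂ)) (n : ℕ) :
    poch (c - b) (n + 1) / poch c (n + 1) =
      1 - ∑ p ∈ antidiagonal n, (poch b (p.1 + 1) / p.1.factorial) *
        (poch (1 - b) p.2 / p.2.factorial) / (c + p.1) := by
  have hcj : ∀ j : ℕ, c + j ≠ 0 := fun j h => hc j (eq_neg_of_add_eq_zero_left h)
  have h := poch_div_poch_partialFraction (1 - b) c hc n
  have h1 : poch (c - b) (n + 1) / poch c (n + 1) =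
      (c - b) * (poch (c + (1 - b)) n / poch c (n + 1)) := by
    rw [poch_succ_left, mul_div_assoc]; congr 3; ring
  have h2 := sum_poch_mul_poch b (1 - b) n
  rw [add_sub_cancel, poch_one, div_self (fact_ne n)] at h2
  rw [h1, h]
  refine Eq.trans ?_ (congrArg (· - _) h2)
  rw [Finset.mul_sum, ← Finset.sum_sub_distrib]
  refine Finset.sum_congr rfl fun p _ => ?_
  have := hcj p.1
  rw [sub_sub_cancel, poch_succ]
  field_simp
  ring

/-- The sum of the residues in the partial fractions of `(c - b)_{n+1} / (c)_{n+1}`. -/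
lemma sum_poch_succ_mul_poch (b : ℂ) (n : ℕ) :
    ∑ p ∈ antidiagonal n, (poch b (p.1 + 1) / p.1.factorial) *
        (poch (1 - b) p.2 / p.2.factorial) = (n + 1) * b := by
  have h := sum_poch_mul_poch (b + 1) (1 - b) n
  rw [show b + 1 + (1 - b) = 2 by ring, poch_two, Nat.factorial_succ] at h
  have : ((n : ℂ) + 1) * b = b * (((n + 1) * n.factorial : ℕ) / n.factorial) := by
    have := fact_ne n
    push_cast; field_simp
  rw [this, ← h, Finset.mul_sum]
  refine Finset.sum_congr rfl fun p _ => ?_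
  rw [poch_succ_left]; ring

/-- Quotients of Pochhammer symbols grow subexponentially. -/
lemma exists_norm_poch_div_poch_le (b c : ℂ) (hc : ∀ n : ℕ, c ≠ -(n : ℂ)) {r : ℝ} (hr : 1 < r) :
    ∃ C : ℝ, 0 ≤ C ∧ ∀ n, ‖poch b n / poch c n‖ ≤ C * r ^ n := by
  have hcj : ∀ j : ℕ, c + j ≠ 0 := fun j h => hc j (eq_neg_of_add_eq_zero_left h)
  have ht : Tendsto (fun n : ℕ => ‖(b + n) / (c + n)‖) atTop (𝓝 1) := by
    have := (tendsto_add_mul_div_add_mul_atTop_nhds b c (1 : ℂ) one_ne_zero).norm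
    simpa using this
  obtain ⟨N, hN⟩ := eventually_atTop.1 (ht.eventually_lt_const hr)
  have hr0 : 0 < r := by linarith
  set u : ℕ → ℝ := fun n => ‖poch b n / poch c n‖ / r ^ n with hu
  have hu0 : ∀ n, 0 ≤ u n := fun n => by positivity
  refine ⟨∑ i ∈ Finset.range (N + 1), u i, Finset.sum_nonneg fun i _ => hu0 i, ?_⟩
  suffices h : ∀ n, u n ≤ ∑ i ∈ Finset.range (N + 1), u i by
    intro n
    exact (div_le_iff₀ (by positivity)).1 (h n)
  have hle : ∀ n ≤ N, u n ≤ ∑ i ∈ Finset.range (N + 1), u i := fun n hn =>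
    Finset.single_le_sum (f := u) (fun i _ => hu0 i) (Finset.mem_range.2 (by omega))
  have hge : ∀ n, N ≤ n → u n ≤ u N := by
    intro n hn
    induction n, hn using Nat.le_induction with
    | base => exact le_rfl
    | succ n hn ih =>
      refine le_trans ?_ ih
      have h1 : u (n + 1) = u n * (‖(b + n) / (c + n)‖ / r) := by
        simp only [hu, poch_succ]
        rw [mul_div_mul_comm, norm_mul, pow_succ]
        ring
      rw [h1]
      refine mul_le_of_le_one_right (hu0 n) ?_
      rw [div_le_one hr0]
      exact (hN n hn).le
  intro n
  rcases le_total n N with h | h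
  · exact hle n h
  · exact (hge n h).trans (hle N le_rfl)

lemma one_ne_neg_nat (n : ℕ) : (1 : ℂ) ≠ -(n : ℂ) := by
  intro h
  have h2 : ((n + 1 : ℕ) : ℂ) = 0 := by push_cast; linear_combination h
  exact n.succ_ne_zero (by exact_mod_cast h2)

lemma exists_norm_poch_div_factorial_le (b : ℂ) {r : ℝ} (hr : 1 < r) :
    ∃ C : ℝ, 0 ≤ C ∧ ∀ n, ‖poch b n / (n.factorial : ℂ)‖ ≤ C * r ^ n := by
  simpa only [poch_one] using exists_norm_poch_div_poch_le b 1 one_ne_neg_nat hr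

/-- The binomial series. -/
lemma hasSum_binomial (a : ℂ) {x : ℂ} (hx : ‖x‖ < 1) :
    HasSum (fun n : ℕ => poch a n / n.factorial * x ^ n) ((1 - x) ^ (-a)) := by
  have h := (Complex.one_div_one_sub_cpow_hasFPowerSeriesOnBall_zero a).hasSum
    (y := x) (by simpa [enorm_eq_nnnorm, ← NNReal.coe_lt_coe] using hx)
  rw [zero_add, one_div, ← Complex.cpow_neg] at h
  have e : ∀ n : ℕ, poch a n / n.factorial * x ^ n =
      (FormalMultilinearSeries.ofScalars ℂ fun n : ℕ => Ring.choose (a + n - 1) n) n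
        fun _ => x := by
    intro n
    have h1 := Ring.factorial_nsmul_multichoose_eq_ascPochhammer a n
    rw [nsmul_eq_mul, Polynomial.ascPochhammer_smeval_eq_eval] at h1
    rw [FormalMultilinearSeries.ofScalars_apply_eq, Ring.choose, smul_eq_mul,
      show a + n - 1 - n + 1 = a by ring, poch, ← h1, mul_div_cancel_left₀ _ (fact_ne n)]
  simpa only [e] using h

/-! ### The Gauss series and Pfaff's transformation -/

lemma HasSum.sum_antidiagonal {f : ℕ × ℕ → ℂ} {s : ℂ} (h : HasSum f s) :
    HasSum (fun n => ∑ p ∈ antidiagonal n, f p) s := by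
  have h1 := (Finset.HasAntidiagonal.sigmaAntidiagonalEquivProd (A := ℕ)).hasSum_iff.2 h
  refine HasSum.sigma h1 fun n => ?_
  rw [← Finset.sum_coe_sort]
  exact hasSum_fintype _

lemma exists_one_lt_pow_mul_lt_one {q : ℝ} (hq : q < 1) (k : ℕ) :
    ∃ r : ℝ, 1 < r ∧ r ^ k * q < 1 := by
  have h : Tendsto (fun r : ℝ => r ^ k * q) (𝓝[>] 1) (𝓝 (1 ^ k * q)) :=
    (by fun_prop : Continuous fun r : ℝ => r ^ k * q).continuousAt.mono_left nhdsWithin_le_nhds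
  rw [one_pow, one_mul] at h
  obtain ⟨r, h1, h2⟩ := ((h.eventually_lt_const hq).and self_mem_nhdsWithin).exists
  exact ⟨r, h2, h1⟩

lemma summable_norm_gauss (a b c : ℂ) (hc : ∀ n : ℕ, c ≠ -(n : ℂ)) {x : ℂ} (hx : ‖x‖ < 1) :
    Summable fun n : ℕ => ‖poch a n / n.factorial * (poch b n / poch c n) * x ^ n‖ := by
  obtain ⟨r, hr, hrx⟩ := exists_one_lt_pow_mul_lt_one hx 2
  obtain ⟨C, hC, h1⟩ := exists_norm_poch_div_factorial_le a hr
  obtain ⟨D, hD, h2⟩ := exists_norm_poch_div_poch_le b c hc hr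
  refine Summable.of_nonneg_of_le (fun n => norm_nonneg _) (fun n => ?_)
    ((summable_geometric_of_lt_one (by positivity) hrx).mul_left (C * D))
  rw [norm_mul, norm_mul, norm_pow]
  calc _ ≤ (C * r ^ n) * (D * r ^ n) * ‖x‖ ^ n := by gcongr; exacts [h1 n, h2 n]
    _ = C * D * (r ^ 2 * ‖x‖) ^ n := by rw [mul_pow, ← pow_mul, mul_comm 2 n, pow_mul]; ring

lemma hasSum_gauss (a b c : ℂ) (hc : ∀ n : ℕ, c ≠ -(n : ℂ)) {x : ℂ} (hx : ‖x‖ < 1) :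
    HasSum (fun n : ℕ => poch a n / n.factorial * (poch b n / poch c n) * x ^ n)
      (₂F₁ a b c x) := by
  have h : ₂F₁ a b c x =
      ∑' n : ℕ, poch a n / n.factorial * (poch b n / poch c n) * x ^ n := by
    rw [ordinaryHypergeometric_eq_tsum]
    refine tsum_congr fun n => ?_
    simp only [poch, smul_eq_mul]
    ring
  rw [h]
  exact (summable_norm_gauss a b c hc hx).of_norm.hasSum

lemma analyticAt_gauss (a b c : ℂ) (hc : ∀ n : ℕ, c ≠ -(n : ℂ)) {x : ℂ} (hx : ‖x‖ < 1) :
    AnalyticAt ℂ (₂F₁ a b c) x := by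
  have hr : (1 : ENNReal) ≤ (ordinaryHypergeometricSeries ℂ a b c).radius := by
    refine le_of_forall_lt fun q hq => ?_
    obtain ⟨q', h1, h2⟩ := ENNReal.lt_iff_exists_nnreal_btwn.1 hq
    refine h1.trans_le (FormalMultilinearSeries.le_radius_of_summable_norm _ ?_)
    have h3 : ‖((q' : ℝ) : ℂ)‖ < 1 := by simpa using h2
    refine (summable_norm_gauss a b c hc h3).congr fun n => ?_
    rw [norm_mul, norm_pow, ordinaryHypergeometricSeries, FormalMultilinearSeries.ofScalars_norm]
    simp only [poch, ordinaryHypergeometricCoefficient]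
    congr 2
    · ring
    · simp
  have h0 : 0 < (ordinaryHypergeometricSeries ℂ a b c).radius := lt_of_lt_of_le one_pos hr
  refine ((ordinaryHypergeometricSeries ℂ a b c).hasFPowerSeriesOnBall h0).analyticAt_of_mem ?_
  refine Metric.eball_subset_eball hr ?_
  simpa [enorm_eq_nnnorm, ← NNReal.coe_lt_coe] using hx

/-- Pfaff's transformation near the origin. Both sides are rearrangements of one double series. -/
lemma pfaff_of_norm_lt (a b c : ℂ) (hc : ∀ n : ℕ, c ≠ -(n : ℂ)) {x : ℂ} (hx : ‖x‖ < 1 / 4) :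
    (1 - x) ^ (-a) * ₂F₁ a (c - b) c (x / (x - 1)) = ₂F₁ a b c x := by
  have hx1 : 3 / 4 ≤ ‖x - 1‖ := by
    have := norm_sub_norm_le (1 : ℂ) x
    rw [norm_one, norm_sub_rev] at this
    linarith
  have hx0 : x - 1 ≠ 0 := by rw [← norm_pos_iff]; linarith
  have hx0' : 1 - x ≠ 0 := by rw [← neg_sub]; exact neg_ne_zero.2 hx0
  have hy : ‖x / (x - 1)‖ < 1 := by
    rw [norm_div, div_lt_one (by linarith)]; linarith
  set f : ℕ × ℕ → ℂ := fun p => poch a (p.1 + p.2) * x ^ (p.1 + p.2) *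
    ((-1) ^ p.1 * (poch (c - b) p.1 / poch c p.1) / (p.1.factorial * p.2.factorial)) with hf
  have hsum : Summable f := by
    obtain ⟨r, hr, hrx⟩ := exists_one_lt_pow_mul_lt_one (q := 1 / 2) (by norm_num) 2
    obtain ⟨C, hC, h1⟩ := exists_norm_poch_div_factorial_le a hr
    obtain ⟨D, hD, h2⟩ := exists_norm_poch_div_poch_le (c - b) c hc hr
    have hg := summable_geometric_of_lt_one (by positivity) hrx
    refine Summable.of_norm_bounded (g := fun p : ℕ × ℕ =>
      (C * D) * ((r ^ 2 * (1 / 2)) ^ p.1 * (r ^ 2 * (1 / 2)) ^ p.2))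
      ((hg.mul_of_nonneg hg (fun _ => by positivity) fun _ => by positivity).mul_left _) ?_
    rintro ⟨n, m⟩
    have e : f (n, m) = (poch a (n + m) / (n + m).factorial) * (x ^ (n + m) * (-1) ^ n) *
        (poch (c - b) n / poch c n) * ((n + m).choose m : ℂ) := by
      have := congrArg (Nat.cast (R := ℂ)) (Nat.add_choose_mul_factorial_mul_factorial n m)
      push_cast at this
      simp only [hf]
      rw [← this]
      have := fact_ne n
      have := fact_ne m
      have h3 : ((n + m).choose m : ℂ) ≠ 0 := by
        exact_mod_cast (Nat.choose_pos (Nat.le_add_left m n)).ne'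
      field_simp
    have h3 : ‖((n + m).choose m : ℂ)‖ ≤ 2 ^ (n + m) := by
      rw [Complex.norm_natCast]; exact_mod_cast Nat.choose_le_two_pow _ _
    have h4 : ‖x ^ (n + m) * (-1) ^ n‖ ≤ (1 / 4) ^ (n + m) := by
      rw [norm_mul, norm_pow, norm_pow, norm_neg, norm_one, one_pow, mul_one]
      gcongr
    have h5 : r ^ n ≤ r ^ (n + m) := pow_le_pow_right₀ hr.le (by omega)
    rw [e, norm_mul, norm_mul, norm_mul]
    calc _ ≤ (C * r ^ (n + m)) * (1 / 4) ^ (n + m) * (D * r ^ (n + m)) * 2 ^ (n + m) := by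
          gcongr
          · exact h1 _
          · exact (h2 n).trans (by gcongr)
      _ = C * D * (r * (1 / 4) * r * 2) ^ (n + m) := by simp only [mul_pow]; ring
      _ = _ := by
        rw [← pow_add]; congr 2; ring
  have h1 : HasSum (fun n => (1 - x) ^ (-a) *
      (poch a n / n.factorial * (poch (c - b) n / poch c n) * (x / (x - 1)) ^ n))
      (∑' p, f p) := by
    refine HasSum.prod_fiberwise hsum.hasSum fun n => ?_
    have h2 := (hasSum_binomial (a + n) (x := x) (by linarith)).mul_left
      (poch a n / n.factorial * (poch (c - b) n / poch c n) * (-x) ^ n)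
    have e1 : (1 - x) ^ (-(a + n)) * (-x) ^ n = (1 - x) ^ (-a) * (x / (x - 1)) ^ n := by
      rw [neg_add, Complex.cpow_add _ _ hx0', Complex.cpow_neg _ (n : ℂ), Complex.cpow_natCast,
        ← neg_sub 1 x, div_neg, ← neg_div, div_pow]
      ring
    have e2 : (1 - x) ^ (-a) * (poch a n / n.factorial * (poch (c - b) n / poch c n) *
        (x / (x - 1)) ^ n) = poch a n / n.factorial * (poch (c - b) n / poch c n) * (-x) ^ n *
          (1 - x) ^ (-(a + n)) := by
      linear_combination (-(poch a n / n.factorial * (poch (c - b) n / poch c n))) * e1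
    rw [e2]
    refine h2.congr_fun fun m => ?_
    simp only [hf, poch_add, pow_add]
    rw [neg_pow]
    ring
  have h2 : HasSum (fun n : ℕ => poch a n / n.factorial * (poch b n / poch c n) * x ^ n)
      (∑' p, f p) := by
    convert HasSum.sum_antidiagonal hsum.hasSum using 2 with N
    have h3 := sum_neg_one_poch_div (c - b) c hc N
    rw [sub_sub_cancel] at h3
    have h4 : ∑ p ∈ antidiagonal N, f p = poch a N * x ^ N * ∑ p ∈ antidiagonal N,
      (-1) ^ p.1 * (poch (c - b) p.1 / poch c p.1) / (p.1.factorial * p.2.factorial) := by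
      rw [Finset.mul_sum]
      refine Finset.sum_congr rfl fun p hp => ?_
      rw [Finset.HasAntidiagonal.mem_antidiagonal] at hp
      simp only [hf, hp]
    rw [h4, h3]
    ring
  rw [(hasSum_gauss a b c hc (by linarith)).unique h2]
  exact ((hasSum_gauss a (c - b) c hc hy).mul_left _).unique h1

/-- On the negative half-line the Gauss function is continued by Pfaff's transformation. -/
lemma isGaussBranch_pfaff (a b c : ℂ) (hc : ∀ n : ℕ, c ≠ -(n : ℂ)) {ξ : ℝ} (hξ0 : 0 < ξ)
    (hξ1 : ξ < 1) :
    IsGaussBranch a b c ((ξ : ℂ) / ((ξ : ℂ) - 1))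
      fun x => (1 - x) ^ (-a) * ₂F₁ a (c - b) c (x / (x - 1)) := by
  constructor
  · intro x hx
    obtain ⟨y, hy, rfl⟩ : ∃ y : ℝ, 0 ≤ y ∧ -(y : ℂ) = x := by
      rw [segment_eq_image] at hx
      obtain ⟨θ, ⟨h0, h1⟩, rfl⟩ := hx
      refine ⟨θ * (ξ / (1 - ξ)), by have : 0 < 1 - ξ := by linarith
                                    positivity, ?_⟩
      rw [← neg_sub (1 : ℂ) (ξ : ℂ), div_neg]
      simp only [smul_zero, zero_add, Complex.real_smul]
      push_cast; ring
    have h1 : (1 : ℂ) - -(y : ℂ) = ((1 + y : ℝ) : ℂ) := by push_cast; ring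
    have h2 : -(y : ℂ) - 1 = ((-(1 + y) : ℝ) : ℂ) := by push_cast; ring
    have h3 : (-(y : ℂ)) - 1 ≠ 0 := by
      rw [h2]; exact_mod_cast (by linarith : -(1 + y) ≠ 0)
    refine AnalyticAt.mul ?_ ?_
    · refine AnalyticAt.cpow (analyticAt_const.sub analyticAt_id) analyticAt_const ?_
      rw [h1, Complex.ofReal_mem_slitPlane]
      linarith
    · refine AnalyticAt.fun_comp (g := ₂F₁ a (c - b) c) (analyticAt_gauss _ _ _ hc ?_)
        (AnalyticAt.div analyticAt_id (analyticAt_id.sub analyticAt_const) h3)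
      rw [h2, ← Complex.ofReal_neg, ← Complex.ofReal_div, Complex.norm_real, neg_div_neg_eq,
        Real.norm_of_nonneg (by positivity), div_lt_one (by positivity)]
      linarith
  · filter_upwards [Metric.ball_mem_nhds (0 : ℂ) (by norm_num : (0 : ℝ) < 1 / 4)] with x hx
    exact pfaff_of_norm_lt a b c hc (by simpa using hx)

lemma gaussF_eq (a b c : ℂ) (hc : ∀ n : ℕ, c ≠ -(n : ℂ)) {ξ : ℝ} (hξ0 : 0 < ξ) (hξ1 : ξ < 1) :
    gaussF a b c ((ξ : ℂ) / ((ξ : ℂ) - 1)) = (1 - (ξ : ℂ)) ^ a * ₂F₁ a (c - b) c (ξ : ℂ) := by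
  rw [(isGaussBranch_pfaff a b c hc hξ0 hξ1).gaussF_eq]
  have h1 : (1 : ℂ) - ξ ≠ 0 := by
    have : (1 - ξ : ℝ) ≠ 0 := by linarith
    exact_mod_cast this
  have h1' : (ξ : ℂ) - 1 ≠ 0 := by rw [← neg_sub]; exact neg_ne_zero.2 h1
  have h2 : 1 - (ξ : ℂ) / ((ξ : ℂ) - 1) = (1 - (ξ : ℂ))⁻¹ := by
    field_simp; ring
  have h3 : (ξ : ℂ) / ((ξ : ℂ) - 1) / ((ξ : ℂ) / ((ξ : ℂ) - 1) - 1) = ξ := by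
    have : (ξ : ℂ) / ((ξ : ℂ) - 1) - 1 = ((ξ : ℂ) - 1)⁻¹ := by field_simp; ring
    rw [this]; field_simp
  have h4 : (1 - (ξ : ℂ)).arg ≠ Real.pi := by
    rw [← Complex.ofReal_one, ← Complex.ofReal_sub, Complex.arg_ofReal_of_nonneg (by linarith)]
    exact Real.pi_pos.ne
  simp only [h2, h3, Complex.inv_cpow _ _ h4, Complex.cpow_neg, inv_inv]

lemma gaussF_comm (a b c : ℂ) (hc : ∀ n : ℕ, c ≠ -(n : ℂ)) {ξ : ℝ} (hξ0 : 0 < ξ) (hξ1 : ξ < 1) :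
    gaussF a b c ((ξ : ℂ) / ((ξ : ℂ) - 1)) = gaussF b a c ((ξ : ℂ) / ((ξ : ℂ) - 1)) := by
  have h := isGaussBranch_pfaff a b c hc hξ0 hξ1
  have h' : IsGaussBranch b a c ((ξ : ℂ) / ((ξ : ℂ) - 1))
      fun x => (1 - x) ^ (-a) * ₂F₁ a (c - b) c (x / (x - 1)) := by
    refine ⟨h.1, ?_⟩
    have := h.2
    simpa only [ordinaryHypergeometric, ordinaryHypergeometricSeries_symm b a c] using this
  rw [h.gaussF_eq, h'.gaussF_eq]

/-! ### Partial fractions of the Gauss function in its lower parameter -/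

lemma ne_neg_nat_of_re_pos {c : ℂ} (hc : 0 < c.re) (n : ℕ) : c ≠ -(n : ℂ) := by
  rintro rfl
  rw [Complex.neg_re, Complex.natCast_re] at hc
  have : (0 : ℝ) ≤ n := n.cast_nonneg
  linarith

lemma re_le_norm_add_nat {c : ℂ} (n : ℕ) : c.re ≤ ‖c + n‖ := by
  refine le_trans ?_ (Complex.re_le_norm _)
  simp

lemma summable_norm_double (a b c : ℂ) {x : ℂ} (hx : ‖x‖ < 1) :
    Summable fun p : ℕ × ℕ => ‖poch a (p.1 + p.2) / (p.1 + p.2).factorial * x ^ (p.1 + p.2) *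
      ((poch b p.1 / p.1.factorial) * (poch c p.2 / p.2.factorial))‖ := by
  obtain ⟨r, hr, hrx⟩ := exists_one_lt_pow_mul_lt_one hx 2
  obtain ⟨A, hA, h1⟩ := exists_norm_poch_div_factorial_le a hr
  obtain ⟨B, hB, h2⟩ := exists_norm_poch_div_factorial_le b hr
  obtain ⟨C, hC, h3⟩ := exists_norm_poch_div_factorial_le c hr
  have hg := summable_geometric_of_lt_one (by positivity) hrx
  refine Summable.of_nonneg_of_le (fun _ => norm_nonneg _) ?_
    ((hg.mul_of_nonneg hg (fun _ => by positivity) fun _ => by positivity).mul_left (A * B * C))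
  rintro ⟨j, m⟩
  rw [norm_mul, norm_mul, norm_mul, norm_pow]
  calc _ ≤ (A * r ^ (j + m)) * ‖x‖ ^ (j + m) * ((B * r ^ j) * (C * r ^ m)) := by
        gcongr
        exacts [h1 _, h2 _, h3 _]
    _ = _ := by simp only [mul_pow, ← pow_mul, pow_add]; ring

/-- The coefficient of `1 / (c + j)` in the partial fractions of `F(a, b; c + 1; w) / c`, where
`w = ξ / (ξ - 1)`. -/
def resG (a b : ℂ) (ξ : ℝ) (j : ℕ) : ℂ :=
  (1 - (ξ : ℂ)) ^ (a + b - 1) * (poch a j * poch b j * (ξ : ℂ) ^ j / (j.factorial * j.factorial)) *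
    gaussF (1 - a) (1 - b) (j + 1) ((ξ : ℂ) / ((ξ : ℂ) - 1))

/-- Minus the coefficient of `1 / (c + j)` in the partial fractions of `F(a, b; c; w)`, where
`w = ξ / (ξ - 1)`. -/
def resF (a b : ℂ) (ξ : ℝ) (j : ℕ) : ℂ :=
  (1 - (ξ : ℂ)) ^ (a + b - 1) *
    (poch a (j + 1) * poch b (j + 1) * (ξ : ℂ) ^ (j + 1) / (j.factorial * (j + 1).factorial)) *
    gaussF (1 - a) (1 - b) (j + 2) ((ξ : ℂ) / ((ξ : ℂ) - 1))

section

variable (a b : ℂ) {ξ : ℝ} (hξ0 : 0 < ξ) (hξ1 : ξ < 1)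

/-- The double family whose sum by rows gives `resG` and by antidiagonals the Gauss series. -/
def dblG (a b : ℂ) (ξ : ℝ) (p : ℕ × ℕ) : ℂ :=
  (1 - (ξ : ℂ)) ^ a * (poch a (p.1 + p.2) / (p.1 + p.2).factorial * (ξ : ℂ) ^ (p.1 + p.2) *
    ((poch b p.1 / p.1.factorial) * (poch (1 - b) p.2 / p.2.factorial)))

/-- The double family whose sum by rows gives `resF` and by antidiagonals the Gauss series. -/
def dblF (a b : ℂ) (ξ : ℝ) (p : ℕ × ℕ) : ℂ :=
  (1 - (ξ : ℂ)) ^ a * (poch a (p.1 + p.2 + 1) / (p.1 + p.2 + 1).factorial *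
    (ξ : ℂ) ^ (p.1 + p.2 + 1) *
      ((poch b (p.1 + 1) / p.1.factorial) * (poch (1 - b) p.2 / p.2.factorial)))

include hξ1 in
lemma one_sub_ne : (1 : ℂ) - ξ ≠ 0 := by
  have : (1 - ξ : ℝ) ≠ 0 := by linarith
  exact_mod_cast this

include hξ0 hξ1 in
lemma norm_xi_lt : ‖(ξ : ℂ)‖ < 1 := by
  rwa [Complex.norm_real, Real.norm_of_nonneg hξ0.le]

include hξ0 hξ1

lemma summable_norm_dblG : Summable fun p => ‖dblG a b ξ p‖ := by
  refine ((summable_norm_double a b (1 - b) (norm_xi_lt hξ0 hξ1)).mul_left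
    ‖(1 - (ξ : ℂ)) ^ a‖).congr fun p => ?_
  exact (norm_mul _ _).symm

lemma summable_norm_dblF : Summable fun p => ‖dblF a b ξ p‖ := by
  refine Summable.of_nonneg_of_le (fun _ => norm_nonneg _) ?_
    ((summable_norm_double (a + 1) (b + 1) (1 - b) (norm_xi_lt hξ0 hξ1)).mul_left
    (‖(1 - (ξ : ℂ)) ^ a‖ * ‖a * b * ξ‖))
  rintro ⟨j, m⟩
  have e : dblF a b ξ (j, m) = (1 - (ξ : ℂ)) ^ a * (a * b * ξ) *
      (poch (a + 1) (j + m) / (j + m).factorial * (ξ : ℂ) ^ (j + m) *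
      ((poch (b + 1) j / j.factorial) * (poch (1 - b) m / m.factorial))) *
      ((j + m + 1 : ℕ) : ℂ)⁻¹ := by
    simp only [dblF]
    rw [poch_succ_left, poch_succ_left, Nat.factorial_succ, pow_succ, Nat.cast_mul]
    have := fact_ne (j + m)
    have h : ((j + m + 1 : ℕ) : ℂ) ≠ 0 := by exact_mod_cast (j + m).succ_ne_zero
    field_simp
  rw [e, norm_mul, norm_mul, norm_mul]
  refine mul_le_of_le_one_right (by positivity) ?_
  rw [norm_inv, Complex.norm_natCast]
  exact inv_le_one_of_one_le₀ (by exact_mod_cast Nat.succ_pos _)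

lemma hasSum_dblG_row (j : ℕ) : HasSum (fun m => dblG a b ξ (j, m)) (resG a b ξ j) := by
  have hc : 0 < ((j : ℂ) + 1).re := by simp; positivity
  have h := (hasSum_gauss (1 - b) (j + 1 - (1 - a)) (j + 1) (ne_neg_nat_of_re_pos hc)
    (norm_xi_lt hξ0 hξ1)).mul_left ((1 - (ξ : ℂ)) ^ a * (poch a j * poch b j * (ξ : ℂ) ^ j /
      (j.factorial * j.factorial)))
  have e : resG a b ξ j = (1 - (ξ : ℂ)) ^ a * (poch a j * poch b j * (ξ : ℂ) ^ j /
      (j.factorial * j.factorial)) * ₂F₁ (1 - b) (j + 1 - (1 - a)) (j + 1) (ξ : ℂ) := by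
    rw [resG, gaussF_comm _ _ _ (ne_neg_nat_of_re_pos hc) hξ0 hξ1,
      gaussF_eq _ _ _ (ne_neg_nat_of_re_pos hc) hξ0 hξ1]
    have h1 : (1 - (ξ : ℂ)) ^ a = (1 - (ξ : ℂ)) ^ (a + b - 1) * (1 - (ξ : ℂ)) ^ (1 - b) := by
      rw [← Complex.cpow_add _ _ (one_sub_ne hξ1)]; congr 1; ring
    rw [h1]; ring
  rw [e]
  refine h.congr_fun fun m => ?_
  have h1 : poch (j + 1) m * j.factorial = (j + m).factorial := by
    rw [← poch_one, ← poch_one, poch_add]; ring_nf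
  have h2 := poch_ne_zero (ne_neg_nat_of_re_pos hc) m
  rw [dblG, poch_add, ← h1, pow_add, show (j : ℂ) + 1 - (1 - a) = a + j by ring]
  have := fact_ne j
  have := fact_ne m
  field_simp

lemma hasSum_dblF_row (j : ℕ) : HasSum (fun m => dblF a b ξ (j, m)) (resF a b ξ j) := by
  have hc : 0 < ((j : ℂ) + 2).re := by simp; positivity
  have h := (hasSum_gauss (1 - b) (j + 2 - (1 - a)) (j + 2) (ne_neg_nat_of_re_pos hc)
    (norm_xi_lt hξ0 hξ1)).mul_left ((1 - (ξ : ℂ)) ^ a *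
      (poch a (j + 1) * poch b (j + 1) * (ξ : ℂ) ^ (j + 1) / (j.factorial * (j + 1).factorial)))
  have e : resF a b ξ j = (1 - (ξ : ℂ)) ^ a *
      (poch a (j + 1) * poch b (j + 1) * (ξ : ℂ) ^ (j + 1) / (j.factorial * (j + 1).factorial)) *
        ₂F₁ (1 - b) (j + 2 - (1 - a)) (j + 2) (ξ : ℂ) := by
    rw [resF, gaussF_comm _ _ _ (ne_neg_nat_of_re_pos hc) hξ0 hξ1,
      gaussF_eq _ _ _ (ne_neg_nat_of_re_pos hc) hξ0 hξ1]
    have h1 : (1 - (ξ : ℂ)) ^ a = (1 - (ξ : ℂ)) ^ (a + b - 1) * (1 - (ξ : ℂ)) ^ (1 - b) := by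
      rw [← Complex.cpow_add _ _ (one_sub_ne hξ1)]; congr 1; ring
    rw [h1]; ring
  rw [e]
  refine h.congr_fun fun m => ?_
  have h1 : poch (j + 2) m * (j + 1).factorial = (j + m + 1).factorial := by
    rw [add_right_comm, ← poch_one, ← poch_one, poch_add 1 (j + 1) m]; push_cast; ring_nf
  have h2 := poch_ne_zero (ne_neg_nat_of_re_pos hc) m
  rw [dblF, ← h1, add_right_comm j m 1, poch_add a (j + 1), pow_add (ξ : ℂ) (j + 1),
    show (j : ℂ) + 2 - (1 - a) = a + (j + 1 : ℕ) by push_cast; ring]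
  have := fact_ne (j + 1)
  have := fact_ne j
  have := fact_ne m
  field_simp

lemma summable_norm_resG : Summable fun j => ‖resG a b ξ j‖ := by
  have h := summable_norm_dblG a b hξ0 hξ1
  refine Summable.of_nonneg_of_le (fun _ => norm_nonneg _) (fun j => ?_) h.prod
  rw [← (hasSum_dblG_row a b hξ0 hξ1 j).tsum_eq]
  exact norm_tsum_le_tsum_norm (h.prod_factor j)

lemma summable_norm_resF : Summable fun j => ‖resF a b ξ j‖ := by
  have h := summable_norm_dblF a b hξ0 hξ1
  refine Summable.of_nonneg_of_le (fun _ => norm_nonneg _) (fun j => ?_) h.prod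
  rw [← (hasSum_dblF_row a b hξ0 hξ1 j).tsum_eq]
  exact norm_tsum_le_tsum_norm (h.prod_factor j)

omit hξ0 hξ1 in
lemma summable_div_add {f : ℕ × ℕ → ℂ} (hf : Summable fun p => ‖f p‖) {c : ℂ} (hc : 0 < c.re) :
    Summable fun p : ℕ × ℕ => f p / (c + p.1) := by
  refine Summable.of_norm_bounded (hf.mul_right c.re⁻¹) fun p => ?_
  rw [norm_div, div_eq_mul_inv]
  have := re_le_norm_add_nat (c := c) p.1
  gcongr

/-- Partial fractions of `F(a, b; c + 1; w) / c` in `c`. -/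
lemma hasSum_resG_div {c : ℂ} (hc : 0 < c.re) :
    HasSum (fun j : ℕ => resG a b ξ j / (c + j))
      (gaussF a b (c + 1) ((ξ : ℂ) / ((ξ : ℂ) - 1)) / c) := by
  have hc1 : 0 < (c + 1).re := by simp; linarith
  have hs := (summable_div_add (summable_norm_dblG a b hξ0 hξ1) hc).hasSum
  have h1 : HasSum (fun j : ℕ => resG a b ξ j / (c + j))
      (∑' p : ℕ × ℕ, dblG a b ξ p / (c + p.1)) :=
    HasSum.prod_fiberwise hs fun j =>
      (hasSum_dblG_row a b hξ0 hξ1 j).div_const (c + (j : ℂ))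
  have hg := ((hasSum_gauss a (c + 1 - b) (c + 1) (ne_neg_nat_of_re_pos hc1)
    (norm_xi_lt hξ0 hξ1)).mul_left ((1 - (ξ : ℂ)) ^ a)).div_const c
  rw [← gaussF_eq _ _ _ (ne_neg_nat_of_re_pos hc1) hξ0 hξ1] at hg
  rwa [← (HasSum.sum_antidiagonal hs).unique (hg.congr_fun fun n => ?_)]
  have h2 := poch_div_poch_partialFraction (1 - b) c (ne_neg_nat_of_re_pos hc) n
  have h3 : poch c (n + 1) = c * poch (c + 1) n := poch_succ_left c n
  have h4 : ∑ p ∈ antidiagonal n, dblG a b ξ p / (c + p.1) =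
      (1 - (ξ : ℂ)) ^ a * (poch a n / n.factorial * (ξ : ℂ) ^ n) *
      ∑ p ∈ antidiagonal n, (poch (1 - (1 - b)) p.1 / p.1.factorial) *
        (poch (1 - b) p.2 / p.2.factorial) / (c + p.1) := by
    rw [Finset.mul_sum]
    refine Finset.sum_congr rfl fun p hp => ?_
    rw [Finset.HasAntidiagonal.mem_antidiagonal] at hp
    rw [dblG, hp, sub_sub_cancel]
    ring
  rw [h4, ← h2, h3, show c + (1 - b) = c + 1 - b by ring]
  ring

/-- Partial fractions of `F(a, b; c; w)` in `c`. -/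
lemma hasSum_resF_div {c : ℂ} (hc : 0 < c.re) :
    HasSum (fun j : ℕ => resF a b ξ j / (c + j))
      (1 - gaussF a b c ((ξ : ℂ) / ((ξ : ℂ) - 1))) := by
  have hs := (summable_div_add (summable_norm_dblF a b hξ0 hξ1) hc).hasSum
  have h1 : HasSum (fun j : ℕ => resF a b ξ j / (c + j))
      (∑' p : ℕ × ℕ, dblF a b ξ p / (c + p.1)) :=
    HasSum.prod_fiberwise hs fun j =>
      (hasSum_dblF_row a b hξ0 hξ1 j).div_const (c + (j : ℂ))
  have hb := (hasSum_binomial a (norm_xi_lt hξ0 hξ1)).mul_left ((1 - (ξ : ℂ)) ^ a)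
  rw [← Complex.cpow_add _ _ (one_sub_ne hξ1), add_neg_cancel, Complex.cpow_zero] at hb
  have hg := hb.sub ((hasSum_gauss a (c - b) c (ne_neg_nat_of_re_pos hc)
    (norm_xi_lt hξ0 hξ1)).mul_left ((1 - (ξ : ℂ)) ^ a))
  rw [← gaussF_eq _ _ _ (ne_neg_nat_of_re_pos hc) hξ0 hξ1] at hg
  rw [← hasSum_nat_add_iff' 1] at hg
  simp only [Finset.sum_range_one, poch_zero, Nat.factorial_zero, Nat.cast_one, div_one, pow_zero,
    mul_one, sub_self, sub_zero] at hg
  rwa [← (HasSum.sum_antidiagonal hs).unique (hg.congr_fun fun n => ?_)]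
  have h4 : ∑ p ∈ antidiagonal n, dblF a b ξ p / (c + p.1) =
      (1 - (ξ : ℂ)) ^ a * (poch a (n + 1) / (n + 1).factorial * (ξ : ℂ) ^ (n + 1)) *
      ∑ p ∈ antidiagonal n, (poch b (p.1 + 1) / p.1.factorial) *
        (poch (1 - b) p.2 / p.2.factorial) / (c + p.1) := by
    rw [Finset.mul_sum]
    refine Finset.sum_congr rfl fun p hp => ?_
    rw [Finset.HasAntidiagonal.mem_antidiagonal] at hp
    rw [dblF, hp]
    ring
  rw [h4, poch_sub_div_poch_partialFraction b c (ne_neg_nat_of_re_pos hc) n]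
  ring

/-- The sum of all `resF a b ξ j`, which is minus the coefficient of `1 / c` in the expansion of
`F(a, b; c; w)` at `c = ∞`. -/
lemma hasSum_resF : HasSum (fun j : ℕ => resF a b ξ j) (a * b * ξ / (1 - ξ)) := by
  have hs := (summable_norm_dblF a b hξ0 hξ1).of_norm.hasSum
  have h1 := HasSum.prod_fiberwise hs fun j => hasSum_dblF_row a b hξ0 hξ1 j
  have hb := (hasSum_binomial (a + 1) (norm_xi_lt hξ0 hξ1)).mul_left
    ((1 - (ξ : ℂ)) ^ a * (a * b * ξ))
  have e : (1 - (ξ : ℂ)) ^ a * (a * b * ξ) * (1 - (ξ : ℂ)) ^ (-(a + 1)) =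
      a * b * ξ / (1 - ξ) := by
    have h2 : (1 - (ξ : ℂ)) ^ a * (1 - (ξ : ℂ)) ^ (-(a + 1)) = (1 - (ξ : ℂ))⁻¹ := by
      rw [← Complex.cpow_add _ _ (one_sub_ne hξ1), ← Complex.cpow_neg_one]
      congr 1; ring
    rw [mul_right_comm, h2]; ring
  rw [e] at hb
  rwa [← (HasSum.sum_antidiagonal hs).unique (hb.congr_fun fun n => ?_)]
  have h4 : ∑ p ∈ antidiagonal n, dblF a b ξ p =
      (1 - (ξ : ℂ)) ^ a * (poch a (n + 1) / (n + 1).factorial * (ξ : ℂ) ^ (n + 1)) *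
      ∑ p ∈ antidiagonal n, (poch b (p.1 + 1) / p.1.factorial) *
        (poch (1 - b) p.2 / p.2.factorial) := by
    rw [Finset.mul_sum]
    refine Finset.sum_congr rfl fun p hp => ?_
    rw [Finset.HasAntidiagonal.mem_antidiagonal] at hp
    rw [dblF, hp]; ring
  rw [h4, sum_poch_succ_mul_poch, poch_succ_left, Nat.factorial_succ]
  have := fact_ne n
  have h : (n : ℂ) + 1 ≠ 0 := by exact_mod_cast n.succ_ne_zero
  push_cast
  field_simp
  ring

end

/-- A series of simple poles at the negative integers may be differentiated term by term. -/
lemma hasDerivAt_tsum_div {r : ℕ → ℂ} (hr : Summable fun j => ‖r j‖) {u : ℂ} (hu : 0 ≤ u.re) :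
    HasDerivAt (fun v : ℂ => ∑' j, r j / (v + 1 + j)) (-∑' j, r j / (u + 1 + j) ^ 2) u := by
  set t : Set ℂ := {v | -(1 / 2) < v.re} with ht
  have hlow : ∀ v ∈ t, ∀ j : ℕ, 1 / 2 ≤ ‖v + 1 + j‖ := by
    intro v hv j
    refine le_trans ?_ (re_le_norm_add_nat j)
    have hv' : -(1 / 2) < v.re := hv
    simp; linarith
  have hut : u ∈ t := by change -(1 / 2) < u.re; linarith
  have h := hasDerivAt_tsum_of_isPreconnected (u := fun j => ‖r j‖ * 4) (t := t)
    (g := fun j v => r j / (v + 1 + j)) (g' := fun j v => -(r j / (v + 1 + j) ^ 2)) (y₀ := u)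
    (y := u) (hr.mul_right 4) (isOpen_lt continuous_const Complex.continuous_re)
    (convex_halfSpace_re_gt _).isPreconnected ?_ ?_ hut ?_ hut
  · rwa [tsum_neg] at h
  · intro j v hv
    have h1 : v + 1 + j ≠ 0 := by
      rw [← norm_pos_iff]; linarith [hlow v hv j]
    have h2 : HasDerivAt (fun v : ℂ => v + 1 + j) 1 v := by
      simpa using ((hasDerivAt_id v).add_const (1 : ℂ)).add_const (j : ℂ)
    convert! (hasDerivAt_const v (r j)).div h2 h1 using 1
    ring
  · intro j v hv
    have h1 := hlow v hv j
    rw [norm_neg, norm_div, norm_pow, div_eq_mul_inv]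
    gcongr
    rw [inv_le_comm₀ (by positivity) (by norm_num)]
    nlinarith
  · refine Summable.of_norm_bounded (hr.mul_right 2) fun j => ?_
    have h1 := hlow u hut j
    rw [norm_div, div_eq_mul_inv]
    gcongr
    rw [inv_le_comm₀ (by positivity) (by norm_num)]
    linarith

/-! ### Dual pairs of sequences and the resolvent identity -/

/-- Sequences `F, G` and `F', G'` that are Cauchy transforms of each other with respect to the
weights `a²` and `b²`. If `A(k, l) = a_k b_l / (k + l + 1)` and `L = [0, A; -Aᵗ, 0]`, the relations
say that `(a F, b G')` and `(-a G, b F')` solve `(1 + L) f = (a, 0)` and `(1 + L) f = (0, b)`. -/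
structure DualPair (a b F G F' G' : ℕ → ℂ) : Prop where
  summable_a : Summable fun k => ‖a k‖
  summable_b : Summable fun k => ‖b k‖
  bounded : ∃ C : ℝ, ∀ k, ‖F k‖ ≤ C ∧ ‖G k‖ ≤ C ∧ ‖F' k‖ ≤ C ∧ ‖G' k‖ ≤ C
  hF : ∀ k : ℕ, HasSum (fun l : ℕ => b l ^ 2 * G' l / (k + l + 1)) (1 - F k)
  hG : ∀ k : ℕ, HasSum (fun l : ℕ => b l ^ 2 * F' l / (k + l + 1)) (G k)
  hF' : ∀ l : ℕ, HasSum (fun k : ℕ => a k ^ 2 * G k / (l + k + 1)) (1 - F' l)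
  hG' : ∀ l : ℕ, HasSum (fun k : ℕ => a k ^ 2 * F k / (l + k + 1)) (G' l)

/-- The matrix `A(k, l) = a_k b_l / (k + l + 1)`. -/
def cauchyMat (a b : ℕ → ℂ) (k l : ℕ) : ℂ := a k * b l / (k + l + 1)

/-- The off-diagonal block `a_k b_l (F_k F'_l + G_k G'_l) / (k + l + 1)`. -/
def offBlock (a b F G F' G' : ℕ → ℂ) (k l : ℕ) : ℂ :=
  a k * b l * (F k * F' l + G k * G' l) / (k + l + 1)

lemma natCast_add_one_ne (k l : ℕ) : (k : ℂ) + l + 1 ≠ 0 := by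
  exact_mod_cast (k + l).succ_ne_zero

lemma norm_div_natCast_add_one_le (x : ℂ) (k l : ℕ) : ‖x / ((k : ℂ) + l + 1)‖ ≤ ‖x‖ := by
  rw [norm_div]
  refine div_le_self (norm_nonneg _) ?_
  rw [show (k : ℂ) + l + 1 = ((k + l + 1 : ℕ) : ℂ) by push_cast; ring, Complex.norm_natCast]
  exact_mod_cast Nat.succ_pos _

lemma cauchyMat_swap (a b : ℕ → ℂ) (k l : ℕ) : cauchyMat b a l k = cauchyMat a b k l := by
  simp only [cauchyMat]; ring

lemma offBlock_swap (a b F G F' G' : ℕ → ℂ) (k l : ℕ) :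
    offBlock b a F' G' F G l k = offBlock a b F G F' G' k l := by
  simp only [offBlock]; ring

namespace DualPair

variable {a b F G F' G' : ℕ → ℂ}

lemma symm (h : DualPair a b F G F' G') : DualPair b a F' G' F G where
  summable_a := h.summable_b
  summable_b := h.summable_a
  bounded := by
    obtain ⟨C, hC⟩ := h.bounded
    exact ⟨C, fun k => ⟨(hC k).2.2.1, (hC k).2.2.2, (hC k).1, (hC k).2.1⟩⟩
  hF := h.hF'
  hG := h.hG'
  hF' := h.hF
  hG' := h.hG

lemma exists_norm_offBlock_le (h : DualPair a b F G F' G') :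
    ∃ C : ℝ, 0 ≤ C ∧ ∀ k l, ‖offBlock a b F G F' G' k l‖ ≤ C * (‖a k‖ * ‖b l‖) := by
  obtain ⟨C, hC⟩ := h.bounded
  have hC0 : 0 ≤ C := (norm_nonneg _).trans (hC 0).1
  refine ⟨C * C + C * C, by positivity, fun k l => (norm_div_natCast_add_one_le _ _ _).trans ?_⟩
  rw [norm_mul, norm_mul, mul_comm]
  gcongr
  refine (norm_add_le _ _).trans ?_
  rw [norm_mul, norm_mul]
  obtain ⟨h1, h2, -, -⟩ := hC k
  obtain ⟨-, -, h3, h4⟩ := hC l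
  gcongr

lemma norm_cauchyMat_le (a b : ℕ → ℂ) (k l : ℕ) : ‖cauchyMat a b k l‖ ≤ ‖a k‖ * ‖b l‖ :=
  (norm_div_natCast_add_one_le _ _ _).trans (norm_mul _ _).le

lemma exists_bound_a (h : DualPair a b F G F' G') : ∃ C : ℝ, ∀ k, ‖a k‖ ≤ C :=
  ⟨∑' k, ‖a k‖, fun k => h.summable_a.le_tsum k fun _ _ => norm_nonneg _⟩

/-- The block `A Bᵗ` off its diagonal, by partial fractions of `1 / ((k + m + 1) (l + m + 1))`. -/
lemma hasSum_diag_of_ne (h : DualPair a b F G F' G') {k l : ℕ} (hkl : k ≠ l) :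
    HasSum (fun m => cauchyMat a b k m * offBlock a b F G F' G' l m)
      (a k * a l * (F k * G l - G k * F l) / (k - l)) := by
  have hkl' : (k : ℂ) - l ≠ 0 := sub_ne_zero.2 (by exact_mod_cast hkl)
  have h1 := ((((h.hG l).sub (h.hG k)).mul_left (F l)).add
    (((h.hF l).sub (h.hF k)).mul_left (G l))).mul_left (a k * a l / (k - l))
  have e : a k * a l * (F k * G l - G k * F l) / (k - l) = a k * a l / (k - l) *
      (F l * (G l - G k) + G l * (1 - F l - (1 - F k))) := by ring
  rw [e]
  refine h1.congr_fun fun m => ?_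
  have := natCast_add_one_ne k m
  have := natCast_add_one_ne l m
  simp only [cauchyMat, offBlock]
  field_simp
  ring

/-- The block `A Bᵗ` on its diagonal: `f` and `g` are the derivatives of `F` and
`-G` with respect to `k`. -/
lemma hasSum_diag_self {k : ℕ} {f g : ℂ}
    (hf : HasSum (fun m : ℕ => b m ^ 2 * G' m / (k + m + 1) ^ 2) f)
    (hg : HasSum (fun m : ℕ => b m ^ 2 * F' m / (k + m + 1) ^ 2) g) :
    HasSum (fun m => cauchyMat a b k m * offBlock a b F G F' G' k m)
      (a k ^ 2 * (F k * g + G k * f)) := by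
  refine (((hg.mul_left (F k)).add (hf.mul_left (G k))).mul_left (a k ^ 2)).congr_fun fun m => ?_
  have := natCast_add_one_ne k m
  simp only [cauchyMat, offBlock]
  field_simp

lemma summable_norm_prod (h : DualPair a b F G F' G') :
    Summable fun p : ℕ × ℕ => ‖a p.1‖ * ‖b p.2‖ :=
  h.summable_a.mul_of_nonneg h.summable_b (fun _ => norm_nonneg _) fun _ => norm_nonneg _

/-- The relation `B b = a G`. -/
lemma hasSum_offBlock_mul (h : DualPair a b F G F' G') (k : ℕ) :
    HasSum (fun m => b m * offBlock a b F G F' G' k m) (a k * G k) := by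
  have h1 := (((h.hG k).mul_left (F k)).add ((h.hF k).mul_left (G k))).mul_left (a k)
  rw [show a k * (F k * G k + G k * (1 - F k)) = a k * G k by ring] at h1
  refine h1.congr_fun fun m => ?_
  simp only [offBlock]
  ring

/-- The relation `(Aᵗ B) b = Aᵗ (B b) = b (1 - F')`. -/
lemma hasSum_mul_diag (h : DualPair a b F G F' G') (l : ℕ) {D : ℕ → ℂ}
    (hD : ∀ m, HasSum (fun j => cauchyMat a b j m * offBlock a b F G F' G' j l) (D m)) :
    HasSum (fun m => b m * D m) (b l * (1 - F' l)) := by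
  -- `Aᵗ B` is symmetric
  have hD' : ∀ m, HasSum (fun j => cauchyMat a b j l * offBlock a b F G F' G' j m) (D m) := by
    intro m
    rcases eq_or_ne m l with rfl | hml
    · exact hD m
    · have h1 := h.symm.hasSum_diag_of_ne hml
      have h2 := h.symm.hasSum_diag_of_ne hml.symm
      simp only [cauchyMat_swap, offBlock_swap] at h1 h2
      rw [(hD m).unique h1]
      convert h2 using 1
      have h3 : (m : ℂ) - l ≠ 0 := sub_ne_zero.2 (by exact_mod_cast hml)
      have h4 : (l : ℂ) - m ≠ 0 := sub_ne_zero.2 (by exact_mod_cast hml.symm)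
      field_simp
      ring
  obtain ⟨C, hC0, hC⟩ := h.exists_norm_offBlock_le
  obtain ⟨A, hA⟩ := h.exists_bound_a
  obtain ⟨B, hB⟩ := h.symm.exists_bound_a
  have hA0 : 0 ≤ A := (norm_nonneg _).trans (hA 0)
  have hB0 : 0 ≤ B := (norm_nonneg _).trans (hB 0)
  have hs : Summable fun p : ℕ × ℕ =>
      b p.1 * (cauchyMat a b p.2 l * offBlock a b F G F' G' p.2 p.1) := by
    refine Summable.of_norm_bounded
      ((h.symm.summable_norm_prod.mul_left (B * (A * B * C)))) ?_
    rintro ⟨m, j⟩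
    rw [norm_mul, norm_mul]
    calc _ ≤ B * ((A * B) * (C * (‖a j‖ * ‖b m‖))) := by
          gcongr
          · exact hB m
          · exact (norm_cauchyMat_le a b j l).trans (by gcongr; exacts [hA j, hB l])
          · exact hC j m
      _ = _ := by ring
  have h1 := HasSum.prod_fiberwise hs.hasSum fun m => (hD' m).mul_left (b m)
  have hs' := (Equiv.prodComm ℕ ℕ).hasSum_iff.2 hs.hasSum
  have h2 : HasSum (fun j => cauchyMat a b j l * (a j * G j)) (∑' p : ℕ × ℕ,
      b p.1 * (cauchyMat a b p.2 l * offBlock a b F G F' G' p.2 p.1)) := by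
    refine HasSum.prod_fiberwise hs' fun j =>
      ((h.hasSum_offBlock_mul j).mul_left (cauchyMat a b j l)).congr_fun fun m => ?_
    simp only [Function.comp, Equiv.prodComm_apply, Prod.swap_prod_mk]
    ring
  have h3 : HasSum (fun j => cauchyMat a b j l * (a j * G j)) (b l * (1 - F' l)) := by
    refine ((h.hF' l).mul_left (b l)).congr_fun fun j => ?_
    simp only [cauchyMat]
    ring
  rwa [h2.unique h3] at h1

/-- The resolvent identity `B + A (Aᵗ B) = A`. It is checked after multiplication by
`k + l + 1 = (k + m + 1) - (m - l)`, which turns both products into rank-one sums. -/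
lemma hasSum_cauchyMat_mul_diag (h : DualPair a b F G F' G') (k l : ℕ) {D : ℕ → ℂ}
    (hD : ∀ m, HasSum (fun j => cauchyMat a b j m * offBlock a b F G F' G' j l) (D m)) :
    HasSum (fun m => cauchyMat a b k m * D m)
      (cauchyMat a b k l - offBlock a b F G F' G' k l) := by
  have hml : ∀ m : ℕ, ((m : ℂ) - l) * D m = b m * b l * (F' m * G' l - G' m * F' l) := by
    intro m
    rcases eq_or_ne m l with rfl | hml
    · ring
    · have h1 := h.symm.hasSum_diag_of_ne hml
      simp only [cauchyMat_swap, offBlock_swap] at h1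
      have h3 : (m : ℂ) - l ≠ 0 := sub_ne_zero.2 (by exact_mod_cast hml)
      rw [(hD m).unique h1]
      field_simp
  have h1 := (((h.hasSum_mul_diag l hD).mul_left (a k)).sub
    ((((h.hG k).mul_left (G' l)).sub ((h.hF k).mul_left (F' l))).mul_left (a k * b l))).mul_left
      ((k : ℂ) + l + 1)⁻¹
  have e : cauchyMat a b k l - offBlock a b F G F' G' k l = ((k : ℂ) + l + 1)⁻¹ *
      (a k * (b l * (1 - F' l)) - a k * b l * (G' l * G k - F' l * (1 - F k))) := by
    simp only [cauchyMat, offBlock]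
    ring
  rw [e]
  refine h1.congr_fun fun m => ?_
  have h2 := natCast_add_one_ne k l
  have h3 := natCast_add_one_ne k m
  rw [eq_inv_mul_iff_mul_eq₀ h2]
  simp only [cauchyMat]
  field_simp
  linear_combination (-(a k * b m)) * hml m

/-- The sum of `|x| K(x, x)` over the half-integers `x` is `∑ a_k² G_k`, because the weights
`k + 1/2` and `m + 1/2` add up to the denominator `k + m + 1` of `A(k, m)`. -/
lemma hasSum_trace (h : DualPair a b F G F' G') {D D' : ℕ → ℂ} {s : ℂ}
    (hD : ∀ k, HasSum (fun m => cauchyMat a b k m * offBlock a b F G F' G' k m) (D k))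
    (hD' : ∀ m, HasSum (fun k => cauchyMat a b k m * offBlock a b F G F' G' k m) (D' m))
    (hs : HasSum (fun k => a k ^ 2 * G k) s) :
    ∃ s₁ s₂ : ℂ, HasSum (fun k : ℕ => ((k : ℂ) + 1 / 2) * D k) s₁ ∧
      HasSum (fun k : ℕ => ((k : ℂ) + 1 / 2) * D' k) s₂ ∧ s₁ + s₂ = s := by
  obtain ⟨C, hC0, hC⟩ := h.exists_norm_offBlock_le
  obtain ⟨A, hA⟩ := h.exists_bound_a
  obtain ⟨B, hB⟩ := h.symm.exists_bound_a
  have hA0 : 0 ≤ A := (norm_nonneg _).trans (hA 0)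
  have hB0 : 0 ≤ B := (norm_nonneg _).trans (hB 0)
  have hle : ∀ k m : ℕ, ‖a k * b m * offBlock a b F G F' G' k m‖ ≤
      (A * B * C) * (‖a k‖ * ‖b m‖) := by
    intro k m
    rw [norm_mul, norm_mul]
    calc _ ≤ (A * B) * (C * (‖a k‖ * ‖b m‖)) := by
          gcongr
          exacts [hA k, hB m, hC k m]
      _ = _ := by ring
  have hfrac : ∀ i k m : ℕ, i ≤ k + m → ‖((i : ℂ) + 1 / 2) / (k + m + 1)‖ ≤ 1 := by
    intro i k m hi
    have e1 : (i : ℂ) + 1 / 2 = ((i + 1 / 2 : ℝ) : ℂ) := by push_cast; ring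
    have e2 : (k : ℂ) + m + 1 = ((k + m + 1 : ℝ) : ℂ) := by push_cast; ring
    have hi' : (i : ℝ) ≤ k + m := by exact_mod_cast hi
    rw [e1, e2, ← Complex.ofReal_div, Complex.norm_real, Real.norm_of_nonneg (by positivity)]
    rw [div_le_one (by positivity)]
    linarith
  have hsum : ∀ i : ℕ × ℕ → ℕ, (∀ p, i p ≤ p.1 + p.2) → Summable fun p : ℕ × ℕ =>
      ((i p : ℂ) + 1 / 2) *
        (cauchyMat a b p.1 p.2 * offBlock a b F G F' G' p.1 p.2) := by
    intro i hi
    refine Summable.of_norm_bounded (h.summable_norm_prod.mul_left (A * B * C)) ?_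
    rintro ⟨k, m⟩
    have e : ((i (k, m) : ℂ) + 1 / 2) * (cauchyMat a b k m * offBlock a b F G F' G' k m) =
        ((i (k, m) : ℂ) + 1 / 2) / (k + m + 1) * (a k * b m * offBlock a b F G F' G' k m) := by
      simp only [cauchyMat]; ring
    dsimp only
    rw [e, norm_mul]
    exact (mul_le_of_le_one_left (norm_nonneg _) (hfrac _ _ _ (hi _))).trans (hle k m)
  set f₁ : ℕ × ℕ → ℂ := fun p => ((p.1 : ℂ) + 1 / 2) *
    (cauchyMat a b p.1 p.2 * offBlock a b F G F' G' p.1 p.2) with hf₁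
  set f₂ : ℕ × ℕ → ℂ := fun p => ((p.2 : ℂ) + 1 / 2) *
    (cauchyMat a b p.1 p.2 * offBlock a b F G F' G' p.1 p.2) with hf₂
  have hs1 : HasSum f₁ (∑' p, f₁ p) := (hsum (fun p => p.1) fun p => by simp).hasSum
  have hs2 : HasSum f₂ (∑' p, f₂ p) := (hsum (fun p => p.2) fun p => by simp).hasSum
  have hs2' : HasSum (fun p : ℕ × ℕ => f₂ (p.2, p.1)) (∑' p, f₂ p) :=
    (Equiv.prodComm ℕ ℕ).hasSum_iff.2 hs2
  have h3 : HasSum (fun p : ℕ × ℕ => a p.1 * (b p.2 * offBlock a b F G F' G' p.1 p.2))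
      (∑' p, f₁ p + ∑' p, f₂ p) := by
    refine (hs1.add hs2).congr_fun fun p => ?_
    have hinv := mul_inv_cancel₀ (natCast_add_one_ne p.1 p.2)
    simp only [hf₁, hf₂, cauchyMat, div_eq_mul_inv _ ((p.1 : ℂ) + p.2 + 1)]
    linear_combination (-(a p.1 * b p.2 * offBlock a b F G F' G' p.1 p.2)) * hinv
  have r1 : ∀ k : ℕ, HasSum (fun m : ℕ => f₁ (k, m)) (((k : ℂ) + 1 / 2) * D k) := fun k => by
    simpa only [hf₁] using (hD k).mul_left ((k : ℂ) + 1 / 2)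
  have r2 : ∀ m : ℕ, HasSum (fun k : ℕ => f₂ (k, m)) (((m : ℂ) + 1 / 2) * D' m) := fun m => by
    simpa only [hf₂] using (hD' m).mul_left ((m : ℂ) + 1 / 2)
  have r3 : ∀ k : ℕ, HasSum (fun m : ℕ => a k * (b m * offBlock a b F G F' G' k m))
      (a k * (a k * G k)) := fun k => (h.hasSum_offBlock_mul k).mul_left (a k)
  have h4 : HasSum (fun k => a k * (a k * G k)) (∑' p, f₁ p + ∑' p, f₂ p) :=
    h3.prod_fiberwise r3
  refine ⟨∑' p, f₁ p, ∑' p, f₂ p, hs1.prod_fiberwise r1, hs2'.prod_fiberwise r2, ?_⟩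
  refine h4.unique (hs.congr_fun fun k => ?_)
  ring

end DualPair

/-! ### Matrices and bounded operators in `ℓ²` -/

section Operators

variable {ι : Type*} [DecidableEq ι]

local notation "ℓ²" => lp (fun _ : ι => ℂ) 2

/-- The basis vector of `ℓ²` with index `y`. -/
def basisVec (y : ι) : ℓ² := lp.single 2 y (1 : ℂ)

lemma basisVec_self (y : ι) : (basisVec y : ℓ²) y = 1 := lp.single_apply_self _ _ _

lemma basisVec_ne {x y : ι} (h : x ≠ y) : (basisVec y : ℓ²) x = 0 := lp.single_apply_ne _ _ _ h

lemma single_eq_smul (y : ι) (c : ℂ) :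
    (lp.single 2 y c : ℓ²) = c • (basisVec y : ℓ²) := by
  rw [basisVec, ← lp.single_smul, smul_eq_mul, mul_one]

omit [DecidableEq ι] in
lemma norm_apply_le (f : ℓ²) (x : ι) : ‖f x‖ ≤ ‖f‖ := lp.norm_apply_le_norm two_ne_zero f x

/-- A bounded operator acts by its matrix. -/
lemma hasSum_apply (T : ℓ² →L[ℂ] ℓ²) (f : ℓ²) (x : ι) :
    HasSum (fun y => f y * T (basisVec y) x) (T f x) := by
  have h1 := (lp.hasSum_single (by norm_num) f).mapL T
  have h2 := h1.mapL (lp.evalCLM ℂ (fun _ : ι => ℂ) 2 x)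
  refine h2.congr_fun fun y => ?_
  rw [single_eq_smul, map_smul]
  rfl

/-- A matrix with entries bounded by `α x * α y`, where `α` is summable, is the matrix of a bounded
operator. -/
lemma exists_operator {M : ι → ι → ℂ} {α : ι → ℝ} (hα : Summable α)
    (hM : ∀ x y, ‖M x y‖ ≤ α x * α y) :
    ∃ T : ℓ² →L[ℂ] ℓ², ∀ x y, T (basisVec y) x = M x y := by
  set R : ι × ι → (ℓ² →L[ℂ] ℓ²) := fun p =>
    (lp.evalCLM ℂ (fun _ : ι => ℂ) 2 p.2).smulRight (M p.1 p.2 • (basisVec p.1 : ℓ²)) with hR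
  have hev : ∀ y : ι, ‖lp.evalCLM ℂ (fun _ : ι => ℂ) 2 y‖ ≤ 1 := fun y =>
    ContinuousLinearMap.opNorm_le_bound _ zero_le_one fun f => by
      rw [one_mul]; exact norm_apply_le f y
  have hs : Summable R := by
    have h1 : Summable fun p : ι × ι => α p.1 * α p.2 := by
      have hα' : Summable fun x => ‖α x‖ := hα.norm
      exact (hα'.mul_norm hα').of_norm
    refine Summable.of_norm_bounded h1 fun p => ?_
    refine le_trans ?_ (hM p.1 p.2)
    rw [hR, ContinuousLinearMap.norm_smulRight_apply, norm_smul, basisVec,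
      lp.norm_single (by norm_num), norm_one, mul_one]
    exact mul_le_of_le_one_left (norm_nonneg _) (hev _)
  refine ⟨∑' p, R p, fun x y => ?_⟩
  have h1 := (hs.hasSum.mapL (ContinuousLinearMap.apply ℂ ℓ² (basisVec y))).mapL
    (lp.evalCLM ℂ (fun _ : ι => ℂ) 2 x)
  have e : ∀ p : ι × ι, lp.evalCLM ℂ (fun _ : ι => ℂ) 2 x
      (ContinuousLinearMap.apply ℂ ℓ² (basisVec y) (R p)) =
      (basisVec y : ℓ²) p.2 * (M p.1 p.2 * (basisVec p.1 : ℓ²) x) := fun p => rfl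
  simp only [e] at h1
  refine h1.unique ?_
  have h2 := hasSum_single (f := fun p : ι × ι =>
    (basisVec y : ℓ²) p.2 * (M p.1 p.2 * (basisVec p.1 : ℓ²) x)) (x, y) ?_
  · simpa only [basisVec_self, one_mul, mul_one] using h2
  · rintro ⟨x', y'⟩ hne
    by_cases hy : y' = y
    · have hx : x ≠ x' := fun hx => hne (by rw [hx, hy])
      simp only [basisVec_ne hx, mul_zero]
    · simp only [basisVec_ne hy, zero_mul]

lemma inner_basisVec_left (x : ι) (f : ℓ²) : inner ℂ (basisVec x : ℓ²) f = f x := by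
  rw [basisVec, lp.inner_single_left]
  simp

lemma adjoint_eq_neg {T : ℓ² →L[ℂ] ℓ²}
    (hT : ∀ x y, T (basisVec y) x = -(starRingEnd ℂ) (T (basisVec x) y)) :
    ContinuousLinearMap.adjoint T = -T := by
  have h : ∀ y, ContinuousLinearMap.adjoint T (basisVec y) = (-T) (basisVec y) := by
    intro y
    ext x
    rw [← inner_basisVec_left, ContinuousLinearMap.adjoint_inner_right, ← inner_conj_symm,
      inner_basisVec_left]
    change _ = -(T (basisVec y) x)
    rw [hT x y, neg_neg]
  refine lp.ext_continuousLinearMap (by norm_num) fun y => ?_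
  ext1
  exact h y

omit [DecidableEq ι] in
lemma re_inner_apply_eq_zero {T : ℓ² →L[ℂ] ℓ²} (hT : ContinuousLinearMap.adjoint T = -T) (f : ℓ²) :
    (inner ℂ f (T f)).re = 0 := by
  have h := ContinuousLinearMap.adjoint_inner_right T f f
  rw [hT, neg_apply, inner_neg_right, ← inner_conj_symm (T f) f] at h
  have h2 := congrArg Complex.re h
  simp only [Complex.neg_re, Complex.conj_re] at h2
  linarith

omit [DecidableEq ι] in
lemma isUnit_one_add_of_adjoint_eq_neg {T : ℓ² →L[ℂ] ℓ²}
    (hT : ContinuousLinearMap.adjoint T = -T) : IsUnit (1 + T) := by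
  have hs : IsSelfAdjoint ((-Complex.I) • T) := by
    rw [IsSelfAdjoint, star_smul, ContinuousLinearMap.star_eq_adjoint, hT]
    simp
  by_contra hu
  have hmem : Complex.I ∈ spectrum ℂ ((-Complex.I) • T) := by
    rw [spectrum.mem_iff]
    intro h
    apply hu
    have e : algebraMap ℂ (ℓ² →L[ℂ] ℓ²) Complex.I - (-Complex.I) • T =
        Complex.I • (1 + T) := by
      rw [Algebra.algebraMap_eq_smul_one, neg_smul, sub_neg_eq_add, smul_add]
    rw [e] at h
    have h2 := h.smul (Units.mk0 Complex.I Complex.I_ne_zero)⁻¹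
    rwa [Units.smul_def, smul_smul, Units.val_inv_eq_inv_val, Units.val_mk0,
      inv_mul_cancel₀ Complex.I_ne_zero, one_smul] at h2
  have := hs.mem_spectrum_eq_re hmem
  simp at this

lemma one_add_apply_mul_inverse_apply {T : ℓ² →L[ℂ] ℓ²} (hu : IsUnit (1 + T)) (y : ι) :
    (1 + T) ((T * Ring.inverse (1 + T)) (basisVec y)) = T (basisVec y) := by
  have e : (1 + T) * (T * Ring.inverse (1 + T)) = T := by
    have h1 : (1 + T) * T = T * (1 + T) := by noncomm_ring
    rw [← mul_assoc, h1, mul_assoc, Ring.mul_inverse_cancel _ hu, mul_one]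
  rw [← mul_apply_eq_comp, e]

/-- The operator `L (1 + L)⁻¹` is determined, column by column, by the equation `(1 + L) K = L`. -/
lemma mul_inverse_apply_eq {T : ℓ² →L[ℂ] ℓ²} (hu : IsUnit (1 + T)) {y : ι} {κ : ℓ²}
    (h : (1 + T) κ = T (basisVec y)) : (T * Ring.inverse (1 + T)) (basisVec y) = κ := by
  have hinv : ∀ f : ℓ², Ring.inverse (1 + T) ((1 + T) f) = f := fun f => by
    rw [← mul_apply_eq_comp, Ring.inverse_mul_cancel _ hu, one_apply_eq_self]
  rw [← hinv κ, h, ← one_add_apply_mul_inverse_apply hu, hinv]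

end Operators

/-! ### Principal minors and determinantal point processes -/

section FiniteMinors

variable {n : Type*} [Fintype n] [DecidableEq n]

/-- Expansion of `det (M + D)` in principal minors, where `D` is the projection onto the
coordinates outside `X`. -/
lemma sum_det_submatrix_eq_det_add (M : Matrix n n ℂ) (X : Finset n) :
    ∑ Y : Finset n, (if X ⊆ Y then (M.submatrix (fun i : Y => (i : n)) (fun i : Y => (i : n))).det
      else 0) =
    (M + Matrix.of (X.piecewise (0 : Matrix n n ℂ).row (1 : Matrix n n ℂ).row)).det := by
  set D : Matrix n n ℂ := Matrix.of (X.piecewise (0 : Matrix n n ℂ).row (1 : Matrix n n ℂ).row)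
    with hD
  have h := Matrix.detRowAlternating.map_add_univ (M : n → n → ℂ) (D : n → n → ℂ)
  refine (h.trans (Finset.sum_congr rfl fun Y _ => ?_)).symm
  split_ifs with hXY
  · rw [← Matrix.det_piecewise_one_eq_submatrix_det]
    change Matrix.det _ = _
    congr 1
    ext i j
    by_cases hi : i ∈ Y
    · simp [hi, Finset.piecewise, Matrix.row]
    · have hi' : i ∉ X := fun h => hi (hXY h)
      simp [hi, hi', Finset.piecewise, Matrix.row, hD]
  · obtain ⟨i, hiX, hiY⟩ := Finset.not_subset.1 hXY
    change Matrix.det _ = 0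
    refine Matrix.det_eq_zero_of_row_eq_zero i fun j => ?_
    simp [hiX, hiY, Finset.piecewise, Matrix.row, hD]

/-- The determinantal form of the correlation functions of a finite `L`-ensemble:
`∑_{Y ⊇ X} det M_Y = det (1 + M) det K_X` with `K = M (1 + M)⁻¹`. -/
lemma sum_det_submatrix_of_subset (M : Matrix n n ℂ) (hM : (1 + M).det ≠ 0) (X : Finset n) :
    ∑ Y : Finset n, (if X ⊆ Y then (M.submatrix (fun i : Y => (i : n)) (fun i : Y => (i : n))).det
      else 0) = (1 + M).det * ((M * (1 + M)⁻¹).submatrix (fun i : X => (i : n))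
        (fun i : X => (i : n))).det := by
  have h2 : M + Matrix.of (X.piecewise (0 : Matrix n n ℂ).row (1 : Matrix n n ℂ).row) =
      Matrix.of (X.piecewise (M * (1 + M)⁻¹).row (1 : Matrix n n ℂ).row) * (1 + M) := by
    have hK : M * (1 + M)⁻¹ * (1 + M) = M := by
      rw [Matrix.mul_assoc, Matrix.nonsing_inv_mul _ (isUnit_iff_ne_zero.2 hM), Matrix.mul_one]
    ext i j
    rw [Matrix.mul_apply]
    by_cases hi : i ∈ X
    · have h := congrFun (congrFun hK i) j
      rw [Matrix.mul_apply] at h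
      simpa [hi, Finset.piecewise, Matrix.row] using h.symm
    · have h := congrFun (congrFun (Matrix.one_mul (1 + M)) i) j
      rw [Matrix.mul_apply] at h
      simpa [hi, Finset.piecewise, Matrix.row, add_comm] using h.symm
  rw [sum_det_submatrix_eq_det_add, h2, Matrix.det_mul, Matrix.det_piecewise_one_eq_submatrix_det,
    mul_comm]

/-- A determinant is at most the product of the row sums of absolute values. -/
lemma norm_det_le_prod_sum (M : Matrix n n ℂ) : ‖M.det‖ ≤ ∏ i, ∑ j, ‖M i j‖ := by
  rw [← Matrix.det_transpose, Matrix.det_apply]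
  refine (norm_sum_le _ _).trans ?_
  have h1 : ∀ σ : Equiv.Perm n, ‖Equiv.Perm.sign σ • ∏ i, M.transpose (σ i) i‖ =
      ∏ i, ‖M i (σ i)‖ := by
    intro σ
    rw [← norm_prod]
    rcases Int.units_eq_one_or (Equiv.Perm.sign σ) with h | h <;> simp [h]
  simp only [h1]
  rw [Finset.prod_univ_sum]
  have h2 : ∑ σ : Equiv.Perm n, ∏ i, ‖M i (σ i)‖ =
      ∑ f ∈ Finset.univ.image (fun σ : Equiv.Perm n => (σ : n → n)), ∏ i, ‖M i (f i)‖ := by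
    rw [Finset.sum_image]
    intro σ _ τ _ h
    exact DFunLike.coe_injective h
  rw [h2]
  refine Finset.sum_le_sum_of_subset_of_nonneg (fun f _ => ?_) fun f _ _ => ?_
  · simp
  · exact Finset.prod_nonneg fun i _ => norm_nonneg _

end FiniteMinors

section Minors

variable {ι : Type*} [DecidableEq ι]

/-- The principal minor of `M` on the finite index set `Y`. -/
def minor (M : ι → ι → ℂ) (Y : Finset ι) : ℂ :=
  (Matrix.of fun x y : {x // x ∈ Y} => M x.1 y.1).det

/-- The finite section of `M` on `Λ`. -/
def finSection (M : ι → ι → ℂ) (Λ : Finset ι) : Matrix {x // x ∈ Λ} {x // x ∈ Λ} ℂ :=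
  Matrix.of fun x y => M x.1 y.1

/-- The matrix `M_Λ (1 + M_Λ)⁻¹` of the finite section, extended by zero. -/
def finResolvent (M : ι → ι → ℂ) (Λ : Finset ι) (x y : ι) : ℂ :=
  if h : x ∈ Λ ∧ y ∈ Λ then (finSection M Λ * (1 + finSection M Λ)⁻¹) ⟨x, h.1⟩ ⟨y, h.2⟩ else 0

lemma minor_empty (M : ι → ι → ℂ) : minor M ∅ = 1 := by
  rw [minor, Matrix.det_isEmpty]

lemma minor_subtype (M : ι → ι → ℂ) (Λ : Finset ι) (Y : Finset {x // x ∈ Λ}) :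
    ((finSection M Λ).submatrix (fun i : Y => (i : {x // x ∈ Λ}))
      (fun i : Y => (i : {x // x ∈ Λ}))).det = minor M (Y.map (Function.Embedding.subtype _)) := by
  set e : {x // x ∈ Y} → {x // x ∈ Y.map (Function.Embedding.subtype (· ∈ Λ))} :=
    fun i => ⟨i.1.1, Finset.mem_map_of_mem _ i.2⟩ with he
  have hb : Function.Bijective e := by
    refine ⟨fun i j h => Subtype.ext (Subtype.ext (Subtype.mk.inj h)), ?_⟩
    rintro ⟨x, hx⟩
    obtain ⟨y, hy, rfl⟩ := Finset.mem_map.1 hx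
    exact ⟨⟨y, hy⟩, rfl⟩
  rw [minor, ← Matrix.det_submatrix_equiv_self (Equiv.ofBijective e hb)]
  rfl

lemma map_subtype_of_subset {Λ X : Finset ι} (hX : X ⊆ Λ) :
    (X.subtype (· ∈ Λ)).map (Function.Embedding.subtype _) = X := by
  rw [Finset.subtype_map, Finset.filter_true_of_mem fun x hx => hX hx]

lemma sum_powerset_minor_eq_sum (M : ι → ι → ℂ) {Λ X : Finset ι} (hX : X ⊆ Λ) :
    ∑ Y ∈ Λ.powerset, (if X ⊆ Y then minor M Y else 0) =
      ∑ Y : Finset {x // x ∈ Λ}, (if X.subtype (· ∈ Λ) ⊆ Y then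
        ((finSection M Λ).submatrix (fun i : Y => (i : {x // x ∈ Λ}))
          (fun i : Y => (i : {x // x ∈ Λ}))).det else 0) := by
  symm
  refine Finset.sum_bij (fun Y _ => Y.map (Function.Embedding.subtype _)) ?_ ?_ ?_ ?_
  · intro Y _
    rw [Finset.mem_powerset]
    intro x hx
    obtain ⟨y, -, rfl⟩ := Finset.mem_map.1 hx
    exact y.2
  · intro Y _ Y' _ hYY
    exact Finset.map_injective _ hYY
  · intro Y hY
    rw [Finset.mem_powerset] at hY
    exact ⟨Y.subtype (· ∈ Λ), Finset.mem_univ _, map_subtype_of_subset hY⟩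
  · intro Y _
    rw [minor_subtype]
    have : X.subtype (· ∈ Λ) ⊆ Y ↔ X ⊆ Y.map (Function.Embedding.subtype _) := by
      conv_rhs => rw [← map_subtype_of_subset hX]
      exact Finset.map_subset_map.symm
    simp only [this]

lemma sum_powerset_minor (M : ι → ι → ℂ) {Λ X : Finset ι} (hX : X ⊆ Λ)
    (hM : (1 + finSection M Λ).det ≠ 0) :
    ∑ Y ∈ Λ.powerset, (if X ⊆ Y then minor M Y else 0) =
      (1 + finSection M Λ).det * minor (finResolvent M Λ) X := by
  rw [sum_powerset_minor_eq_sum M hX, sum_det_submatrix_of_subset (finSection M Λ) hM]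
  congr 1
  conv_rhs => rw [← map_subtype_of_subset hX]
  rw [← minor_subtype]
  congr 1
  ext i j
  simp [finSection, finResolvent]

lemma sum_powerset_minor_eq_det (M : ι → ι → ℂ) (Λ : Finset ι) :
    ∑ Y ∈ Λ.powerset, minor M Y = (1 + finSection M Λ).det := by
  have h := sum_powerset_minor_eq_sum M (Finset.empty_subset Λ)
  rw [sum_det_submatrix_eq_det_add] at h
  have e : Matrix.of (((∅ : Finset ι).subtype (· ∈ Λ)).piecewise
      (0 : Matrix {x // x ∈ Λ} {x // x ∈ Λ} ℂ).row (1 : Matrix _ _ ℂ).row) = 1 := by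
    ext i j
    simp [Finset.piecewise, Matrix.row]
  rw [e, add_comm] at h
  simpa using h

/-- Absolute summability of the principal minors, for nonnegative minors and a matrix whose entries
are dominated by a summable rank-one matrix. The hypothesis `hpos` says that the minors are
nonnegative real numbers. -/
lemma summable_norm_minor {M : ι → ι → ℂ} {α : ι → ℝ} (hα : Summable α)
    (hM : ∀ x y, ‖M x y‖ ≤ α x * α y) (hα0 : ∀ x, 0 ≤ α x)
    (hpos : ∀ Y, ((‖minor M Y‖ : ℝ) : ℂ) = minor M Y) : Summable fun Y => ‖minor M Y‖ := by
  set S := ∑' x, α x with hS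
  have hS0 : 0 ≤ S := tsum_nonneg hα0
  have hsum : ∀ s : Finset ι, ∑ x ∈ s, α x ≤ S := fun s => hα.sum_le_tsum s fun x _ => hα0 x
  -- the sum of the minors inside `Λ` is `det (1 + M_Λ)`, which is bounded uniformly in `Λ`
  have hdet : ∀ Λ : Finset ι, ‖(1 + finSection M Λ).det‖ ≤ Real.exp (S * S) := by
    intro Λ
    refine (norm_det_le_prod_sum _).trans ?_
    have hrow : ∀ i : {x // x ∈ Λ}, ∑ j, ‖(1 + finSection M Λ) i j‖ ≤ 1 + α i.1 * S := by
      intro i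
      have h1 : ∀ j, ‖(1 + finSection M Λ) i j‖ ≤ (if i = j then 1 else 0) + α i.1 * α j.1 := by
        intro j
        rw [Matrix.add_apply]
        refine (norm_add_le _ _).trans (add_le_add ?_ (hM _ _))
        rw [Matrix.one_apply]
        split_ifs <;> simp
      refine (Finset.sum_le_sum fun j _ => h1 j).trans ?_
      rw [Finset.sum_add_distrib, ← Finset.mul_sum, Finset.sum_ite_eq, if_pos (Finset.mem_univ _)]
      gcongr
      · exact hα0 _
      · rw [Finset.sum_coe_sort Λ (f := fun x => α x)]
        exact hsum Λ
    refine (Finset.prod_le_prod (fun i _ => Finset.sum_nonneg fun j _ => norm_nonneg _)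
      fun i _ => hrow i).trans ?_
    have h2 : ∀ i : {x // x ∈ Λ}, 1 + α i.1 * S ≤ Real.exp (α i.1 * S) := fun i => by
      rw [add_comm]; exact Real.add_one_le_exp _
    refine (Finset.prod_le_prod (fun i _ => by have := hα0 i.1; positivity)
      fun i _ => h2 i).trans ?_
    rw [← Real.exp_sum, ← Finset.sum_mul, Real.exp_le_exp]
    gcongr
    rw [Finset.sum_coe_sort Λ (f := fun x => α x)]
    exact hsum Λ
  refine summable_of_sum_le (c := Real.exp (S * S)) (fun _ => norm_nonneg _) fun u => ?_
  have h1 : u ⊆ (u.biUnion id).powerset := by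
    intro Y hY
    rw [Finset.mem_powerset]
    exact Finset.subset_biUnion_of_mem id hY
  refine (Finset.sum_le_sum_of_subset_of_nonneg h1 fun _ _ _ => norm_nonneg _).trans ?_
  refine le_trans (le_of_eq ?_) (hdet (u.biUnion id))
  rw [← sum_powerset_minor_eq_det]
  have h2 : ∑ Y ∈ (u.biUnion id).powerset, minor M Y =
      ((∑ Y ∈ (u.biUnion id).powerset, ‖minor M Y‖ : ℝ) : ℂ) := by
    push_cast
    exact Finset.sum_congr rfl fun Y _ => (hpos Y).symm
  rw [h2, Complex.norm_real, Real.norm_of_nonneg (Finset.sum_nonneg fun _ _ => norm_nonneg _)]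

/-- If the principal minors are nonnegative, the finite sections of `1 + M` are invertible. -/
lemma det_one_add_finSection_ne_zero {M : ι → ι → ℂ}
    (hpos : ∀ Y, ((‖minor M Y‖ : ℝ) : ℂ) = minor M Y) (Λ : Finset ι) :
    (1 + finSection M Λ).det ≠ 0 := by
  have h2 : ∑ Y ∈ Λ.powerset, minor M Y = ((∑ Y ∈ Λ.powerset, ‖minor M Y‖ : ℝ) : ℂ) := by
    push_cast
    exact Finset.sum_congr rfl fun Y _ => (hpos Y).symm
  have h3 : 1 ≤ ∑ Y ∈ Λ.powerset, ‖minor M Y‖ := by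
    have := Finset.single_le_sum (f := fun Y => ‖minor M Y‖) (fun Y _ => norm_nonneg _)
      (Finset.empty_mem_powerset Λ)
    simpa [minor_empty] using this
  rw [← sum_powerset_minor_eq_det, h2]
  exact_mod_cast (by linarith : ∑ Y ∈ Λ.powerset, ‖minor M Y‖ ≠ 0)

end Minors

/-! ### Infinite `L`-ensembles as limits of finite sections -/

section Ensemble

variable {ι : Type*} [DecidableEq ι]

local notation "ℓ²" => lp (fun _ : ι => ℂ) 2

/-- The truncation of a vector to the coordinates in `Λ`. -/
def truncVec (Λ : Finset ι) (f : ι → ℂ) : ℓ² := ∑ x ∈ Λ, lp.single 2 x (f x)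

lemma truncVec_apply (Λ : Finset ι) (f : ι → ℂ) (x : ι) :
    truncVec Λ f x = if x ∈ Λ then f x else 0 := by
  rw [truncVec, lp.coeFn_sum, Finset.sum_apply]
  simp only [lp.coeFn_single, Finset.sum_pi_single]

/-- A Galerkin estimate: for a skew-adjoint operator the columns of the finite resolvents differ
from the truncated columns of the resolvent by at most the tail of the latter. -/
lemma norm_finResolvent_sub_le {M : ι → ι → ℂ} {T : ℓ² →L[ℂ] ℓ²}
    (hM : ∀ x y, T (basisVec y) x = M x y) (hT : ContinuousLinearMap.adjoint T = -T)
    {Λ : Finset ι} (hΛ : (1 + finSection M Λ).det ≠ 0) {y : ι} (hy : y ∈ Λ) {κ : ℓ²}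
    (hκ : (1 + T) κ = T (basisVec y)) {x : ι} (hx : x ∈ Λ) :
    ‖finResolvent M Λ x y - κ x‖ ≤ ‖T‖ * ‖κ - truncVec Λ κ‖ := by
  set v : ℓ² := truncVec Λ fun x => finResolvent M Λ x y with hv
  set δ : ℓ² := v - truncVec Λ κ with hδ
  have hδΛ : ∀ x, x ∉ Λ → δ x = 0 := by
    intro x hx
    change v x - truncVec Λ κ x = 0
    rw [hv, truncVec_apply, truncVec_apply, if_neg hx, if_neg hx, sub_zero]
  -- on `Λ` the finite resolvent solves the same equation
  have hfin : ∀ x ∈ Λ, ((1 + T) v) x = M x y := by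
    intro x hx
    have h1 : (1 + finSection M Λ) * (finSection M Λ * (1 + finSection M Λ)⁻¹) =
        finSection M Λ := by
      have h2 : (1 + finSection M Λ) * finSection M Λ =
        finSection M Λ * (1 + finSection M Λ) := by noncomm_ring
      rw [← Matrix.mul_assoc, h2, Matrix.mul_assoc,
        Matrix.mul_nonsing_inv _ (isUnit_iff_ne_zero.2 hΛ), Matrix.mul_one]
    have h2 := congrFun (congrFun h1 ⟨x, hx⟩) ⟨y, hy⟩
    rw [Matrix.add_mul, Matrix.one_mul, Matrix.add_apply, Matrix.mul_apply (M := finSection M Λ)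
      (N := finSection M Λ * (1 + finSection M Λ)⁻¹)] at h2
    change v x + (T v) x = M x y
    have h3 : v x = (finSection M Λ * (1 + finSection M Λ)⁻¹) ⟨x, hx⟩ ⟨y, hy⟩ := by
      rw [hv, truncVec_apply, if_pos hx, finResolvent, dif_pos ⟨hx, hy⟩]
    have h4 : (T v) x = ∑ j : {x // x ∈ Λ}, finSection M Λ ⟨x, hx⟩ j *
        (finSection M Λ * (1 + finSection M Λ)⁻¹) j ⟨y, hy⟩ := by
      refine (hasSum_apply T v x).unique ?_
      have h5 : ∀ z ∉ Λ, v z * T (basisVec z) x = 0 := by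
        intro z hz
        rw [hv, truncVec_apply, if_neg hz, zero_mul]
      have h6 : HasSum (fun z => v z * T (basisVec z) x) (∑ z ∈ Λ, v z * T (basisVec z) x) :=
        hasSum_sum_of_ne_finset_zero h5
      rw [← Finset.sum_coe_sort] at h6
      convert h6 using 1
      refine Finset.sum_congr rfl fun j _ => ?_
      rw [hM, hv, truncVec_apply, if_pos j.2, finResolvent, dif_pos ⟨j.2, hy⟩, mul_comm]
      rfl
    rw [h3, h4]
    exact h2
  have heq : ∀ x ∈ Λ, ((1 + T) δ) x = (T (κ - truncVec Λ κ)) x := by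
    intro x hx
    have h1 : (1 + T) δ = (1 + T) v - (1 + T) κ + ((κ - truncVec Λ κ) +
        T (κ - truncVec Λ κ)) := by
      change δ + T δ = (v + T v) - (κ + T κ) + _
      rw [hδ, map_sub, map_sub]
      abel
    rw [h1]
    change (((1 + T) v) x - ((1 + T) κ) x) + ((κ x - truncVec Λ κ x) +
      (T (κ - truncVec Λ κ)) x) = _
    rw [hfin x hx, hκ, hM, truncVec_apply, if_pos hx]
    ring
  -- `T` is skew-adjoint, so that `‖δ‖²` is the real part of `⟪δ, (1 + T) δ⟫`
  have hinner : inner ℂ δ ((1 + T) δ) = inner ℂ δ (T (κ - truncVec Λ κ)) := by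
    rw [lp.inner_eq_tsum, lp.inner_eq_tsum]
    refine tsum_congr fun x => ?_
    by_cases hx : x ∈ Λ
    · rw [heq x hx]
    · rw [hδΛ x hx, inner_zero_left, inner_zero_left]
  have hre : (inner ℂ δ ((1 + T) δ)).re = ‖δ‖ ^ 2 := by
    change (inner ℂ δ (δ + T δ)).re = _
    rw [inner_add_right, Complex.add_re, re_inner_apply_eq_zero hT, add_zero]
    exact (norm_sq_eq_re_inner (𝕜 := ℂ) δ).symm
  have hle : ‖δ‖ ^ 2 ≤ ‖δ‖ * (‖T‖ * ‖κ - truncVec Λ κ‖) := by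
    rw [← hre, hinner]
    refine (Complex.re_le_norm _).trans ((norm_inner_le_norm _ _).trans ?_)
    gcongr
    exact T.le_opNorm _
  have hδle : ‖δ‖ ≤ ‖T‖ * ‖κ - truncVec Λ κ‖ := by
    rcases eq_or_lt_of_le (norm_nonneg δ) with h | h
    · rw [← h]; positivity
    · rw [sq] at hle; exact le_of_mul_le_mul_left hle h
  refine le_trans ?_ hδle
  have : finResolvent M Λ x y - κ x = δ x := by
    change _ = v x - truncVec Λ κ x
    rw [hv, truncVec_apply, truncVec_apply, if_pos hx, if_pos hx]
  rw [this]
  exact norm_apply_le δ x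

lemma tendsto_finResolvent {M : ι → ι → ℂ} {T : ℓ² →L[ℂ] ℓ²}
    (hM : ∀ x y, T (basisVec y) x = M x y) (hT : ContinuousLinearMap.adjoint T = -T)
    (hdet : ∀ Λ, (1 + finSection M Λ).det ≠ 0) (x y : ι) :
    Tendsto (fun Λ => finResolvent M Λ x y) atTop
      (𝓝 ((T * Ring.inverse (1 + T)) (basisVec y) x)) := by
  set κ : ℓ² := (T * Ring.inverse (1 + T)) (basisVec y) with hκ
  have hκ' : (1 + T) κ = T (basisVec y) :=
    one_add_apply_mul_inverse_apply (isUnit_one_add_of_adjoint_eq_neg hT) y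
  have h0 : Tendsto (fun Λ : Finset ι => ‖T‖ * ‖κ - truncVec Λ κ‖) atTop (𝓝 0) := by
    have h1 : Tendsto (fun Λ : Finset ι => truncVec Λ κ) atTop (𝓝 κ) :=
      lp.hasSum_single (by norm_num) κ
    have h2 := ((tendsto_const_nhds (x := κ)).sub h1).norm.const_mul ‖T‖
    simpa using h2
  rw [tendsto_iff_norm_sub_tendsto_zero]
  refine squeeze_zero' (Eventually.of_forall fun _ => norm_nonneg _) ?_ h0
  filter_upwards [eventually_ge_atTop ({x, y} : Finset ι)] with Λ hΛ
  exact norm_finResolvent_sub_le hM hT (hdet Λ) (hΛ (by simp)) hκ' (hΛ (by simp))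

/-- The correlation functions of an `L`-ensemble on an infinite set: if the principal minors of a
skew-adjoint matrix `M` are summable with sum `Z`, then `∑_{Y ⊇ X} det M_Y = Z det K_X`, where
`K = M (1 + M)⁻¹`. -/
lemma hasSum_minor_of_subset {M : ι → ι → ℂ} {T : ℓ² →L[ℂ] ℓ²}
    (hM : ∀ x y, T (basisVec y) x = M x y) (hT : ContinuousLinearMap.adjoint T = -T)
    (hdet : ∀ Λ, (1 + finSection M Λ).det ≠ 0) {Z : ℂ}
    (hZ : HasSum (minor M) Z) (hs : Summable fun Y => ‖minor M Y‖) (X : Finset ι) :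
    HasSum (fun Y : Finset ι => if X ⊆ Y then minor M Y else 0)
      (Z * minor (fun x y => (T * Ring.inverse (1 + T)) (basisVec y) x) X) := by
  have hs' : Summable fun Y : Finset ι => if X ⊆ Y then minor M Y else 0 := by
    refine Summable.of_norm_bounded hs fun Y => ?_
    split_ifs
    · exact le_rfl
    · simp
  have h1 : Tendsto (fun Λ : Finset ι => ∑ Y ∈ Λ.powerset, if X ⊆ Y then minor M Y else 0) atTop
      (𝓝 (∑' Y, if X ⊆ Y then minor M Y else 0)) :=
    hs'.hasSum.comp tendsto_finset_powerset_atTop_atTop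
  have h2 : Tendsto (fun Λ : Finset ι => (1 + finSection M Λ).det) atTop (𝓝 Z) := by
    have := hZ.comp tendsto_finset_powerset_atTop_atTop
    refine this.congr fun Λ => ?_
    exact sum_powerset_minor_eq_det M Λ
  have h3 : Tendsto (fun Λ : Finset ι => minor (finResolvent M Λ) X) atTop
      (𝓝 (minor (fun x y => (T * Ring.inverse (1 + T)) (basisVec y) x) X)) := by
    have hc : Continuous fun A : Matrix {x // x ∈ X} {x // x ∈ X} ℂ => A.det :=
      continuous_id.matrix_det
    refine (hc.tendsto _).comp ?_
    refine tendsto_pi_nhds.2 fun x => tendsto_pi_nhds.2 fun y => ?_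
    exact tendsto_finResolvent hM hT hdet x.1 y.1
  have h4 : Tendsto (fun Λ : Finset ι => ∑ Y ∈ Λ.powerset, if X ⊆ Y then minor M Y else 0) atTop
      (𝓝 (Z * minor (fun x y => (T * Ring.inverse (1 + T)) (basisVec y) x) X)) := by
    refine (h2.mul h3).congr' ?_
    filter_upwards [eventually_ge_atTop X] with Λ hΛ
    exact (sum_powerset_minor M hΛ (hdet Λ)).symm
  rw [← tendsto_nhds_unique h1 h4]
  exact hs'.hasSum

end Ensemble

/-! ### Frobenius coordinates -/

section Frobenius

lemma finset_eq_range_of_isLowerSet {S : Finset ℕ} (hS : IsLowerSet (S : Set ℕ)) :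
    S = Finset.range S.card := by
  have hsub : S ⊆ Finset.range S.card := by
    intro i hi
    have h : Finset.range (i + 1) ⊆ S := fun j hj =>
      hS (Nat.lt_succ_iff.1 (Finset.mem_range.1 hj)) hi
    have := Finset.card_le_card h
    rw [Finset.card_range] at this
    exact Finset.mem_range.2 this
  exact Finset.eq_of_subset_of_card_le hsub (by rw [Finset.card_range])

lemma mem_diag_iff (lam : YoungDiagram) (i : ℕ) : (i, i) ∈ lam ↔ i < diagLen lam := by
  set S := (lam.cells.filter fun c => c.1 = c.2).image Prod.fst with hS
  have hmem : ∀ j, j ∈ S ↔ (j, j) ∈ lam := by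
    intro j
    simp only [hS, Finset.mem_image, Finset.mem_filter, YoungDiagram.mem_cells]
    constructor
    · rintro ⟨⟨x, y⟩, ⟨h1, h2⟩, rfl⟩
      simp only at h2
      subst h2
      exact h1
    · exact fun h => ⟨(j, j), ⟨h, rfl⟩, rfl⟩
  have hlow : IsLowerSet (S : Set ℕ) := by
    intro x y hyx hx
    rw [Finset.mem_coe, hmem] at hx ⊢
    exact lam.up_left_mem hyx hyx hx
  have hcard : S.card = diagLen lam := by
    rw [hS, diagLen, Finset.card_image_of_injOn]
    rintro ⟨x, y⟩ h ⟨x', y'⟩ h' hxx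
    simp only [Finset.coe_filter, Set.mem_ofPred_eq] at h h' hxx
    ext
    · exact hxx
    · exact (h.2.symm.trans hxx).trans h'.2
  rw [← hmem, finset_eq_range_of_isLowerSet hlow, hcard, Finset.mem_range]

lemma rowLen_eq {lam : YoungDiagram} {i : ℕ} (hi : i < diagLen lam) :
    lam.rowLen i = i + frobP lam i + 1 := by
  have h := YoungDiagram.mem_iff_lt_rowLen.1 ((mem_diag_iff lam i).2 hi)
  rw [frobP]; omega

lemma colLen_eq {lam : YoungDiagram} {i : ℕ} (hi : i < diagLen lam) :
    lam.colLen i = i + frobQ lam i + 1 := by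
  have h := YoungDiagram.mem_iff_lt_colLen.1 ((mem_diag_iff lam i).2 hi)
  rw [frobQ]; omega

lemma mem_iff_of_le (lam : YoungDiagram) {i j : ℕ} (hij : i ≤ j) :
    (i, j) ∈ lam ↔ i < diagLen lam ∧ j ≤ i + frobP lam i := by
  constructor
  · intro h
    have hi : i < diagLen lam := (mem_diag_iff lam i).1 (lam.up_left_mem le_rfl hij h)
    have h2 := YoungDiagram.mem_iff_lt_rowLen.1 h
    rw [rowLen_eq hi] at h2
    exact ⟨hi, by omega⟩
  · rintro ⟨hi, h⟩
    rw [YoungDiagram.mem_iff_lt_rowLen, rowLen_eq hi]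
    omega

lemma mem_iff_of_ge (lam : YoungDiagram) {i j : ℕ} (hij : j ≤ i) :
    (i, j) ∈ lam ↔ j < diagLen lam ∧ i ≤ j + frobQ lam j := by
  constructor
  · intro h
    have hj : j < diagLen lam := (mem_diag_iff lam j).1 (lam.up_left_mem hij le_rfl h)
    have h2 := YoungDiagram.mem_iff_lt_colLen.1 h
    rw [colLen_eq hj] at h2
    exact ⟨hj, by omega⟩
  · rintro ⟨hj, h⟩
    rw [YoungDiagram.mem_iff_lt_colLen, colLen_eq hj]
    omega

lemma frobP_lt {lam : YoungDiagram} {i j : ℕ} (hij : i < j) (hj : j < diagLen lam) :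
    frobP lam j < frobP lam i := by
  have h := lam.rowLen_anti i j hij.le
  rw [rowLen_eq hj, rowLen_eq (hij.trans hj)] at h
  omega

lemma frobQ_lt {lam : YoungDiagram} {i j : ℕ} (hij : i < j) (hj : j < diagLen lam) :
    frobQ lam j < frobQ lam i := by
  have h := lam.colLen_anti i j hij.le
  rw [colLen_eq hj, colLen_eq (hij.trans hj)] at h
  omega

lemma injOn_frobP (lam : YoungDiagram) :
    Set.InjOn (frobP lam) (Finset.range (diagLen lam) : Set ℕ) := by
  intro i hi j hj h
  simp only [Finset.coe_range, Set.mem_Iio] at hi hj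
  rcases lt_trichotomy i j with hij | hij | hij
  · exact absurd h (frobP_lt hij hj).ne'
  · exact hij
  · exact absurd h (frobP_lt hij hi).ne

lemma injOn_frobQ (lam : YoungDiagram) :
    Set.InjOn (frobQ lam) (Finset.range (diagLen lam) : Set ℕ) := by
  intro i hi j hj h
  simp only [Finset.coe_range, Set.mem_Iio] at hi hj
  rcases lt_trichotomy i j with hij | hij | hij
  · exact absurd h (frobQ_lt hij hj).ne'
  · exact hij
  · exact absurd h (frobQ_lt hij hi).ne

/-- A decreasing enumeration of a finite set of natural numbers is unique. -/
lemma eq_of_image_eq {d : ℕ} {f g : ℕ → ℕ} (hf : ∀ i j, i < j → j < d → f j < f i)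
    (hg : ∀ i j, i < j → j < d → g j < g i)
    (h : (Finset.range d).image f = (Finset.range d).image g) {i : ℕ} (hi : i < d) :
    f i = g i := by
  have hcard : ((Finset.range d).image f).card = d := by
    rw [Finset.card_image_of_injOn, Finset.card_range]
    intro i hi j hj h
    simp only [Finset.coe_range, Set.mem_Iio] at hi hj
    rcases lt_trichotomy i j with hij | hij | hij
    · exact absurd h (hf _ _ hij hj).ne'
    · exact hij
    · exact absurd h (hf _ _ hij hi).ne
  have key : ∀ u : ℕ → ℕ, (∀ i j, i < j → j < d → u j < u i) →
      (Finset.range d).image f = (Finset.range d).image u →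
      (fun x : Fin d => u (d - 1 - x)) = ((Finset.range d).image f).orderEmbOfFin hcard := by
    intro u hu hfu
    refine Finset.orderEmbOfFin_unique hcard (fun x => ?_) fun x y hxy => ?_
    · rw [hfu]
      exact Finset.mem_image_of_mem _ (Finset.mem_range.2 (by omega))
    · have hxy' : (x : ℕ) < y := hxy
      exact hu _ _ (by omega) (by omega)
  have h1 := congrFun ((key f hf rfl).trans (key g hg h).symm) ⟨d - 1 - i, by omega⟩
  simpa only [show d - 1 - (d - 1 - i) = i by omega] using h1

lemma card_image_frobP (lam : YoungDiagram) :
    ((Finset.range (diagLen lam)).image (frobP lam)).card = diagLen lam := by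
  rw [Finset.card_image_of_injOn (injOn_frobP lam), Finset.card_range]

lemma toLeft_config (lam : YoungDiagram) :
    (config lam).toLeft = (Finset.range (diagLen lam)).image (frobP lam) := by
  rw [config, Finset.toLeft_disjSum]

lemma toRight_config (lam : YoungDiagram) :
    (config lam).toRight = (Finset.range (diagLen lam)).image (frobQ lam) := by
  rw [config, Finset.toRight_disjSum]

lemma config_injective : Function.Injective config := by
  intro lam mu h
  have hP : (Finset.range (diagLen lam)).image (frobP lam) =
      (Finset.range (diagLen mu)).image (frobP mu) := by rw [← toLeft_config, h, toLeft_config]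
  have hQ : (Finset.range (diagLen lam)).image (frobQ lam) =
      (Finset.range (diagLen mu)).image (frobQ mu) := by rw [← toRight_config, h, toRight_config]
  have hd : diagLen lam = diagLen mu := by
    rw [← card_image_frobP lam, hP, card_image_frobP]
  rw [← hd] at hP hQ
  have hPi : ∀ i < diagLen lam, frobP lam i = frobP mu i := fun i hi =>
    eq_of_image_eq (fun _ _ => frobP_lt) (fun i j hij hj => frobP_lt hij (hd ▸ hj)) hP hi
  have hQi : ∀ i < diagLen lam, frobQ lam i = frobQ mu i := fun i hi =>
    eq_of_image_eq (fun _ _ => frobQ_lt) (fun i j hij hj => frobQ_lt hij (hd ▸ hj)) hQ hi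
  ext ⟨i, j⟩
  rw [YoungDiagram.mem_cells, YoungDiagram.mem_cells]
  rcases le_total i j with hij | hij
  · rw [mem_iff_of_le lam hij, mem_iff_of_le mu hij, ← hd]
    exact and_congr_right fun hi => by rw [hPi i hi]
  · rw [mem_iff_of_ge lam hij, mem_iff_of_ge mu hij, ← hd]
    exact and_congr_right fun hi => by rw [hQi j hi]

/-- Strictly decreasing sequences `p` and `q` of length `d` are the Frobenius coordinates of a Young
diagram. -/
lemma exists_youngDiagram (d : ℕ) (p q : ℕ → ℕ) (hp : ∀ i j, i < j → j < d → p j < p i)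
    (hq : ∀ i j, i < j → j < d → q j < q i) :
    ∃ lam : YoungDiagram, diagLen lam = d ∧ (∀ i < d, frobP lam i = p i) ∧
      ∀ i < d, frobQ lam i = q i := by
  have hgap : ∀ f : ℕ → ℕ, (∀ i j, i < j → j < d → f j < f i) → ∀ i j, i ≤ j → j < d →
      f j + j ≤ f i + i := by
    intro f hf i j hij hj
    induction j, hij using Nat.le_induction with
    | base => exact le_rfl
    | succ j hij ih =>
      have := hf j (j + 1) (by omega) hj
      have := ih (by omega)
      omega
  set mem : ℕ × ℕ → Prop := fun c => (c.1 ≤ c.2 ∧ c.1 < d ∧ c.2 ≤ c.1 + p c.1) ∨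
    (c.2 ≤ c.1 ∧ c.2 < d ∧ c.1 ≤ c.2 + q c.2) with hmem
  classical
  set B := (Finset.range d).sup (fun i => i + p i + q i) + d + 1 with hB
  have hbound : ∀ c, mem c → c ∈ Finset.range B ×ˢ Finset.range B := by
    rintro ⟨i, j⟩ h
    have hle : ∀ i < d, i + p i + q i ≤ (Finset.range d).sup (fun i => i + p i + q i) :=
      fun i hi => Finset.le_sup (f := fun i => i + p i + q i) (Finset.mem_range.2 hi)
    simp only [Finset.mem_product, Finset.mem_range]
    rcases h with ⟨h1, h2, h3⟩ | ⟨h1, h2, h3⟩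
    · have := hle _ h2
      simp only at h1 h2 h3 this
      omega
    · have := hle _ h2
      simp only at h1 h2 h3 this
      omega
  have hlow : ∀ c c' : ℕ × ℕ, c' ≤ c → mem c → mem c' := by
    rintro ⟨i, j⟩ ⟨i', j'⟩ ⟨hi, hj⟩ h
    simp only at hi hj
    have hp0 : ∀ k l, k ≤ l → l < d → l ≤ k + p k := fun k l hkl hl => by
      have := hgap p hp k l hkl hl; omega
    have hq0 : ∀ k l, k ≤ l → l < d → l ≤ k + q k := fun k l hkl hl => by
      have := hgap q hq k l hkl hl; omega
    rcases h with ⟨h1, h2, h3⟩ | ⟨h1, h2, h3⟩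
    · simp only at h1 h2 h3
      rcases le_total i' j' with h4 | h4
      · have := hgap p hp i' i hi h2
        exact Or.inl ⟨h4, by simp only; omega, by simp only; omega⟩
      · have := hq0 j' i' h4 (by omega)
        exact Or.inr ⟨h4, by simp only; omega, by simp only; omega⟩
    · simp only at h1 h2 h3
      rcases le_total i' j' with h4 | h4
      · have := hp0 i' j' h4 (by omega)
        exact Or.inl ⟨h4, by simp only; omega, by simp only; omega⟩
      · have := hgap q hq j' j hj h2
        exact Or.inr ⟨h4, by simp only; omega, by simp only; omega⟩
  have hL : IsLowerSet (((Finset.range B ×ˢ Finset.range B).filter mem : Finset (ℕ × ℕ)) :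
      Set (ℕ × ℕ)) := by
    intro c c' hcc hc
    rw [Finset.mem_coe, Finset.mem_filter] at hc ⊢
    have := hlow c c' hcc hc.2
    exact ⟨hbound _ this, this⟩
  set lam : YoungDiagram := ⟨(Finset.range B ×ˢ Finset.range B).filter mem, hL⟩ with hlam
  have hmem_lam : ∀ c, c ∈ lam ↔ mem c := by
    intro c
    rw [hlam, YoungDiagram.mem_mk, Finset.mem_filter]
    exact ⟨fun h => h.2, fun h => ⟨hbound _ h, h⟩⟩
  have hd : diagLen lam = d := by
    refine eq_of_forall_lt_iff fun i => ?_
    rw [← mem_diag_iff, hmem_lam]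
    simp only [hmem]
    omega
  refine ⟨lam, hd, fun i hi => ?_, fun i hi => ?_⟩
  · have h : lam.rowLen i = i + p i + 1 := by
      refine eq_of_forall_lt_iff fun j => ?_
      rw [← YoungDiagram.mem_iff_lt_rowLen, hmem_lam]
      rcases le_or_gt i j with hij | hij
      · simp only [hmem]
        constructor
        · rintro (h | h)
          · omega
          · have : i = j := by omega
            omega
        · intro h; left; omega
      · refine iff_of_true (Or.inr ?_) (by omega)
        have := hgap q hq j i hij.le hi
        exact ⟨hij.le, by simp only; omega, by simp only; omega⟩
    rw [frobP, h]; omega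
  · have h : lam.colLen i = i + q i + 1 := by
      refine eq_of_forall_lt_iff fun j => ?_
      rw [← YoungDiagram.mem_iff_lt_colLen, hmem_lam]
      rcases le_or_gt i j with hij | hij
      · simp only [hmem]
        constructor
        · rintro (h | h)
          · have : i = j := by omega
            omega
          · omega
        · intro h; right; omega
      · refine iff_of_true (Or.inl ?_) (by omega)
        have := hgap p hp j i hij.le hi
        exact ⟨hij.le, by simp only; omega, by simp only; omega⟩
    rw [frobQ, h]; omega

/-- The configurations are the finite sets with as many positive as negative points. -/
lemma exists_config_eq {Y : Finset HalfInt} (hY : Y.toLeft.card = Y.toRight.card) :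
    ∃ lam, config lam = Y := by
  have henum : ∀ (S : Finset ℕ), ∃ f : ℕ → ℕ, (∀ i j, i < j → j < S.card → f j < f i) ∧
      (Finset.range S.card).image f = S := by
    intro S
    refine ⟨fun i => if h : i < S.card then S.orderEmbOfFin rfl ⟨S.card - 1 - i, by omega⟩ else 0,
      fun i j hij hj => ?_, ?_⟩
    · simp only [dif_pos hj, dif_pos (hij.trans hj)]
      refine (S.orderEmbOfFin rfl).strictMono ?_
      rw [Fin.mk_lt_mk]; omega
    · ext x
      simp only [Finset.mem_image, Finset.mem_range]
      constructor
      · rintro ⟨i, hi, rfl⟩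
        rw [dif_pos hi]
        exact S.orderEmbOfFin_mem rfl _
      · intro hx
        have : x ∈ Set.range (S.orderEmbOfFin rfl) := by
          rw [Finset.range_orderEmbOfFin]; exact hx
        obtain ⟨⟨i, hi⟩, rfl⟩ := this
        refine ⟨S.card - 1 - i, by omega, ?_⟩
        rw [dif_pos (by omega)]
        congr 2
        omega
  obtain ⟨p, hp, hpi⟩ := henum Y.toLeft
  obtain ⟨q, hq, hqi⟩ := henum Y.toRight
  rw [← hY] at hq hqi
  obtain ⟨lam, hd, hP, hQ⟩ := exists_youngDiagram _ p q hp hq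
  refine ⟨lam, ?_⟩
  have e1 : (Finset.range (diagLen lam)).image (frobP lam) = Y.toLeft := by
    rw [hd]
    refine Eq.trans (Finset.image_congr fun i hi => ?_) hpi
    exact hP i (by simpa using hi)
  have e2 : (Finset.range (diagLen lam)).image (frobQ lam) = Y.toRight := by
    rw [hd]
    refine Eq.trans (Finset.image_congr fun i hi => ?_) hqi
    exact hQ i (by simpa using hi)
  rw [config, e1, e2, Finset.toLeft_disjSum_toRight]

/-- The number of boxes in terms of the Frobenius coordinates. -/
lemma card_eq_sum_frob (lam : YoungDiagram) :
    lam.card = ∑ i ∈ Finset.range (diagLen lam), (frobP lam i + frobQ lam i + 1) := by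
  have h1 : (lam.cells.filter fun c => c.1 ≤ c.2).card =
      ∑ i ∈ Finset.range (diagLen lam), (frobP lam i + 1) := by
    rw [Finset.card_eq_sum_card_fiberwise (f := Prod.fst) (t := Finset.range (diagLen lam))]
    · refine Finset.sum_congr rfl fun i hi => ?_
      rw [Finset.mem_range] at hi
      have : ((lam.cells.filter fun c => c.1 ≤ c.2).filter fun c => c.1 = i) =
          (Finset.Icc i (i + frobP lam i)).image fun j => (i, j) := by
        ext ⟨x, y⟩
        simp only [Finset.mem_filter, YoungDiagram.mem_cells, Finset.mem_image, Finset.mem_Icc,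
          Prod.mk.injEq]
        constructor
        · rintro ⟨⟨h1, h2⟩, rfl⟩
          exact ⟨y, ⟨h2, ((mem_iff_of_le lam h2).1 h1).2⟩, rfl, rfl⟩
        · rintro ⟨j, ⟨h1, h2⟩, rfl, rfl⟩
          exact ⟨⟨(mem_iff_of_le lam h1).2 ⟨hi, h2⟩, h1⟩, rfl⟩
      rw [this, Finset.card_image_of_injective _ (fun a b h => (Prod.mk.inj h).2), Nat.card_Icc]
      omega
    · rintro ⟨x, y⟩ h
      simp only [Finset.coe_filter, Set.mem_ofPred_eq, YoungDiagram.mem_cells] at h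
      simpa using ((mem_iff_of_le lam h.2).1 h.1).1
  have h2 : (lam.cells.filter fun c => ¬ c.1 ≤ c.2).card =
      ∑ i ∈ Finset.range (diagLen lam), frobQ lam i := by
    rw [Finset.card_eq_sum_card_fiberwise (f := Prod.snd) (t := Finset.range (diagLen lam))]
    · refine Finset.sum_congr rfl fun i hi => ?_
      rw [Finset.mem_range] at hi
      have : ((lam.cells.filter fun c => ¬ c.1 ≤ c.2).filter fun c => c.2 = i) =
          (Finset.Ioc i (i + frobQ lam i)).image fun j => (j, i) := by
        ext ⟨x, y⟩
        simp only [Finset.mem_filter, YoungDiagram.mem_cells, Finset.mem_image, Finset.mem_Ioc,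
          Prod.mk.injEq, not_le]
        constructor
        · rintro ⟨⟨h1, h2⟩, rfl⟩
          exact ⟨x, ⟨h2, ((mem_iff_of_ge lam h2.le).1 h1).2⟩, rfl, rfl⟩
        · rintro ⟨j, ⟨h1, h2⟩, rfl, rfl⟩
          exact ⟨⟨(mem_iff_of_ge lam h1.le).2 ⟨hi, h2⟩, h1⟩, rfl⟩
      rw [this, Finset.card_image_of_injective _ (fun a b h => (Prod.mk.inj h).1), Nat.card_Ioc]
      omega
    · rintro ⟨x, y⟩ h
      simp only [Finset.coe_filter, Set.mem_ofPred_eq, YoungDiagram.mem_cells, not_le] at h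
      simpa using ((mem_iff_of_ge lam h.2.le).1 h.1).1
  rw [YoungDiagram.card, ← Finset.card_filter_add_card_filter_not (fun c : ℕ × ℕ => c.1 ≤ c.2),
    h1, h2,
    ← Finset.sum_add_distrib]
  exact Finset.sum_congr rfl fun i _ => by ring

end Frobenius

/-! ### The principal minors of `L` -/

section BlockMinors

/-- The Cauchy determinant `det [1 / (p_i + q_j + 1)]` of distinct `p_i` and distinct `q_j` does not
vanish: a linear relation between its columns would be a polynomial of degree `< d` with the `d`
roots `p_i`. -/
lemma det_cauchy_ne_zero {d : ℕ} {p q : Fin d → ℕ} (hp : Function.Injective p)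
    (hq : Function.Injective q) :
    (Matrix.of fun i j : Fin d => 1 / ((p i : ℝ) + q j + 1)).det ≠ 0 := by
  intro h0
  obtain ⟨v, hv, hv0⟩ := Matrix.exists_mulVec_eq_zero_iff.2 h0
  have hpos : ∀ i j, (p i : ℝ) + q j + 1 ≠ 0 := fun i j => by positivity
  set N : Polynomial ℝ := ∑ j, Polynomial.C (v j) *
    ∏ k ∈ Finset.univ.erase j, (Polynomial.X + Polynomial.C ((q k : ℝ) + 1)) with hN
  have hdeg : N.natDegree ≤ d - 1 := by
    refine Polynomial.natDegree_sum_le_of_forall_le _ _ fun j _ => ?_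
    refine (Polynomial.natDegree_C_mul_le _ _).trans ((Polynomial.natDegree_prod_le _ _).trans ?_)
    simp only [Polynomial.natDegree_X_add_C]
    rw [Finset.sum_const, smul_eq_mul, mul_one, Finset.card_erase_of_mem (Finset.mem_univ _),
      Finset.card_univ, Fintype.card_fin]
  have heval : ∀ i, N.eval (p i : ℝ) = 0 := by
    intro i
    have h1 := congrFun hv0 i
    simp only [Matrix.mulVec, dotProduct, Matrix.of_apply, Pi.zero_apply] at h1
    have h2 : N.eval (p i : ℝ) = (∏ k, ((p i : ℝ) + q k + 1)) *
        ∑ j, 1 / ((p i : ℝ) + q j + 1) * v j := by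
      rw [hN, Polynomial.eval_finsetSum, Finset.mul_sum]
      refine Finset.sum_congr rfl fun j _ => ?_
      rw [← Finset.mul_prod_erase _ _ (Finset.mem_univ j), Polynomial.eval_mul,
        Polynomial.eval_C, Polynomial.eval_prod]
      simp only [Polynomial.eval_add, Polynomial.eval_X, Polynomial.eval_C, ← add_assoc]
      have := hpos i j
      field_simp
    rw [h2, h1, mul_zero]
  obtain ⟨j, hj⟩ := Function.ne_iff.1 hv
  have hd : 0 < d := j.pos
  have hinj : Function.Injective fun i : Fin d => (p i : ℝ) :=
    Nat.cast_injective.comp hp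
  have hN0 : N = 0 := Polynomial.eq_zero_of_natDegree_lt_card_of_eval_eq_zero N hinj heval
    (by rw [Fintype.card_fin]; omega)
  have h3 : N.eval (-((q j : ℝ) + 1)) = v j *
      ∏ k ∈ Finset.univ.erase j, (-((q j : ℝ) + 1) + (q k + 1)) := by
    rw [hN, Polynomial.eval_finsetSum, Finset.sum_eq_single j]
    · rw [Polynomial.eval_mul, Polynomial.eval_C, Polynomial.eval_prod]
      simp only [Polynomial.eval_add, Polynomial.eval_X, Polynomial.eval_C]
    · intro k _ hkj
      rw [Polynomial.eval_mul, Polynomial.eval_prod,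
        Finset.prod_eq_zero (Finset.mem_erase.2 ⟨hkj.symm, Finset.mem_univ j⟩), mul_zero]
      simp
    · exact fun h => absurd (Finset.mem_univ j) h
  rw [hN0, Polynomial.eval_zero] at h3
  have h4 : ∏ k ∈ Finset.univ.erase j, (-((q j : ℝ) + 1) + (q k + 1)) ≠ 0 := by
    refine Finset.prod_ne_zero_iff.2 fun k hk => ?_
    have hkj : q k ≠ q j := fun h => (Finset.mem_erase.1 hk).1 (hq h)
    intro h
    apply hkj
    have : (q k : ℝ) = q j := by linarith
    exact_mod_cast this
  exact (mul_ne_zero hj h4) h3.symm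

/-- A principal minor may be computed in any enumeration `e` of the index set. -/
lemma minor_eq_det_of_enum {ι κ : Type*} [DecidableEq ι] [Fintype κ] [DecidableEq κ]
    (M : ι → ι → ℂ) {Y : Finset ι} (e : κ → ι) (he : Function.Injective e)
    (hY : ∀ x, x ∈ Y ↔ ∃ k, e k = x) :
    minor M Y = (Matrix.of fun i j => M (e i) (e j)).det := by
  set f : κ → {x // x ∈ Y} := fun k => ⟨e k, (hY _).2 ⟨k, rfl⟩⟩ with hf
  have hb : Function.Bijective f := by
    refine ⟨fun i j h => he (Subtype.mk.inj h), ?_⟩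
    rintro ⟨x, hx⟩
    obtain ⟨k, rfl⟩ := (hY x).1 hx
    exact ⟨k, rfl⟩
  rw [minor, ← Matrix.det_submatrix_equiv_self (Equiv.ofBijective f hb)]
  rfl

/-- The determinant of a skew block matrix with square blocks. -/
lemma det_fromBlocks_zero_neg_transpose {κ : Type*} [Fintype κ] [DecidableEq κ]
    (A : Matrix κ κ ℂ) : (Matrix.fromBlocks 0 A (-A.transpose) 0).det = A.det ^ 2 := by
  have h1 : Matrix.fromBlocks 0 A (-A.transpose) 0 =
      Matrix.fromBlocks A 0 0 A.transpose *
        (Matrix.fromBlocks 1 1 0 1 * Matrix.fromBlocks 1 0 (-1) 1 * Matrix.fromBlocks 1 1 0 1) := by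
    simp [Matrix.fromBlocks_multiply]
  rw [h1]
  simp only [Matrix.det_mul, Matrix.det_fromBlocks_zero₂₁, Matrix.det_fromBlocks_zero₁₂,
    Matrix.det_one, Matrix.det_transpose]
  ring

lemma exists_mulVec_eq_zero_of_card_lt {m n : Type*} [Fintype m] [Fintype n]
    (C : Matrix n m ℂ) (hlt : Fintype.card n < Fintype.card m) :
    ∃ v : m → ℂ, v ≠ 0 ∧ C.mulVec v = 0 := by
  have h := LinearMap.ker_ne_bot_of_finrank_lt (f := C.mulVecLin) (by simpa using hlt)
  obtain ⟨v, hv, hv0⟩ := (Submodule.ne_bot_iff _).1 h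
  exact ⟨v, hv0, by simpa using hv⟩

/-- The determinant of a block matrix with zero diagonal blocks of different sizes. -/
lemma det_fromBlocks_zero_of_card_ne {m n : Type*} [Fintype m] [DecidableEq m] [Fintype n]
    [DecidableEq n] (hmn : Fintype.card m ≠ Fintype.card n) (A : Matrix m n ℂ) (B : Matrix n m ℂ) :
    (Matrix.fromBlocks 0 A B 0).det = 0 := by
  apply Matrix.exists_mulVec_eq_zero_iff.1
  rcases lt_or_gt_of_ne hmn with h | h
  · obtain ⟨v, hv, hv0⟩ := exists_mulVec_eq_zero_of_card_lt A h
    refine ⟨Sum.elim 0 v, ?_, ?_⟩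
    · intro h; apply hv; ext i; exact congrFun h (Sum.inr i)
    · rw [Matrix.fromBlocks_mulVec]
      ext (i | i) <;> simp [hv0]
  · obtain ⟨v, hv, hv0⟩ := exists_mulVec_eq_zero_of_card_lt B h
    refine ⟨Sum.elim v 0, ?_, ?_⟩
    · intro h; apply hv; ext i; exact congrFun h (Sum.inl i)
    · rw [Matrix.fromBlocks_mulVec]
      ext (i | i) <;> simp [hv0]

/-- The skew block matrix `[0, A; -Aᵗ, 0]` on `ℤ'`. -/
def skewMat (A : ℕ → ℕ → ℂ) : HalfInt → HalfInt → ℂ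
  | .inl _, .inl _ => 0
  | .inl k, .inr l => A k l
  | .inr k, .inl l => -A l k
  | .inr _, .inr _ => 0

lemma minor_skewMat_of_card_ne (A : ℕ → ℕ → ℂ) {Y : Finset HalfInt}
    (hY : Y.toLeft.card ≠ Y.toRight.card) : minor (skewMat A) Y = 0 := by
  rw [minor_eq_det_of_enum (κ := {x // x ∈ Y.toLeft} ⊕ {x // x ∈ Y.toRight}) _
    (Sum.map Subtype.val Subtype.val)
    (Sum.map_injective.2 ⟨Subtype.val_injective, Subtype.val_injective⟩)]
  · have e : (Matrix.of fun i j : {x // x ∈ Y.toLeft} ⊕ {x // x ∈ Y.toRight} =>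
        skewMat A (Sum.map Subtype.val Subtype.val i) (Sum.map Subtype.val Subtype.val j)) =
        Matrix.fromBlocks 0 (Matrix.of fun i j => A i.1 j.1) (Matrix.of fun i j => -A j.1 i.1)
          0 := by
      ext (i | i) (j | j) <;> rfl
    rw [e]
    exact det_fromBlocks_zero_of_card_ne (by simpa using hY) _ _
  · rintro (x | x) <;> simp

lemma minor_skewMat_config (A : ℕ → ℕ → ℂ) (lam : YoungDiagram) :
    minor (skewMat A) (config lam) =
      (Matrix.of fun i j : Fin (diagLen lam) => A (frobP lam i) (frobQ lam j)).det ^ 2 := by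
  have hinj : ∀ f : ℕ → ℕ, Set.InjOn f (Finset.range (diagLen lam) : Set ℕ) →
      Function.Injective fun i : Fin (diagLen lam) => f i := by
    intro f hf i j h
    exact Fin.ext (hf (by simp) (by simp) h)
  rw [minor_eq_det_of_enum (κ := Fin (diagLen lam) ⊕ Fin (diagLen lam)) _
    (Sum.map (fun i => frobP lam i) (fun i => frobQ lam i))
    (Sum.map_injective.2 ⟨hinj _ (injOn_frobP lam), hinj _ (injOn_frobQ lam)⟩)]
  · rw [← det_fromBlocks_zero_neg_transpose]
    congr 1
    ext (i | i) (j | j) <;> rfl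
  · rintro (x | x)
    · simp only [config, Finset.inl_mem_disjSum, Finset.mem_image, Finset.mem_range, Sum.exists,
        Sum.map_inl, Sum.map_inr, Sum.inl.injEq, reduceCtorEq, exists_false, or_false]
      exact ⟨fun ⟨i, hi, h⟩ => ⟨⟨i, hi⟩, h⟩, fun ⟨i, h⟩ => ⟨i, i.2, h⟩⟩
    · simp only [config, Finset.inr_mem_disjSum, Finset.mem_image, Finset.mem_range, Sum.exists,
        Sum.map_inl, Sum.map_inr, Sum.inr.injEq, reduceCtorEq, exists_false, false_or]
      exact ⟨fun ⟨i, hi, h⟩ => ⟨⟨i, hi⟩, h⟩, fun ⟨i, h⟩ => ⟨i, i.2, h⟩⟩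

/-- The square of the determinant `det [1 / (p_i + q_j + 1)]`, as a real number. -/
def cauchyDetSq (lam : YoungDiagram) : ℝ :=
  (Matrix.of fun i j : Fin (diagLen lam) =>
    1 / ((frobP lam i : ℝ) + (frobQ lam j : ℝ) + 1)).det ^ 2

lemma cauchyDetSq_pos (lam : YoungDiagram) : 0 < cauchyDetSq lam := by
  have hinj : ∀ f : ℕ → ℕ, Set.InjOn f (Finset.range (diagLen lam) : Set ℕ) →
      Function.Injective fun i : Fin (diagLen lam) => f i := by
    intro f hf i j h
    exact Fin.ext (hf (by simp) (by simp) h)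
  exact sq_pos_of_ne_zero (det_cauchy_ne_zero (hinj _ (injOn_frobP lam)) (hinj _ (injOn_frobQ lam)))

lemma det_sq_eq_cauchyDetSq (lam : YoungDiagram) :
    (Matrix.of fun i j : Fin (diagLen lam) =>
      1 / ((frobP lam i : ℂ) + (frobQ lam j : ℂ) + 1)).det ^ 2 = (cauchyDetSq lam : ℂ) := by
  rw [cauchyDetSq, Complex.ofReal_pow]
  congr 1
  rw [← Complex.ofRealHom_eq_coe, RingHom.map_det]
  congr 1
  ext i j
  simp

lemma minor_cauchyMat_config (a b : ℕ → ℂ) (lam : YoungDiagram) :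
    minor (skewMat (cauchyMat a b)) (config lam) =
      (∏ i ∈ Finset.range (diagLen lam), a (frobP lam i) ^ 2 * b (frobQ lam i) ^ 2) *
        cauchyDetSq lam := by
  rw [minor_skewMat_config, ← det_sq_eq_cauchyDetSq]
  have h1 : (Matrix.of fun i j : Fin (diagLen lam) =>
      cauchyMat a b (frobP lam i) (frobQ lam j)) = Matrix.of fun i j : Fin (diagLen lam) =>
        a (frobP lam i) * (Matrix.of fun i j : Fin (diagLen lam) => b (frobQ lam j) *
          (Matrix.of fun i j : Fin (diagLen lam) =>
            1 / ((frobP lam i : ℂ) + (frobQ lam j : ℂ) + 1)) i j) i j := by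
    ext i j
    simp only [cauchyMat, Matrix.of_apply]
    ring
  rw [h1, Matrix.det_mul_column, Matrix.det_mul_row, ← Fin.prod_univ_eq_prod_range
    (fun i => a (frobP lam i) ^ 2 * b (frobQ lam i) ^ 2), Finset.prod_mul_distrib,
    Finset.prod_pow, Finset.prod_pow]
  ring

end BlockMinors

/-! ### Admissible parameters and positivity -/

section Admissible

open scoped ComplexOrder

lemma cpow_pos {x y : ℂ} (hx : 0 < x) (hy : y.im = 0) : 0 < x ^ y := by
  have ex : ((x.re : ℝ) : ℂ) = x := Complex.ext rfl (Complex.pos_iff.1 hx).2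
  have ey : ((y.re : ℝ) : ℂ) = y := Complex.ext rfl hy.symm
  have h0 : 0 < x.re := (Complex.pos_iff.1 hx).1
  rw [← ex, ← ey, ← Complex.ofReal_cpow h0.le]
  exact_mod_cast Real.rpow_pos_of_pos h0 _

lemma cpow_half_sq (x : ℂ) : (x ^ (1 / 2 : ℂ)) ^ 2 = x := by
  rw [← Complex.cpow_nat_mul]
  norm_num

lemma conj_of_pos {x : ℂ} (hx : 0 < x) : (starRingEnd ℂ) x = x :=
  Complex.conj_eq_iff_im.2 (Complex.pos_iff.1 hx).2.symm

lemma factorial_pos' (k : ℕ) : 0 < (k.factorial : ℂ) := by exact_mod_cast k.factorial_pos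

variable {z z' s : ℂ} {ξ : ℝ}

lemma sign_mul_self (hs : s = 1 ∨ s = -1) : s * s = 1 := by
  rcases hs with rfl | rfl <;> norm_num

namespace Admissible

lemma poch_pos (hz : Admissible z z') (hs : s = 1 ∨ s = -1) (k : ℕ) :
    0 < poch (s * z) k * poch (s * z') k := by
  rcases Nat.eq_zero_or_pos k with rfl | hk
  · simp
  · rcases hs with rfl | rfl
    · rw [one_mul, one_mul]
      exact Complex.pos_iff.2 ⟨(hz k hk).1.2, (hz k hk).1.1.symm⟩
    · rw [neg_one_mul, neg_one_mul]
      exact Complex.pos_iff.2 ⟨(hz k hk).2.2, (hz k hk).2.1.symm⟩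

lemma mul_pos (hz : Admissible z z') : 0 < z * z' := by
  simpa [poch_succ] using hz.poch_pos (Or.inl rfl) 1

/-- The sum `z + z'` is real, because `(z)_2 (z')_2 = t (t + z + z' + 1)`. -/
lemma im_add (hz : Admissible z z') : (z + z').im = 0 := by
  have h2 := hz.poch_pos (Or.inl rfl) 2
  have ht := hz.mul_pos
  have e : z + z' = (poch (1 * z) 2 * poch (1 * z') 2) / (z * z') - z * z' - 1 := by
    simp only [poch_succ, poch_zero]
    have hz0 := left_ne_zero_of_mul ht.ne'
    have hz0' := right_ne_zero_of_mul ht.ne'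
    field_simp
    push_cast
    ring
  have h3 := (Complex.pos_iff.1 (div_pos h2 ht)).2
  have h4 := (Complex.pos_iff.1 ht).2
  rw [e, Complex.sub_im, Complex.sub_im, ← h3, ← h4]
  simp

lemma ne_neg_nat (hz : Admissible z z') (hs : s = 1 ∨ s = -1) (n : ℕ) : 1 + s * z ≠ -(n : ℂ) := by
  intro h
  have h1 := (hz.poch_pos hs (n + 2)).ne'
  apply h1
  rw [poch_succ (s * z), show s * z + ((n + 1 : ℕ) : ℂ) = 0 by push_cast; linear_combination h]
  simp

lemma symm (hz : Admissible z z') : Admissible z' z := fun k hk => by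
  simpa only [mul_comm] using hz k hk

lemma poch_one_add_pos (hz : Admissible z z') (hs : s = 1 ∨ s = -1) (k : ℕ) :
    0 < poch (1 + s * z) k * poch (1 + s * z') k := by
  have h := hz.poch_pos hs (k + 1)
  have ht := hz.mul_pos
  have hs2 := sign_mul_self hs
  have e : poch (1 + s * z) k * poch (1 + s * z') k =
      (poch (s * z) (k + 1) * poch (s * z') (k + 1)) / (z * z') := by
    rw [poch_succ_left, poch_succ_left, add_comm (s * z), add_comm (s * z'), eq_div_iff ht.ne']
    linear_combination (-(poch (1 + s * z) k * poch (1 + s * z') k) * (z * z')) * hs2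
  rw [e]
  exact div_pos h ht

lemma im_sign_mul (hz : Admissible z z') (hs : s = 1 ∨ s = -1) : (s * (z + z')).im = 0 := by
  have h := hz.im_add
  rcases hs with rfl | rfl
  · rwa [one_mul]
  · rw [neg_one_mul, Complex.neg_im, h, neg_zero]

lemma poch_mul_pos (hz : Admissible z z') (n : ℕ) : 0 < poch (z * z') n := by
  induction n with
  | zero => simp
  | succ n ih =>
    rw [poch_succ]
    exact _root_.mul_pos ih (add_pos_of_pos_of_nonneg hz.mul_pos (Nat.cast_nonneg n))

end Admissible

lemma xi_pos (hξ0 : 0 < ξ) : 0 < (ξ : ℂ) := by exact_mod_cast hξ0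

lemma one_sub_xi_pos (hξ1 : ξ < 1) : 0 < 1 - (ξ : ℂ) := by
  have : 0 < 1 - ξ := by linarith
  exact_mod_cast this

lemma Psi_pos (hz : Admissible z z') (hξ0 : 0 < ξ) (hξ1 : ξ < 1) (hs : s = 1 ∨ s = -1) (k : ℕ) :
    0 < Psi z z' ξ s k := by
  refine div_pos (mul_pos (mul_pos (mul_pos (cpow_pos hz.mul_pos (by norm_num))
    (cpow_pos (xi_pos hξ0) ?_))
    (cpow_pos (one_sub_xi_pos hξ1) (hz.im_sign_mul hs))) (hz.poch_one_add_pos hs k))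
    (mul_pos (factorial_pos' k) (factorial_pos' k))
  rw [Complex.add_im, Complex.natCast_im]
  norm_num

lemma psi_natCast (hz : Admissible z z') (hs : s = 1 ∨ s = -1) (k : ℕ) :
    psi z z' ξ s k = Psi z z' ξ s k := by
  have h1 := Complex.Gamma_add_nat_div_Gamma_eq (n := k) _ (hz.ne_neg_nat hs)
  have h2 := Complex.Gamma_add_nat_div_Gamma_eq (n := k) _ (hz.symm.ne_neg_nat hs)
  have n1 := Complex.Gamma_ne_zero (hz.ne_neg_nat hs)
  have n2 := Complex.Gamma_ne_zero (hz.symm.ne_neg_nat hs)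
  rw [div_eq_iff n1] at h1
  rw [div_eq_iff n2] at h2
  rw [psi, Psi, show (k : ℂ) + 1 + s * z = 1 + s * z + k by ring,
    show (k : ℂ) + 1 + s * z' = 1 + s * z' + k by ring, h1, h2, Complex.Gamma_nat_eq_factorial,
    poch, poch]
  have := fact_ne k
  generalize 1 + s * z = x at *
  generalize 1 + s * z' = y at *
  field_simp

/-- The square roots `Ψ_±(k)^{1/2}`. -/
def rootPsi (z z' : ℂ) (ξ : ℝ) (s : ℂ) (k : ℕ) : ℂ := Psi z z' ξ s k ^ (1 / 2 : ℂ)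

lemma rootPsi_pos (hz : Admissible z z') (hξ0 : 0 < ξ) (hξ1 : ξ < 1) (hs : s = 1 ∨ s = -1)
    (k : ℕ) : 0 < rootPsi z z' ξ s k :=
  cpow_pos (Psi_pos hz hξ0 hξ1 hs k) (by norm_num)

lemma rootPsi_sq (k : ℕ) : rootPsi z z' ξ s k ^ 2 = Psi z z' ξ s k := cpow_half_sq _

lemma matL_eq : matL z z' ξ = skewMat (cauchyMat (rootPsi z z' ξ 1) (rootPsi z z' ξ (-1))) := by
  funext x y
  rcases x with k | k <;> rcases y with l | l
  · rfl
  · simp only [matL, skewMat, cauchyMat, rootPsi, W]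
    ring
  · simp only [matL, skewMat, cauchyMat, rootPsi, W, add_comm (l : ℂ)]
    ring
  · rfl

lemma xi_cpow_add_half (hξ0 : 0 < ξ) (k : ℕ) :
    (ξ : ℂ) ^ ((k : ℂ) + 1 / 2) = (ξ : ℂ) ^ k * (ξ : ℂ) ^ (1 / 2 : ℂ) := by
  rw [Complex.cpow_add _ _ (xi_pos hξ0).ne', Complex.cpow_natCast]

lemma summable_norm_rootPsi (hξ0 : 0 < ξ) (hξ1 : ξ < 1) :
    Summable fun k => ‖rootPsi z z' ξ s k‖ := by
  obtain ⟨r, hr, hrx⟩ := exists_one_lt_pow_mul_lt_one hξ1 2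
  obtain ⟨A, hA, h1⟩ := exists_norm_poch_div_factorial_le (1 + s * z) hr
  obtain ⟨B, hB, h2⟩ := exists_norm_poch_div_factorial_le (1 + s * z') hr
  obtain ⟨c, hc⟩ : ∃ c : ℂ, c = (z * z') ^ (1 / 2 : ℂ) * (ξ : ℂ) ^ (1 / 2 : ℂ) *
      (1 - (ξ : ℂ)) ^ (s * (z + z')) := ⟨_, rfl⟩
  have hb : ∀ k, ‖rootPsi z z' ξ s k‖ ≤ √(‖c‖ * (A * B)) * √(r ^ 2 * ξ) ^ k := by
    intro k
    refine (sq_le_sq₀ (norm_nonneg _) (by positivity)).1 ?_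
    rw [← norm_pow, rootPsi_sq, mul_pow, ← pow_mul, mul_comm k 2, pow_mul,
      Real.sq_sqrt (by positivity),
      Real.sq_sqrt (by positivity)]
    have e : Psi z z' ξ s k = c * (ξ : ℂ) ^ k * ((poch (1 + s * z) k / k.factorial) *
        (poch (1 + s * z') k / k.factorial)) := by
      rw [Psi, xi_cpow_add_half hξ0]
      have := fact_ne k
      rw [hc]
      field_simp
    rw [e, norm_mul, norm_mul, norm_pow, Complex.norm_real, Real.norm_of_nonneg hξ0.le, norm_mul]
    calc _ ≤ ‖c‖ * ξ ^ k * ((A * r ^ k) * (B * r ^ k)) := by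
          gcongr
          · exact h1 k
          · exact h2 k
      _ = _ := by ring
  refine Summable.of_nonneg_of_le (fun _ => norm_nonneg _) hb
    ((summable_geometric_of_lt_one (by positivity) ?_).mul_left _)
  rw [Real.sqrt_lt' one_pos, one_pow]
  exact hrx

end Admissible

/-! ### The hypergeometric functions form a dual pair -/

section HypergeometricPair

open scoped ComplexOrder

/-- The hypergeometric factor `F(∓z, ∓z'; u + 1; ξ / (ξ - 1))` of `R_±`. -/
def hypF (z z' : ℂ) (ξ : ℝ) (s u : ℂ) : ℂ :=
  gaussF (-(s * z)) (-(s * z')) (u + 1) ((ξ : ℂ) / ((ξ : ℂ) - 1))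

/-- The cofactor of `ψ_±` in `S_±`, so that `S_± = ψ_± · hypG`. -/
def hypG (z z' : ℂ) (ξ : ℝ) (s u : ℂ) : ℂ :=
  (z * z') ^ (1 / 2 : ℂ) * (ξ : ℂ) ^ (1 / 2 : ℂ) / (1 - (ξ : ℂ)) *
    (gaussF (1 - s * z) (1 - s * z') (u + 2) ((ξ : ℂ) / ((ξ : ℂ) - 1)) / (u + 1))

variable {z z' s : ℂ} {ξ : ℝ}

/-- The residues in the partial fractions of `F(±z, ±z'; c; w)` are, up to sign, the values of `S_±`
at the nonnegative integers. -/
lemma resF_eq_Psi_mul (hs : s = 1 ∨ s = -1) (hξ0 : 0 < ξ) (hξ1 : ξ < 1) (j : ℕ) :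
    resF (s * z) (s * z') ξ j = Psi z z' ξ s j * hypG z z' ξ s j := by
  have hs2 := sign_mul_self hs
  have ht := cpow_half_sq (z * z')
  have hx := cpow_half_sq (ξ : ℂ)
  rw [resF, Psi, hypG, xi_cpow_add_half hξ0, poch_succ_left, poch_succ_left, Nat.factorial_succ,
    add_comm (s * z) 1, add_comm (s * z') 1, ← mul_add,
    Complex.cpow_sub _ _ (one_sub_ne hξ1), Complex.cpow_one]
  have h1 := fact_ne j
  have h2 : (j : ℂ) + 1 ≠ 0 := by exact_mod_cast j.succ_ne_zero
  have h3 := one_sub_ne hξ1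
  generalize (z * z') ^ (1 / 2 : ℂ) = T at *
  generalize (ξ : ℂ) ^ (1 / 2 : ℂ) = X at *
  generalize (1 - (ξ : ℂ)) ^ (s * (z + z')) = E
  generalize gaussF _ _ _ _ = g
  generalize poch _ j = p
  generalize poch _ j = q
  push_cast
  rw [pow_succ]
  have e : s * z * p * (s * z' * q) * ((ξ : ℂ) ^ j * ξ) = T * X * T * X * (ξ : ℂ) ^ j * p * q := by
    have : s * z * (s * z') = T ^ 2 := by rw [ht]; linear_combination (z * z') * hs2
    linear_combination p * q * (ξ : ℂ) ^ j * ξ * this - T ^ 2 * p * q * (ξ : ℂ) ^ j * hx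
  rw [e]
  field_simp

/-- The residues in the partial fractions of the `hypG` of the opposite sign are the values of `R_±`
at the nonnegative integers. -/
lemma resG_eq_Psi_mul (hξ0 : 0 < ξ) (hξ1 : ξ < 1) (j : ℕ) :
    (z * z') ^ (1 / 2 : ℂ) * (ξ : ℂ) ^ (1 / 2 : ℂ) / (1 - (ξ : ℂ)) *
      resG (1 + s * z) (1 + s * z') ξ j = Psi z z' ξ s j * hypF z z' ξ s j := by
  rw [resG, Psi, hypF, xi_cpow_add_half hξ0,
    show 1 + s * z + (1 + s * z') - 1 = s * (z + z') + 1 by ring,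
    Complex.cpow_add _ _ (one_sub_ne hξ1), Complex.cpow_one,
    show 1 - (1 + s * z) = -(s * z) by ring, show 1 - (1 + s * z') = -(s * z') by ring]
  have h1 := fact_ne j
  have h3 := one_sub_ne hξ1
  field_simp

lemma neg_sign (hs : s = 1 ∨ s = -1) : -s = 1 ∨ -s = -1 := by
  rcases hs with rfl | rfl <;> simp

variable (hs : s = 1 ∨ s = -1) (hξ0 : 0 < ξ) (hξ1 : ξ < 1)

include hs hξ0 hξ1

lemma summable_norm_Psi_mul_hypG : Summable fun j : ℕ => ‖Psi z z' ξ s j * hypG z z' ξ s j‖ :=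
  (summable_norm_resF (s * z) (s * z') hξ0 hξ1).congr fun j => by
    rw [resF_eq_Psi_mul hs hξ0 hξ1]

omit hs in
lemma summable_norm_Psi_mul_hypF : Summable fun j : ℕ => ‖Psi z z' ξ s j * hypF z z' ξ s j‖ :=
  ((summable_norm_resG (1 + s * z) (1 + s * z') hξ0 hξ1).mul_left
    ‖(z * z') ^ (1 / 2 : ℂ) * (ξ : ℂ) ^ (1 / 2 : ℂ) / (1 - (ξ : ℂ))‖).congr fun j => by
    rw [← norm_mul, resG_eq_Psi_mul hξ0 hξ1]

lemma hasSum_Psi_mul_hypG : HasSum (fun j : ℕ => Psi z z' ξ s j * hypG z z' ξ s j)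
    (z * z' * ξ / (1 - ξ)) := by
  have h := hasSum_resF (s * z) (s * z') hξ0 hξ1
  rw [show s * z * (s * z') = z * z' by linear_combination (z * z') * sign_mul_self hs] at h
  exact h.congr_fun fun j => (resF_eq_Psi_mul hs hξ0 hξ1 j).symm

lemma hasSum_hypF {u : ℂ} (hu : -1 < u.re) :
    HasSum (fun j : ℕ => Psi z z' ξ (-s) j * hypG z z' ξ (-s) j / (u + 1 + j))
      (1 - hypF z z' ξ s u) := by
  have h := hasSum_resF_div (-s * z) (-s * z') hξ0 hξ1 (c := u + 1) (by simp; linarith)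
  rw [hypF, ← neg_mul, ← neg_mul]
  exact h.congr_fun fun j => by rw [resF_eq_Psi_mul (neg_sign hs) hξ0 hξ1 j]

omit hs in
lemma hasSum_hypG {u : ℂ} (hu : -1 < u.re) :
    HasSum (fun j : ℕ => Psi z z' ξ (-s) j * hypF z z' ξ (-s) j / (u + 1 + j))
      (hypG z z' ξ s u) := by
  have h := (hasSum_resG_div (1 + -s * z) (1 + -s * z') hξ0 hξ1 (c := u + 1)
    (by simp; linarith)).mul_left
    ((z * z') ^ (1 / 2 : ℂ) * (ξ : ℂ) ^ (1 / 2 : ℂ) / (1 - (ξ : ℂ)))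
  rw [hypG, show 1 - s * z = 1 + -s * z by ring, show 1 - s * z' = 1 + -s * z' by ring,
    show u + 2 = u + 1 + 1 by ring]
  exact h.congr_fun fun j => by rw [← resG_eq_Psi_mul hξ0 hξ1 j, mul_div_assoc]

omit hs hξ0 hξ1 in
lemma norm_le_of_hasSum_div {r : ℕ → ℂ} (hr : Summable fun j => ‖r j‖) {k : ℕ} {x : ℂ}
    (h : HasSum (fun j : ℕ => r j / ((k : ℂ) + 1 + j)) x) : ‖x‖ ≤ ∑' j, ‖r j‖ := by
  refine h.norm_le_of_bounded hr.hasSum fun j => ?_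
  rw [add_right_comm]
  exact norm_div_natCast_add_one_le _ _ _

lemma exists_norm_hypF_le : ∃ C, ∀ k : ℕ, ‖hypF z z' ξ s k‖ ≤ C := by
  refine ⟨1 + ∑' j : ℕ, ‖Psi z z' ξ (-s) j * hypG z z' ξ (-s) j‖, fun k => ?_⟩
  have h := norm_le_of_hasSum_div (summable_norm_Psi_mul_hypG (neg_sign hs) hξ0 hξ1)
    (hasSum_hypF (z := z) (z' := z') hs hξ0 hξ1 (u := k)
      (by simp; linarith [k.cast_nonneg (α := ℝ)]))
  calc ‖hypF z z' ξ s k‖ = ‖1 - (1 - hypF z z' ξ s k)‖ := by rw [sub_sub_cancel]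
    _ ≤ ‖(1 : ℂ)‖ + ‖1 - hypF z z' ξ s k‖ := norm_sub_le _ _
    _ ≤ _ := by rw [norm_one]; gcongr

omit hs in
lemma exists_norm_hypG_le : ∃ C, ∀ k : ℕ, ‖hypG z z' ξ s k‖ ≤ C :=
  ⟨_, fun k => norm_le_of_hasSum_div (summable_norm_Psi_mul_hypF hξ0 hξ1)
    (hasSum_hypG hξ0 hξ1 (u := k) (by simp; linarith [k.cast_nonneg (α := ℝ)]))⟩

/-- The partial fraction expansions of the hypergeometric functions, with the residues at the
poles `-1, -2, …` given by the same functions with the opposite sign `±`. -/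
lemma dualPair : DualPair (rootPsi z z' ξ s) (rootPsi z z' ξ (-s))
    (fun k => hypF z z' ξ s k) (fun k => hypG z z' ξ s k)
    (fun k => hypF z z' ξ (-s) k) (fun k => hypG z z' ξ (-s) k) where
  summable_a := summable_norm_rootPsi hξ0 hξ1
  summable_b := summable_norm_rootPsi hξ0 hξ1
  bounded := by
    obtain ⟨C₁, h₁⟩ := exists_norm_hypF_le (z := z) (z' := z') hs hξ0 hξ1
    obtain ⟨C₂, h₂⟩ := exists_norm_hypG_le (z := z) (z' := z') (s := s) hξ0 hξ1
    obtain ⟨C₃, h₃⟩ := exists_norm_hypF_le (z := z) (z' := z') (neg_sign hs) hξ0 hξ1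
    obtain ⟨C₄, h₄⟩ := exists_norm_hypG_le (z := z) (z' := z') (s := -s) hξ0 hξ1
    refine ⟨max (max C₁ C₂) (max C₃ C₄), fun k => ⟨?_, ?_, ?_, ?_⟩⟩
    · exact (h₁ k).trans (by simp)
    · exact (h₂ k).trans (by simp)
    · exact (h₃ k).trans (by simp)
    · exact (h₄ k).trans (by simp)
  hF k := (hasSum_hypF hs hξ0 hξ1 (u := k) (by simp; linarith [k.cast_nonneg (α := ℝ)])).congr_fun
    fun j => by rw [rootPsi_sq, add_right_comm]
  hG k := (hasSum_hypG hξ0 hξ1 (u := k) (by simp; linarith [k.cast_nonneg (α := ℝ)])).congr_fun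
    fun j => by rw [rootPsi_sq, add_right_comm]
  hF' k := by
    have h := hasSum_hypF (z := z) (z' := z') (neg_sign hs) hξ0 hξ1 (u := k)
      (by simp; linarith [k.cast_nonneg (α := ℝ)])
    rw [neg_neg] at h
    exact h.congr_fun fun j => by rw [rootPsi_sq, add_right_comm]
  hG' k := by
    have h := hasSum_hypG (z := z) (z' := z') (s := -s) hξ0 hξ1 (u := k)
      (by simp; linarith [k.cast_nonneg (α := ℝ)])
    rw [neg_neg] at h
    exact h.congr_fun fun j => by rw [rootPsi_sq, add_right_comm]

lemma hasDerivAt_hypF {u : ℂ} (hu : 0 ≤ u.re) : HasDerivAt (hypF z z' ξ s)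
    (∑' j : ℕ, Psi z z' ξ (-s) j * hypG z z' ξ (-s) j / (u + 1 + j) ^ 2) u := by
  have h := (hasDerivAt_tsum_div
    (summable_norm_Psi_mul_hypG (z := z) (z' := z') (neg_sign hs) hξ0 hξ1) hu).const_sub 1
  rw [neg_neg] at h
  refine h.congr_of_eventuallyEq ?_
  filter_upwards [(isOpen_lt continuous_const Complex.continuous_re).mem_nhds
    (show (-1 : ℝ) < u.re by linarith)] with v hv
  rw [(hasSum_hypF hs hξ0 hξ1 hv).tsum_eq, sub_sub_cancel]

omit hs in
lemma hasDerivAt_hypG {u : ℂ} (hu : 0 ≤ u.re) : HasDerivAt (hypG z z' ξ s)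
    (-∑' j : ℕ, Psi z z' ξ (-s) j * hypF z z' ξ (-s) j / (u + 1 + j) ^ 2) u := by
  have h := hasDerivAt_tsum_div
    (summable_norm_Psi_mul_hypF (z := z) (z' := z') (s := -s) hξ0 hξ1) hu
  refine h.congr_of_eventuallyEq ?_
  filter_upwards [(isOpen_lt continuous_const Complex.continuous_re).mem_nhds
    (show (-1 : ℝ) < u.re by linarith)] with v hv
  rw [(hasSum_hypG hξ0 hξ1 hv).tsum_eq]

end HypergeometricPair

/-! ### The functions `P_±`, `Q_±` and the blocks of the kernel -/

section KernelBlocks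

open scoped ComplexOrder

variable {z z' s : ℂ} {ξ : ℝ}

lemma hasSum_of_eq {ι : Type*} {f : ι → ℂ} {a b : ℂ} (h : HasSum f a) (e : a = b) : HasSum f b :=
  e ▸ h

lemma differentiableAt_psi (hz : Admissible z z') (hs : s = 1 ∨ s = -1) (hξ0 : 0 < ξ) (k : ℕ) :
    DifferentiableAt ℂ (psi z z' ξ s) k := by
  have hG : ∀ c : ℂ, (∀ m : ℕ, 1 + c ≠ -(m : ℂ)) →
      DifferentiableAt ℂ (fun u : ℂ => Complex.Gamma (u + 1 + c)) k := by
    intro c hc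
    refine DifferentiableAt.comp (g := Complex.Gamma) _
      (Complex.differentiableAt_Gamma _ fun m h => ?_) (by fun_prop)
    refine hc (k + m) ?_
    push_cast
    linear_combination h
  have h1 := hG _ (hz.ne_neg_nat hs)
  have h2 := hG _ (hz.symm.ne_neg_nat hs)
  have h3 : DifferentiableAt ℂ (fun u : ℂ => Complex.Gamma (u + 1)) k := by
    simpa using hG 0 (by simpa using ne_neg_nat_of_re_pos (c := 1) (by simp))
  have h4 : DifferentiableAt ℂ (fun u : ℂ => (ξ : ℂ) ^ (u + 1 / 2)) k :=
    DifferentiableAt.const_cpow (by fun_prop) (Or.inl (xi_pos hξ0).ne')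
  have h5 : Complex.Gamma (k + 1) ≠ 0 := by
    rw [Complex.Gamma_nat_eq_factorial]; exact fact_ne k
  unfold psi
  refine ((((differentiableAt_const _).mul h4).mul (differentiableAt_const _)).mul
    (h1.mul h2)).div (((differentiableAt_const _).mul h3).mul h3) ?_
  exact mul_ne_zero (mul_ne_zero (mul_ne_zero (Complex.Gamma_ne_zero (hz.ne_neg_nat hs))
    (Complex.Gamma_ne_zero (hz.symm.ne_neg_nat hs))) h5) h5

lemma psi_pos (hz : Admissible z z') (hs : s = 1 ∨ s = -1) (hξ0 : 0 < ξ) (hξ1 : ξ < 1) (k : ℕ) :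
    0 < psi z z' ξ s k := by
  rw [psi_natCast hz hs]
  exact Psi_pos hz hξ0 hξ1 hs k

lemma funP_of_ne {u : ℂ} (h : psi z z' ξ s u ≠ 0) :
    funP z z' ξ s u = psi z z' ξ s u ^ (1 / 2 : ℂ) * hypF z z' ξ s u := by
  have e : psi z z' ξ s u ^ (-(1 / 2) : ℂ) * psi z z' ξ s u = psi z z' ξ s u ^ (1 / 2 : ℂ) := by
    nth_rw 2 [← Complex.cpow_one (psi z z' ξ s u)]
    rw [← Complex.cpow_add _ _ h]
    norm_num
  rw [funP, funR, ← mul_assoc, e, hypF]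

lemma funQ_of_ne {u : ℂ} (h : psi z z' ξ s u ≠ 0) :
    funQ z z' ξ s u = psi z z' ξ s u ^ (1 / 2 : ℂ) * hypG z z' ξ s u := by
  have e : psi z z' ξ s u ^ (-(1 / 2) : ℂ) * psi z z' ξ s u = psi z z' ξ s u ^ (1 / 2 : ℂ) := by
    nth_rw 2 [← Complex.cpow_one (psi z z' ξ s u)]
    rw [← Complex.cpow_add _ _ h]
    norm_num
  rw [← e, funQ, funS, hypG]
  ring

variable (hz : Admissible z z') (hs : s = 1 ∨ s = -1) (hξ0 : 0 < ξ) (hξ1 : ξ < 1)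

include hz hs hξ0 hξ1

lemma funP_natCast (k : ℕ) : funP z z' ξ s k = rootPsi z z' ξ s k * hypF z z' ξ s k := by
  rw [funP_of_ne (psi_pos hz hs hξ0 hξ1 k).ne', psi_natCast hz hs, rootPsi]

lemma funQ_natCast (k : ℕ) : funQ z z' ξ s k = rootPsi z z' ξ s k * hypG z z' ξ s k := by
  rw [funQ_of_ne (psi_pos hz hs hξ0 hξ1 k).ne', psi_natCast hz hs, rootPsi]

/-- The derivatives of `P_±` and `Q_±` at `k`; the number `d` is the derivative of `ψ_±^{1/2}`. -/
lemma exists_hasDerivAt (k : ℕ) : ∃ d : ℂ,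
    HasDerivAt (funP z z' ξ s) (d * hypF z z' ξ s k + rootPsi z z' ξ s k *
      ∑' j : ℕ, Psi z z' ξ (-s) j * hypG z z' ξ (-s) j / ((k : ℂ) + 1 + j) ^ 2) k ∧
    HasDerivAt (funQ z z' ξ s) (d * hypG z z' ξ s k + rootPsi z z' ξ s k *
      -∑' j : ℕ, Psi z z' ξ (-s) j * hypF z z' ξ (-s) j / ((k : ℂ) + 1 + j) ^ 2) k := by
  have hd := differentiableAt_psi hz hs hξ0 k
  have hpos := psi_pos hz hs hξ0 hξ1 k
  have hslit : psi z z' ξ s k ∈ Complex.slitPlane := Or.inl (Complex.pos_iff.1 hpos).1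
  have hφ : DifferentiableAt ℂ (fun u => psi z z' ξ s u ^ (1 / 2 : ℂ)) k :=
    hd.cpow (differentiableAt_const _) hslit
  have hk : 0 ≤ (k : ℂ).re := by simp
  have e : psi z z' ξ s k ^ (1 / 2 : ℂ) = rootPsi z z' ξ s k := by
    rw [psi_natCast hz hs, rootPsi]
  have hne : ∀ᶠ u in 𝓝 (k : ℂ), psi z z' ξ s u ≠ 0 := hd.continuousAt.eventually_ne hpos.ne'
  refine ⟨deriv (fun u => psi z z' ξ s u ^ (1 / 2 : ℂ)) k, ?_, ?_⟩
  · rw [← e]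
    exact (hφ.hasDerivAt.mul (hasDerivAt_hypF hs hξ0 hξ1 hk)).congr_of_eventuallyEq
      (hne.mono fun u hu => funP_of_ne hu)
  · rw [← e]
    exact (hφ.hasDerivAt.mul (hasDerivAt_hypG hξ0 hξ1 hk)).congr_of_eventuallyEq
      (hne.mono fun u hu => funQ_of_ne hu)

lemma tendsto_diagQuot (k : ℕ) : DifferentiableAt ℂ (funP z z' ξ s) k ∧
    DifferentiableAt ℂ (funQ z z' ξ s) k ∧
    Tendsto (fun u : ℂ => diagQuot z z' ξ s k u) (𝓝[≠] (k : ℂ)) (𝓝 (diagBlock z z' ξ s k k)) := by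
  obtain ⟨d, hP, hQ⟩ := exists_hasDerivAt hz hs hξ0 hξ1 k
  refine ⟨hP.differentiableAt, hQ.differentiableAt, ?_⟩
  rw [diagBlock, if_pos rfl]
  have hN := ((hQ.differentiableAt.hasDerivAt.const_mul (funP z z' ξ s k)).sub
    (hP.differentiableAt.hasDerivAt.const_mul (funQ z z' ξ s k))).neg
  have h1 := hasDerivAt_iff_tendsto_slope.1 hN
  rw [show -(funP z z' ξ s k * deriv (funQ z z' ξ s) k - funQ z z' ξ s k * deriv (funP z z' ξ s) k)
    = deriv (funP z z' ξ s) k * funQ z z' ξ s k - funP z z' ξ s k * deriv (funQ z z' ξ s) k by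
    ring] at h1
  refine h1.congr' ?_
  filter_upwards [self_mem_nhdsWithin] with u hu
  have h2 : u - k ≠ 0 := sub_ne_zero.2 hu
  have h3 : (k : ℂ) - u ≠ 0 := sub_ne_zero.2 (Ne.symm hu)
  rw [slope_def_field, diagQuot, div_eq_div_iff h2 h3]
  simp only [Pi.neg_apply, Pi.sub_apply]
  ring

/-- The diagonal blocks of the kernel are `A Bᵗ` (`s = 1`) and `Aᵗ B` (`s = -1`), where `A` and `B` are
the off-diagonal blocks of `L` and `K`. -/
lemma hasSum_diagBlock (k l : ℕ) :
    HasSum (fun m => cauchyMat (rootPsi z z' ξ s) (rootPsi z z' ξ (-s)) k m *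
      offBlock (rootPsi z z' ξ s) (rootPsi z z' ξ (-s))
        (fun k => hypF z z' ξ s k) (fun k => hypG z z' ξ s k)
        (fun k => hypF z z' ξ (-s) k) (fun k => hypG z z' ξ (-s) k) l m)
      (diagBlock z z' ξ s k l) := by
  have h := dualPair (z := z) (z' := z') hs hξ0 hξ1
  rcases eq_or_ne k l with rfl | hkl
  · obtain ⟨d, hP, hQ⟩ := exists_hasDerivAt hz hs hξ0 hξ1 k
    -- the squares `1 / (k + 1 + m)²` only improve the convergence
    have hsum : ∀ r : ℕ → ℂ, Summable (fun j => ‖r j‖) →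
        Summable fun j : ℕ => r j / ((k : ℂ) + 1 + j) ^ 2 := by
      intro r hr
      refine Summable.of_norm_bounded hr fun j => ?_
      rw [add_right_comm, pow_two, ← div_div]
      exact (norm_div_natCast_add_one_le _ _ _).trans (norm_div_natCast_add_one_le _ _ _)
    have hf := (hsum _
      (summable_norm_Psi_mul_hypG (z := z) (z' := z') (neg_sign hs) hξ0 hξ1)).hasSum
    have hg := (hsum _ (summable_norm_Psi_mul_hypF (z := z) (z' := z') (s := -s) hξ0 hξ1)).hasSum
    have e := DualPair.hasSum_diag_self (a := rootPsi z z' ξ s) (F := fun k => hypF z z' ξ s k)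
      (G := fun k => hypG z z' ξ s k) (k := k)
      (hf.congr_fun fun m => by rw [rootPsi_sq, add_right_comm])
      (hg.congr_fun fun m => by rw [rootPsi_sq, add_right_comm])
    rw [diagBlock, if_pos rfl, hP.deriv, hQ.deriv, funP_natCast hz hs hξ0 hξ1,
      funQ_natCast hz hs hξ0 hξ1]
    exact hasSum_of_eq e (by ring)
  · have e := h.hasSum_diag_of_ne hkl
    rw [diagBlock, if_neg hkl, diagQuot, funP_natCast hz hs hξ0 hξ1, funP_natCast hz hs hξ0 hξ1,
      funQ_natCast hz hs hξ0 hξ1, funQ_natCast hz hs hξ0 hξ1]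
    exact hasSum_of_eq e (by ring)

end KernelBlocks

/-! ### The resolvent of `L` -/

section Resolvent

/-- The block matrix `[D, B; -Bᵗ, D']` on `ℤ'`. -/
def blockMat (D B D' : ℕ → ℕ → ℂ) : HalfInt → HalfInt → ℂ
  | .inl k, .inl l => D k l
  | .inl k, .inr l => B k l
  | .inr k, .inl l => -B l k
  | .inr k, .inr l => D' k l

/-- The sequences `|a_k|` and `|b_k|` as a function on `ℤ'`. -/
def halfNorm (a b : ℕ → ℂ) : HalfInt → ℝ
  | .inl k => ‖a k‖
  | .inr k => ‖b k‖

lemma halfNorm_nonneg (a b : ℕ → ℂ) (x : HalfInt) : 0 ≤ halfNorm a b x := by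
  rcases x with k | k <;> exact norm_nonneg _

lemma summable_halfNorm {a b : ℕ → ℂ} (ha : Summable fun k => ‖a k‖)
    (hb : Summable fun k => ‖b k‖) : Summable (halfNorm a b) :=
  Summable.sum _ ha hb

lemma norm_skewMat_le (a b : ℕ → ℂ) (x y : HalfInt) :
    ‖skewMat (cauchyMat a b) x y‖ ≤ halfNorm a b x * halfNorm a b y := by
  rcases x with k | k <;> rcases y with l | l
  · simpa [skewMat, halfNorm] using by positivity
  · exact DualPair.norm_cauchyMat_le a b k l
  · simp only [skewMat, halfNorm, norm_neg]
    rw [mul_comm]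
    exact DualPair.norm_cauchyMat_le a b l k
  · simpa [skewMat, halfNorm] using by positivity

namespace DualPair

variable {a b F G F' G' : ℕ → ℂ}

lemma exists_norm_diag_le (h : DualPair a b F G F' G') {D : ℕ → ℕ → ℂ}
    (hD : ∀ k l, HasSum (fun m => cauchyMat a b k m * offBlock a b F G F' G' l m) (D k l)) :
    ∃ C : ℝ, ∀ k l, ‖D k l‖ ≤ C * (‖a k‖ * ‖a l‖) := by
  obtain ⟨C, hC0, hC⟩ := h.exists_norm_offBlock_le
  obtain ⟨E, hE⟩ := h.symm.exists_bound_a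
  have hs : Summable fun m => ‖b m‖ * ‖b m‖ := by
    refine Summable.of_nonneg_of_le (fun _ => by positivity) (fun m => ?_)
      (h.summable_b.mul_left E)
    gcongr
    exact hE m
  refine ⟨C * ∑' m, ‖b m‖ * ‖b m‖, fun k l => ?_⟩
  have h1 := (hD k l).norm_le_of_bounded (hs.hasSum.mul_left (C * (‖a k‖ * ‖a l‖))) fun m => by
    rw [norm_mul]
    calc _ ≤ (‖a k‖ * ‖b m‖) * (C * (‖a l‖ * ‖b m‖)) := by
          gcongr
          · exact norm_cauchyMat_le a b k m
          · exact hC l m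
      _ = _ := by ring
  exact h1.trans_eq (by ring)

variable {D D' : ℕ → ℕ → ℂ}
  (hD : ∀ k l, HasSum (fun m => cauchyMat a b k m * offBlock a b F G F' G' l m) (D k l))
  (hD' : ∀ k l, HasSum (fun m => cauchyMat a b m k * offBlock a b F G F' G' m l) (D' k l))

include hD hD'

lemma exists_norm_blockMat_le (h : DualPair a b F G F' G') : ∃ C : ℝ, ∀ x y,
    ‖blockMat D (offBlock a b F G F' G') D' x y‖ ≤ C * (halfNorm a b x * halfNorm a b y) := by
  obtain ⟨C₁, h₁⟩ := h.exists_norm_diag_le hD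
  obtain ⟨C₂, h₂⟩ := h.symm.exists_norm_diag_le (D := D') fun k l => by
    simpa only [cauchyMat_swap, offBlock_swap] using hD' k l
  obtain ⟨C₃, -, h₃⟩ := h.exists_norm_offBlock_le
  refine ⟨max C₁ (max C₂ C₃), fun x y => ?_⟩
  have h0 := mul_nonneg (halfNorm_nonneg a b x) (halfNorm_nonneg a b y)
  rcases x with k | k <;> rcases y with l | l
  · exact (h₁ k l).trans (mul_le_mul_of_nonneg_right (by simp) h0)
  · exact (h₃ k l).trans (mul_le_mul_of_nonneg_right (by simp) h0)
  · refine le_trans ?_ (mul_le_mul_of_nonneg_right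
      ((le_max_right C₂ C₃).trans (le_max_right _ _)) h0)
    simp only [blockMat, halfNorm, norm_neg]
    rw [mul_comm ‖b k‖]
    exact h₃ l k
  · exact (h₂ k l).trans (mul_le_mul_of_nonneg_right (by simp) h0)

/-- The identity `K + L K = L`, entry by entry. -/
lemma hasSum_blockMat_mul_skewMat (h : DualPair a b F G F' G') (x y : HalfInt) :
    HasSum (fun w => blockMat D (offBlock a b F G F' G') D' w y * skewMat (cauchyMat a b) x w)
      (skewMat (cauchyMat a b) x y - blockMat D (offBlock a b F G F' G') D' x y) := by
  have key : ∀ {f : HalfInt → ℂ} {p q : ℂ}, HasSum (fun m => f (.inl m)) p →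
      HasSum (fun m => f (.inr m)) q → HasSum f (p + q) := fun h₁ h₂ => HasSum.sum h₁ h₂
  have hswap : ∀ k l, HasSum (fun m => cauchyMat b a k m * offBlock b a F' G' F G l m) (D' k l) :=
    fun k l => by simpa only [cauchyMat_swap, offBlock_swap] using hD' k l
  rcases x with k | k <;> rcases y with l | l
  · refine hasSum_of_eq (key (p := 0) (q := -D k l) ?_ ?_) (by simp [skewMat, blockMat])
    · simp [skewMat]
    · refine (hD k l).neg.congr_fun fun m => ?_
      simp only [blockMat, skewMat]
      ring
  · refine hasSum_of_eq (key (p := 0) (q := cauchyMat a b k l - offBlock a b F G F' G' k l) ?_ ?_)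
      (by simp [skewMat, blockMat])
    · simp [skewMat]
    · refine (h.hasSum_cauchyMat_mul_diag k l (D := fun m => D' m l) fun m => hD' m l).congr_fun
        fun m => ?_
      simp only [blockMat, skewMat]
      ring
  · refine hasSum_of_eq (key (q := 0)
      (p := -(cauchyMat b a k l - offBlock b a F' G' F G k l)) ?_ ?_) ?_
    · refine (h.symm.hasSum_cauchyMat_mul_diag k l (D := fun m => D m l) fun m => ?_).neg.congr_fun
        fun m => ?_
      · simpa only [cauchyMat_swap, offBlock_swap] using hD m l
      · simp only [blockMat, skewMat, cauchyMat_swap]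
        ring
    · simp [skewMat]
    · simp only [skewMat, blockMat, cauchyMat_swap, offBlock_swap]
      ring
  · refine hasSum_of_eq (key (q := 0) (p := -D' k l) ?_ ?_) (by simp [skewMat, blockMat])
    · refine (hD' k l).neg.congr_fun fun m => ?_
      simp only [blockMat, skewMat]
      ring
    · simp [skewMat]

/-- The matrix of `L (1 + L)⁻¹` is `[A Bᵗ, B; -Bᵗ, Aᵗ B]`. The bounds on the entries show that its
columns are vectors of `ℓ²`, for which `(1 + L) K = L` can be checked entry by entry. -/
theorem mul_inverse_apply (h : DualPair a b F G F' G') {T : Ell2 →L[ℂ] Ell2}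
    (hT : ∀ x y, T (basisVec y) x = skewMat (cauchyMat a b) x y) (hu : IsUnit (1 + T))
    (x y : HalfInt) : (T * Ring.inverse (1 + T)) (basisVec y) x =
      blockMat D (offBlock a b F G F' G') D' x y := by
  obtain ⟨C, hC⟩ := h.exists_norm_blockMat_le hD hD'
  obtain ⟨S, hS⟩ := exists_operator (M := blockMat D (offBlock a b F G F' G') D')
    ((summable_halfNorm h.summable_a h.summable_b).mul_left (max C 1)) fun x y => by
      have h0 := mul_nonneg (halfNorm_nonneg a b x) (halfNorm_nonneg a b y)
      refine (hC x y).trans ?_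
      calc _ ≤ (max C 1 * max C 1) * (halfNorm a b x * halfNorm a b y) := by
            refine mul_le_mul_of_nonneg_right ?_ h0
            exact (le_max_left C 1).trans (le_mul_of_one_le_left (by positivity) (le_max_right C 1))
        _ = _ := by ring
  rw [mul_inverse_apply_eq hu (κ := S (basisVec y)), hS]
  ext w
  have h1 := hasSum_apply T (S (basisVec y)) w
  simp only [hS, hT] at h1
  have h2 := h1.unique (h.hasSum_blockMat_mul_skewMat hD hD' w y)
  rw [add_apply, lp.coeFn_add, Pi.add_apply, h2, hT,
    one_apply_eq_self, hS]
  ring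

end DualPair

lemma adjoint_eq_neg_of_skewMat {A : ℕ → ℕ → ℂ} (hA : ∀ k l, (starRingEnd ℂ) (A k l) = A k l)
    {T : Ell2 →L[ℂ] Ell2} (hT : ∀ x y, T (basisVec y) x = skewMat A x y) :
    ContinuousLinearMap.adjoint T = -T := by
  refine adjoint_eq_neg fun x y => ?_
  rw [hT, hT]
  rcases x with k | k <;> rcases y with l | l <;> simp [skewMat, hA]

end Resolvent

section HypergeometricResolvent

open scoped ComplexOrder

variable {z z' : ℂ} {ξ : ℝ} (hz : Admissible z z') (hξ0 : 0 < ξ) (hξ1 : ξ < 1)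

include hz hξ0 hξ1

lemma hasSum_diagBlock_neg (k l : ℕ) :
    HasSum (fun m => cauchyMat (rootPsi z z' ξ 1) (rootPsi z z' ξ (-1)) m k *
      offBlock (rootPsi z z' ξ 1) (rootPsi z z' ξ (-1))
        (fun k => hypF z z' ξ 1 k) (fun k => hypG z z' ξ 1 k)
        (fun k => hypF z z' ξ (-1) k) (fun k => hypG z z' ξ (-1) k) m l)
      (diagBlock z z' ξ (-1) k l) := by
  have h := hasSum_diagBlock hz (neg_sign (Or.inl rfl)) hξ0 hξ1 k l
  rw [neg_neg] at h
  refine h.congr_fun fun m => ?_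
  rw [cauchyMat_swap, offBlock_swap]

lemma hypKernel_eq : hypKernel z z' ξ = blockMat (diagBlock z z' ξ 1)
    (offBlock (rootPsi z z' ξ 1) (rootPsi z z' ξ (-1))
      (fun k => hypF z z' ξ 1 k) (fun k => hypG z z' ξ 1 k)
      (fun k => hypF z z' ξ (-1) k) (fun k => hypG z z' ξ (-1) k)) (diagBlock z z' ξ (-1)) := by
  funext x y
  rcases x with k | k <;> rcases y with l | l
  · rfl
  · simp only [hypKernel, blockMat, offBlock, funP_natCast hz (Or.inl rfl) hξ0 hξ1,
      funP_natCast hz (Or.inr rfl) hξ0 hξ1, funQ_natCast hz (Or.inl rfl) hξ0 hξ1,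
      funQ_natCast hz (Or.inr rfl) hξ0 hξ1]
    ring
  · simp only [hypKernel, blockMat, offBlock, funP_natCast hz (Or.inl rfl) hξ0 hξ1,
      funP_natCast hz (Or.inr rfl) hξ0 hξ1, funQ_natCast hz (Or.inl rfl) hξ0 hξ1,
      funQ_natCast hz (Or.inr rfl) hξ0 hξ1, add_comm (l : ℂ)]
    ring
  · rfl

/-- The operator `L` is bounded and skew-adjoint, and the hypergeometric kernel is the matrix of
`L (1 + L)⁻¹`. -/
theorem exists_operator_resolvent : ∃ L : Ell2 →L[ℂ] Ell2,
    (∀ x y, L (basisVec y) x = matL z z' ξ x y) ∧ ContinuousLinearMap.adjoint L = -L ∧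
    IsUnit (1 + L) ∧
    ∀ x y, (L * Ring.inverse (1 + L)) (basisVec y) x = hypKernel z z' ξ x y := by
  have h := dualPair (z := z) (z' := z') (s := 1) (Or.inl rfl) hξ0 hξ1
  obtain ⟨L, hL⟩ := exists_operator
    (M := skewMat (cauchyMat (rootPsi z z' ξ 1) (rootPsi z z' ξ (-1))))
    (summable_halfNorm h.summable_a h.summable_b) (norm_skewMat_le _ _)
  have hadj := adjoint_eq_neg_of_skewMat (fun k l => by
    simp only [cauchyMat, map_div₀, map_mul, map_add, map_natCast, map_one,
      conj_of_pos (rootPsi_pos hz hξ0 hξ1 (Or.inl rfl) k),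
      conj_of_pos (rootPsi_pos hz hξ0 hξ1 (Or.inr rfl) l)]) hL
  have hu := isUnit_one_add_of_adjoint_eq_neg hadj
  refine ⟨L, fun x y => by rw [hL, matL_eq], hadj, hu, fun x y => ?_⟩
  rw [h.mul_inverse_apply (hasSum_diagBlock hz (Or.inl rfl) hξ0 hξ1)
    (hasSum_diagBlock_neg hz hξ0 hξ1) hL hu, hypKernel_eq hz hξ0 hξ1]

end HypergeometricResolvent

/-! ### The weights of the mixed measure as principal minors -/

section Weights

open scoped ComplexOrder

variable {z z' : ℂ} {ξ : ℝ}

/-- The factor of the weight of `λ` that does not depend on `ξ`: the weight is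
`(1 - ξ)^t ξ^{|λ|}` times this. The products `1 * z` and `-1 * z` keep the form `s * z` of `Psi`. -/
def frobWeight (z z' : ℂ) (lam : YoungDiagram) : ℂ :=
  (∏ i ∈ Finset.range (diagLen lam), (z * z') *
    ((poch (1 + 1 * z) (frobP lam i) * poch (1 + 1 * z') (frobP lam i)) /
      ((frobP lam i).factorial : ℂ) ^ 2) *
    ((poch (1 + -1 * z) (frobQ lam i) * poch (1 + -1 * z') (frobQ lam i)) /
      ((frobQ lam i).factorial : ℂ) ^ 2)) * cauchyDetSq lam

lemma frobWeight_pos (hz : Admissible z z') (lam : YoungDiagram) : 0 < frobWeight z z' lam := by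
  refine mul_pos (Finset.prod_pos fun i _ => mul_pos (mul_pos hz.mul_pos ?_) ?_)
    (by exact_mod_cast cauchyDetSq_pos lam)
  · exact div_pos (hz.poch_one_add_pos (Or.inl rfl) _) (pow_pos (factorial_pos' _) 2)
  · exact div_pos (hz.poch_one_add_pos (Or.inr rfl) _) (pow_pos (factorial_pos' _) 2)

lemma Psi_mul_Psi (hξ0 : 0 < ξ) (hξ1 : ξ < 1) (p q : ℕ) :
    Psi z z' ξ 1 p * Psi z z' ξ (-1) q = (z * z') *
      ((poch (1 + 1 * z) p * poch (1 + 1 * z') p) / (p.factorial : ℂ) ^ 2) *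
      ((poch (1 + -1 * z) q * poch (1 + -1 * z') q) / (q.factorial : ℂ) ^ 2) *
      (ξ : ℂ) ^ (p + q + 1) := by
  have ht := cpow_half_sq (z * z')
  have hx := cpow_half_sq (ξ : ℂ)
  have hE : (1 - (ξ : ℂ)) ^ (1 * (z + z')) * (1 - (ξ : ℂ)) ^ (-1 * (z + z')) = 1 := by
    rw [← Complex.cpow_add _ _ (one_sub_ne hξ1), ← add_mul, add_neg_cancel, zero_mul,
      Complex.cpow_zero]
  rw [Psi, Psi, xi_cpow_add_half hξ0, xi_cpow_add_half hξ0]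
  generalize (z * z') ^ (1 / 2 : ℂ) = T at *
  generalize (ξ : ℂ) ^ (1 / 2 : ℂ) = X at *
  generalize (1 - (ξ : ℂ)) ^ (1 * (z + z')) = E at *
  generalize (1 - (ξ : ℂ)) ^ (-1 * (z + z')) = E' at *
  rw [← ht, pow_add (ξ : ℂ) (p + q), pow_add (ξ : ℂ) p, pow_one, ← hx]
  calc _ = E * E' * (T ^ 2 * ((poch (1 + 1 * z) p * poch (1 + 1 * z') p) / (p.factorial : ℂ) ^ 2) *
      ((poch (1 + -1 * z) q * poch (1 + -1 * z') q) / (q.factorial : ℂ) ^ 2) *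
      ((X ^ 2) ^ p * (X ^ 2) ^ q * X ^ 2)) := by ring
    _ = _ := by rw [hE, one_mul]

lemma minor_matL_config (hξ0 : 0 < ξ) (hξ1 : ξ < 1) (lam : YoungDiagram) :
    minor (matL z z' ξ) (config lam) = frobWeight z z' lam * (ξ : ℂ) ^ lam.card := by
  rw [matL_eq, minor_cauchyMat_config, frobWeight, card_eq_sum_frob, ← Finset.prod_pow_eq_pow_sum,
    mul_right_comm, ← Finset.prod_mul_distrib]
  congr 1
  refine Finset.prod_congr rfl fun i _ => ?_
  rw [rootPsi_sq, rootPsi_sq, Psi_mul_Psi hξ0 hξ1]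

lemma mixedMeasure_eq (hz : Admissible z z') (lam : YoungDiagram) :
    mixedMeasure z z' ξ lam =
      (1 - (ξ : ℂ)) ^ (z * z') * (frobWeight z z' lam * (ξ : ℂ) ^ lam.card) := by
  have h1 := (hz.poch_mul_pos lam.card).ne'
  have h2 := fact_ne lam.card
  rw [mixedMeasure, zMeasure, negBinomial, det_sq_eq_cauchyDetSq, frobWeight]
  have e : (z * z') ^ diagLen lam * (∏ i ∈ Finset.range (diagLen lam),
      (poch (z + 1) (frobP lam i) * poch (z' + 1) (frobP lam i) *
        poch (-z + 1) (frobQ lam i) * poch (-z' + 1) (frobQ lam i)) /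
      (((frobP lam i).factorial : ℂ) ^ 2 * ((frobQ lam i).factorial : ℂ) ^ 2)) =
    ∏ i ∈ Finset.range (diagLen lam), (z * z') *
    ((poch (1 + 1 * z) (frobP lam i) * poch (1 + 1 * z') (frobP lam i)) /
      ((frobP lam i).factorial : ℂ) ^ 2) *
    ((poch (1 + -1 * z) (frobQ lam i) * poch (1 + -1 * z') (frobQ lam i)) /
      ((frobQ lam i).factorial : ℂ) ^ 2) := by
    rw [← Finset.card_range (diagLen lam), ← Finset.prod_const, Finset.card_range,
      ← Finset.prod_mul_distrib]
    refine Finset.prod_congr rfl fun i _ => ?_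
    rw [one_mul, one_mul, neg_one_mul, neg_one_mul, add_comm 1 z, add_comm 1 z', add_comm 1 (-z),
      add_comm 1 (-z')]
    ring
  rw [← e]
  field_simp

lemma mixedMeasure_pos (hz : Admissible z z') (hξ0 : 0 < ξ) (hξ1 : ξ < 1) (lam : YoungDiagram) :
    0 < mixedMeasure z z' ξ lam := by
  rw [mixedMeasure_eq hz]
  exact mul_pos (cpow_pos (one_sub_xi_pos hξ1) (Complex.pos_iff.1 hz.mul_pos).2.symm)
    (mul_pos (frobWeight_pos hz lam) (pow_pos (xi_pos hξ0) _))

lemma minor_matL_eq_zero {Y : Finset HalfInt} (hY : Y ∉ Set.range config) :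
    minor (matL z z' ξ) Y = 0 := by
  rw [matL_eq]
  exact minor_skewMat_of_card_ne _ fun h => hY (exists_config_eq h)

lemma minor_matL_nonneg (hz : Admissible z z') (hξ0 : 0 < ξ) (hξ1 : ξ < 1) (Y : Finset HalfInt) :
    0 ≤ minor (matL z z' ξ) Y := by
  by_cases hY : Y ∈ Set.range config
  · obtain ⟨lam, rfl⟩ := hY
    rw [minor_matL_config hξ0 hξ1]
    exact (mul_pos (frobWeight_pos hz lam) (pow_pos (xi_pos hξ0) _)).le
  · rw [minor_matL_eq_zero hY]

lemma norm_minor_matL (hz : Admissible z z') (hξ0 : 0 < ξ) (hξ1 : ξ < 1) (Y : Finset HalfInt) :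
    ((‖minor (matL z z' ξ) Y‖ : ℝ) : ℂ) = minor (matL z z' ξ) Y :=
  RCLike.norm_of_nonneg' (minor_matL_nonneg hz hξ0 hξ1 Y)

lemma summable_minor_matL (hz : Admissible z z') (hξ0 : 0 < ξ) (hξ1 : ξ < 1) :
    Summable fun Y => ‖minor (matL z z' ξ) Y‖ := by
  have h := dualPair (z := z) (z' := z') (s := 1) (Or.inl rfl) hξ0 hξ1
  refine summable_norm_minor (summable_halfNorm h.summable_a h.summable_b) (fun x y => ?_)
    (halfNorm_nonneg _ _) (norm_minor_matL hz hξ0 hξ1)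
  rw [matL_eq]
  exact norm_skewMat_le _ _ x y

/-- The correlation functions of the (unnormalised) determinantal measure given by `L`. -/
lemma hasSum_minor_matL_of_subset (hz : Admissible z z') (hξ0 : 0 < ξ) (hξ1 : ξ < 1) {Z : ℂ}
    (hZ : HasSum (minor (matL z z' ξ)) Z) (X : Finset HalfInt) :
    HasSum (fun Y : Finset HalfInt => if X ⊆ Y then minor (matL z z' ξ) Y else 0)
      (Z * minor (hypKernel z z' ξ) X) := by
  obtain ⟨L, hL, hadj, -, hK⟩ := exists_operator_resolvent hz hξ0 hξ1
  have h := hasSum_minor_of_subset hL hadj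
    (det_one_add_finSection_ne_zero (norm_minor_matL hz hξ0 hξ1)) hZ
    (summable_minor_matL hz hξ0 hξ1) X
  simpa only [hK] using h

/-- Sums over configurations weighted by the minors of `L` are sums over Young diagrams. -/
lemma hasSum_config_iff {f : Finset HalfInt → ℂ} {S : ℂ} (hf : ∀ Y ∉ Set.range config, f Y = 0) :
    HasSum (fun lam => f (config lam)) S ↔ HasSum f S :=
  config_injective.hasSum_iff hf

end Weights

/-! ### The normalisation constant -/

section Normalisation

/-- Tonelli's theorem for double series. -/
lemma hasSum_comm_of_nonneg {α β : Type*} {P : α → β → ℝ} {r : α → ℝ} {c : β → ℝ} {R : ℝ}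
    (h0 : ∀ x y, 0 ≤ P x y) (h1 : ∀ x, HasSum (P x) (r x)) (h2 : HasSum r R)
    (h3 : ∀ y, HasSum (fun x => P x y) (c y)) : HasSum c R := by
  have hs : Summable fun p : α × β => P p.1 p.2 := by
    refine (summable_prod_of_nonneg fun p => h0 p.1 p.2).2 ⟨fun x => (h1 x).summable, ?_⟩
    refine h2.summable.congr fun x => ?_
    exact (h1 x).tsum_eq.symm
  have e1 : HasSum r (∑' p : α × β, P p.1 p.2) := HasSum.prod_fiberwise hs.hasSum h1
  have e2 : HasSum (fun p : β × α => P p.2 p.1) R := by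
    have := (Equiv.prodComm β α).hasSum_iff.2 hs.hasSum
    rw [e1.unique h2] at this
    exact this
  exact HasSum.prod_fiberwise e2 h3

/-- A power series `Z` with nonnegative coefficients and `x Z'(x) = t x (1 - x)⁻¹ Z(x)`, `Z(0) = 1`,
is `(1 - x)⁻ᵗ`. -/
lemma eq_one_sub_rpow_of_euler {ι : Type*} {W : ι → ℝ} {n : ι → ℕ} {Z : ℝ → ℝ} {t : ℝ}
    (hW : ∀ i, 0 ≤ W i)
    (hZ : ∀ x, 0 < x → x < 1 → HasSum (fun i => W i * x ^ n i) (Z x))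
    (hZ' : ∀ x, 0 < x → x < 1 → HasSum (fun i => n i * (W i * x ^ n i)) (Z x * (t * x / (1 - x))))
    (h0 : HasSum (fun i => W i * 0 ^ n i) 1) {x : ℝ} (hx0 : 0 < x) (hx1 : x < 1) :
    (1 - x) ^ t * Z x = 1 := by
  set f : ℝ → ℝ := fun y => ∑' i, W i * y ^ n i with hf
  have hfZ : ∀ y, 0 < y → y < 1 → f y = Z y := fun y h h' => (hZ y h h').tsum_eq
  obtain ⟨ρ, hxρ, hρ1⟩ := exists_between hx1
  have hρ0 : 0 < ρ := hx0.trans hxρ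
  have hder : ∀ y ∈ Set.Ioo (-ρ) ρ, HasDerivAt f (∑' i, W i * (n i * y ^ (n i - 1))) y := by
    intro y hy
    -- the series `∑ n W ρⁿ` dominates the differentiated one on `(-ρ, ρ)`
    refine hasDerivAt_tsum_of_isPreconnected
      (u := fun i => ρ⁻¹ * (n i * (W i * ρ ^ n i))) (((hZ' ρ hρ0 hρ1).summable).mul_left _)
      isOpen_Ioo (convex_Ioo _ _).isPreconnected
      (fun i v _ => (hasDerivAt_pow (n i) v).const_mul (W i)) (fun i v hv => ?_)
      (show (0 : ℝ) ∈ Set.Ioo (-ρ) ρ from ⟨by linarith, hρ0⟩) h0.summable hy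
    have hv' : |v| ≤ ρ := abs_le.2 ⟨hv.1.le, hv.2.le⟩
    rw [Real.norm_eq_abs, abs_mul, abs_mul, abs_pow, abs_of_nonneg (hW i), Nat.abs_cast]
    rcases Nat.eq_zero_or_pos (n i) with h | h
    · simp [h]
    · calc W i * (n i * |v| ^ (n i - 1)) ≤ W i * (n i * ρ ^ (n i - 1)) := by
            have := hW i
            gcongr
        _ = _ := by
            obtain ⟨m, hm⟩ := Nat.exists_eq_add_of_lt h
            rw [hm, show 0 + m + 1 - 1 = m by omega, zero_add, pow_succ]
            field_simp
  -- the mean value theorem needs no derivative at `0`, where the differential equation is void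
  have hder' : ∀ y ∈ Set.Ioo 0 x, HasDerivAt (fun y => (1 - y) ^ t * f y) 0 y := by
    intro y hy
    have hy1 : 0 < 1 - y := by linarith [hy.2]
    have h1 := hder y ⟨by linarith [hy.1], by linarith [hy.2]⟩
    have e : ∑' i, W i * (n i * y ^ (n i - 1)) = Z y * (t / (1 - y)) := by
      have h2 := (hZ' y hy.1 (by linarith)).mul_left y⁻¹
      rw [show y⁻¹ * (Z y * (t * y / (1 - y))) = Z y * (t / (1 - y)) by
        have := hy.1.ne'
        field_simp] at h2
      rw [← h2.tsum_eq]
      refine tsum_congr fun i => ?_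
      rcases Nat.eq_zero_or_pos (n i) with h | h
      · simp [h]
      · obtain ⟨m, hm⟩ := Nat.exists_eq_add_of_lt h
        rw [hm, show 0 + m + 1 - 1 = m by omega, zero_add, pow_succ]
        have := hy.1.ne'
        field_simp
    rw [e, ← hfZ y hy.1 (by linarith)] at h1
    have h3 : HasDerivAt (fun y : ℝ => (1 - y) ^ t) (-1 * t * (1 - y) ^ (t - 1)) y :=
      HasDerivAt.rpow_const ((hasDerivAt_id y).const_sub 1) (Or.inl hy1.ne')
    have h4 := h3.mul h1
    rw [Real.rpow_sub_one hy1.ne'] at h4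
    rw [show (0 : ℝ) = -1 * t * ((1 - y) ^ t / (1 - y)) * f y +
      (1 - y) ^ t * (f y * (t / (1 - y))) by ring]
    exact h4
  have hcont : ContinuousOn (fun y => (1 - y) ^ t * f y) (Set.Icc 0 x) := by
    intro y hy
    refine ContinuousAt.continuousWithinAt (ContinuousAt.mul ?_ ?_)
    · exact ContinuousAt.rpow_const (by fun_prop) (Or.inl (by linarith [hy.2]))
    · exact (hder y ⟨by linarith [hy.1], by linarith [hy.2]⟩).continuousAt
  obtain ⟨c, -, hc⟩ := exists_hasDerivAt_eq_slope _ _ hx0 hcont hder'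
  have h5 : (1 - x) ^ t * f x - (1 - 0) ^ t * f 0 = 0 := by
    have : x - 0 ≠ 0 := by linarith
    rw [eq_div_iff this] at hc
    linarith
  rw [hfZ x hx0 hx1, sub_zero, Real.one_rpow, show f 0 = 1 from h0.tsum_eq] at h5
  linarith

end Normalisation

/-! ### Total mass and correlation functions -/

section TotalMass

open scoped ComplexOrder

/-- The absolute value `k + 1/2` of a half-integer. -/
def absHalf : HalfInt → ℝ
  | .inl k => k + 1 / 2
  | .inr k => k + 1 / 2

lemma absHalf_nonneg (x : HalfInt) : 0 ≤ absHalf x := by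
  rcases x with k | k <;> simp only [absHalf] <;> positivity

lemma sum_absHalf_config (lam : YoungDiagram) : ∑ x ∈ config lam, absHalf x = lam.card := by
  rw [config, Finset.sum_disjSum, Finset.sum_image (injOn_frobP lam),
    Finset.sum_image (injOn_frobQ lam), card_eq_sum_frob, ← Finset.sum_add_distrib]
  push_cast
  refine Finset.sum_congr rfl fun i _ => ?_
  simp only [absHalf]
  ring

lemma minor_singleton {ι : Type*} [DecidableEq ι] (M : ι → ι → ℂ) (x : ι) :
    minor M {x} = M x x := by
  rw [minor_eq_det_of_enum (κ := Unit) M (fun _ => x) (fun _ _ _ => rfl) (by simp [eq_comm])]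
  simp

variable {z z' : ℂ}

lemma frobWeight_bot (z z' : ℂ) : frobWeight z z' ⊥ = 1 := by
  have h : diagLen ⊥ = 0 := by simp [diagLen]
  have hE : IsEmpty (Fin (diagLen ⊥)) := by rw [h]; infer_instance
  rw [frobWeight, cauchyDetSq, Matrix.det_isEmpty, h]
  simp

lemma card_eq_zero_iff (lam : YoungDiagram) : lam.card = 0 ↔ lam = ⊥ := by
  refine ⟨fun h => ?_, fun h => by rw [h]; rfl⟩
  ext x
  rw [YoungDiagram.card, Finset.card_eq_zero] at h
  rw [h, YoungDiagram.cells_bot]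

lemma ofReal_re_frobWeight (hz : Admissible z z') (lam : YoungDiagram) :
    (((frobWeight z z' lam).re : ℝ) : ℂ) = frobWeight z z' lam :=
  Complex.ext rfl (Complex.pos_iff.1 (frobWeight_pos hz lam)).2

lemma re_minor_config (hz : Admissible z z') {ξ : ℝ} (hξ0 : 0 < ξ) (hξ1 : ξ < 1)
    (lam : YoungDiagram) : (minor (matL z z' ξ) (config lam)).re =
      (frobWeight z z' lam).re * ξ ^ lam.card := by
  rw [minor_matL_config hξ0 hξ1, ← ofReal_re_frobWeight hz, ← Complex.ofReal_pow,
    ← Complex.ofReal_mul, Complex.ofReal_re, Complex.ofReal_re]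

/-- The generating function `∑_λ w_λ x^{|λ|}` of the weights, which is the sum of the principal
minors of `L`. -/
def partitionFun (z z' : ℂ) (x : ℝ) : ℝ :=
  ∑' lam : YoungDiagram, (frobWeight z z' lam).re * x ^ lam.card

lemma hasSum_frobWeight (hz : Admissible z z') {x : ℝ} (hx0 : 0 < x) (hx1 : x < 1) :
    HasSum (fun lam : YoungDiagram => (frobWeight z z' lam).re * x ^ lam.card)
      (partitionFun z z' x) := by
  refine Summable.hasSum ?_
  refine ((summable_minor_matL hz hx0 hx1).comp_injective config_injective).congr fun lam => ?_
  rw [Function.comp_apply, ← re_minor_config hz hx0 hx1]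
  have h := congrArg Complex.re (norm_minor_matL hz hx0 hx1 (config lam))
  rw [Complex.ofReal_re] at h
  exact h

lemma hasSum_minor_matL (hz : Admissible z z') {x : ℝ} (hx0 : 0 < x) (hx1 : x < 1) :
    HasSum (minor (matL z z' x)) (partitionFun z z' x : ℂ) := by
  rw [← hasSum_config_iff fun Y hY => minor_matL_eq_zero hY]
  refine (Complex.hasSum_ofReal.2 (hasSum_frobWeight hz hx0 hx1)).congr_fun fun lam => ?_
  rw [minor_matL_config hx0 hx1, ← ofReal_re_frobWeight hz]
  push_cast
  rfl

/-- The sum of `|x| K(x, x)` over all half-integers `x`. -/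
lemma hasSum_absHalf_mul_hypKernel (hz : Admissible z z') {ξ : ℝ} (hξ0 : 0 < ξ) (hξ1 : ξ < 1) :
    HasSum (fun x => (absHalf x : ℂ) * hypKernel z z' ξ x x) (z * z' * ξ / (1 - ξ)) := by
  have h := dualPair (z := z) (z' := z') (s := 1) (Or.inl rfl) hξ0 hξ1
  obtain ⟨s₁, s₂, h₁, h₂, e⟩ := h.hasSum_trace
    (fun k => hasSum_diagBlock hz (Or.inl rfl) hξ0 hξ1 k k)
    (fun k => hasSum_diagBlock_neg hz hξ0 hξ1 k k)
    ((hasSum_Psi_mul_hypG (z := z) (z' := z') (Or.inl rfl) hξ0 hξ1).congr_fun fun k => by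
      rw [rootPsi_sq])
  rw [← e]
  refine HasSum.sum (h₁.congr_fun fun k => ?_) (h₂.congr_fun fun k => ?_)
  · simp [absHalf, hypKernel]
  · simp [absHalf, hypKernel]

/-- The expectation of `|λ|`, computed as `∑_x |x| Prob {x ∈ X(λ)}`. -/
lemma hasSum_card_mul_frobWeight (hz : Admissible z z') {x : ℝ} (hx0 : 0 < x) (hx1 : x < 1) :
    HasSum (fun lam : YoungDiagram => lam.card * ((frobWeight z z' lam).re * x ^ lam.card))
      (partitionFun z z' x * ((z * z').re * x / (1 - x))) := by
  set Z : ℂ := (partitionFun z z' x : ℂ)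
  have hZ := hasSum_minor_matL hz hx0 hx1
  have h1 : ∀ w : HalfInt, HasSum (fun Y : Finset HalfInt => absHalf w *
      (if {w} ⊆ Y then (minor (matL z z' x) Y).re else 0))
      (Z * ((absHalf w : ℂ) * hypKernel z z' x w w)).re := by
    intro w
    have h2 := ((hasSum_minor_matL_of_subset hz hx0 hx1 hZ {w}).mul_left (absHalf w : ℂ)).mapL
      Complex.reCLM
    rw [minor_singleton, mul_left_comm] at h2
    refine h2.congr_fun fun Y => ?_
    simp only [Complex.reCLM_apply, Complex.re_ofReal_mul]
    split_ifs <;> simp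
  have h2 : HasSum (fun w => (Z * ((absHalf w : ℂ) * hypKernel z z' x w w)).re)
      (partitionFun z z' x * ((z * z').re * x / (1 - x))) := by
    have h3 := ((hasSum_absHalf_mul_hypKernel hz hx0 hx1).mul_left Z).mapL Complex.reCLM
    have e : Complex.reCLM (Z * (z * z' * x / (1 - x))) =
        partitionFun z z' x * ((z * z').re * x / (1 - x)) := by
      have et : (((z * z').re : ℝ) : ℂ) = z * z' :=
        Complex.ext rfl (Complex.pos_iff.1 hz.mul_pos).2
      rw [← et, Complex.reCLM_apply, Complex.re_ofReal_mul, Complex.ofReal_re]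
      congr 1
      rw [← Complex.ofReal_one, ← Complex.ofReal_sub, ← Complex.ofReal_mul, ← Complex.ofReal_div,
        Complex.ofReal_re]
    rw [e] at h3
    exact h3
  have h3 : ∀ Y : Finset HalfInt, HasSum (fun w => absHalf w *
      (if {w} ⊆ Y then (minor (matL z z' x) Y).re else 0))
      ((∑ w ∈ Y, absHalf w) * (minor (matL z z' x) Y).re) := by
    intro Y
    have h4 : HasSum (fun w => absHalf w *
        (if {w} ⊆ Y then (minor (matL z z' x) Y).re else 0))
        (∑ w ∈ Y, absHalf w * (if {w} ⊆ Y then (minor (matL z z' x) Y).re else 0)) :=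
      hasSum_sum_of_ne_finset_zero fun w hw => by
        rw [if_neg (mt Finset.singleton_subset_iff.1 hw), mul_zero]
    rw [Finset.sum_mul]
    rw [Finset.sum_congr rfl fun w hw => by
      rw [if_pos (Finset.singleton_subset_iff.2 hw)]] at h4
    exact h4
  have h4 := hasSum_comm_of_nonneg (fun w Y => mul_nonneg (absHalf_nonneg w) ?_) h1 h2 h3
  · rw [← config_injective.hasSum_iff] at h4
    · refine h4.congr_fun fun lam => ?_
      rw [Function.comp_apply, sum_absHalf_config, re_minor_config hz hx0 hx1]
    · intro Y hY
      rw [minor_matL_eq_zero hY, Complex.zero_re, mul_zero]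
  · split_ifs
    · exact (Complex.nonneg_iff.1 (minor_matL_nonneg hz hx0 hx1 Y)).1
    · exact le_rfl

/-- The sum of the principal minors of `L` is `(1 - ξ)⁻ᵗ`. -/
lemma one_sub_rpow_mul_partitionFun (hz : Admissible z z') {ξ : ℝ} (hξ0 : 0 < ξ) (hξ1 : ξ < 1) :
    (1 - ξ) ^ (z * z').re * partitionFun z z' ξ = 1 := by
  refine eq_one_sub_rpow_of_euler (W := fun lam => (frobWeight z z' lam).re)
    (n := YoungDiagram.card)
    (fun lam => (Complex.pos_iff.1 (frobWeight_pos hz lam)).1.le)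
    (fun x h0 h1 => hasSum_frobWeight hz h0 h1)
    (fun x h0 h1 => hasSum_card_mul_frobWeight hz h0 h1) ?_ hξ0 hξ1
  have h := hasSum_single (f := fun lam => (frobWeight z z' lam).re * (0 : ℝ) ^ lam.card) ⊥
    fun lam hlam => by
      rw [zero_pow fun h => hlam ((card_eq_zero_iff lam).1 h), mul_zero]
  rw [(card_eq_zero_iff ⊥).2 rfl, frobWeight_bot] at h
  simpa using h

lemma one_sub_cpow_mul_partitionFun (hz : Admissible z z') {ξ : ℝ} (hξ0 : 0 < ξ) (hξ1 : ξ < 1) :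
    (1 - (ξ : ℂ)) ^ (z * z') * (partitionFun z z' ξ : ℂ) = 1 := by
  have et : (((z * z').re : ℝ) : ℂ) = z * z' :=
    Complex.ext rfl (Complex.pos_iff.1 hz.mul_pos).2
  have h : (0 : ℝ) ≤ 1 - ξ := by linarith
  rw [← et, ← Complex.ofReal_one, ← Complex.ofReal_sub, ← Complex.ofReal_cpow h,
    ← Complex.ofReal_mul, one_sub_rpow_mul_partitionFun hz hξ0 hξ1]

theorem hasSum_mixedMeasure (hz : Admissible z z') {ξ : ℝ} (hξ0 : 0 < ξ) (hξ1 : ξ < 1) :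
    HasSum (fun lam : YoungDiagram => mixedMeasure z z' ξ lam) 1 := by
  rw [← one_sub_cpow_mul_partitionFun hz hξ0 hξ1]
  have h := (hasSum_config_iff fun Y hY => minor_matL_eq_zero hY).2 (hasSum_minor_matL hz hξ0 hξ1)
  refine (h.mul_left _).congr_fun fun lam => ?_
  rw [mixedMeasure_eq hz, minor_matL_config hξ0 hξ1]

theorem hasSum_mixedMeasure_of_subset (hz : Admissible z z') {ξ : ℝ} (hξ0 : 0 < ξ) (hξ1 : ξ < 1)
    (X : Finset HalfInt) :
    HasSum (fun lam : {lam : YoungDiagram // X ⊆ config lam} => mixedMeasure z z' ξ lam.1)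
      (minor (hypKernel z z' ξ) X) := by
  have h := hasSum_minor_matL_of_subset hz hξ0 hξ1 (hasSum_minor_matL hz hξ0 hξ1) X
  rw [← hasSum_config_iff fun Y hY => by rw [minor_matL_eq_zero hY, ite_self]] at h
  have h1 := h.mul_left ((1 - (ξ : ℂ)) ^ (z * z'))
  rw [← mul_assoc, one_sub_cpow_mul_partitionFun hz hξ0 hξ1, one_mul] at h1
  refine (hasSum_subtype_iff_indicator (s := {lam : YoungDiagram | X ⊆ config lam})
    (f := mixedMeasure z z' ξ)).2 (h1.congr_fun fun lam => ?_)
  by_cases hX : X ⊆ config lam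
  · rw [Set.indicator_of_mem hX, if_pos hX, mixedMeasure_eq hz, minor_matL_config hξ0 hξ1]
  · rw [Set.indicator_of_notMem hX, if_neg hX, mul_zero]

end TotalMass

end HypKernel

end

theorem theorem3p3 (z z' : ℂ) (hz : HypKernel.Admissible z z') (ξ : ℝ) (hξ0 : 0 < ξ)
    (hξ1 : ξ < 1) :
    -- the hypergeometric function in question is a genuine analytic continuation
    (∀ a b c : ℂ, (∀ n : ℕ, c ≠ -(n : ℂ)) →
      ∃ g : ℂ → ℂ, HypKernel.IsGaussBranch a b c ((ξ : ℂ) / ((ξ : ℂ) - 1)) g) ∧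
    -- `ψ_±` is real and positive on `{0, 1, 2, …}`
    (∀ s : ℂ, s = 1 ∨ s = -1 → ∀ k : ℕ,
      (HypKernel.psi z z' ξ s k).im = 0 ∧ 0 < (HypKernel.psi z z' ξ s k).re) ∧
    -- the diagonal values of the kernel are the limits of the quotients
    (∀ s : ℂ, s = 1 ∨ s = -1 → ∀ k : ℕ,
      DifferentiableAt ℂ (HypKernel.funP z z' ξ s) k ∧
      DifferentiableAt ℂ (HypKernel.funQ z z' ξ s) k ∧
      Tendsto (fun u : ℂ => HypKernel.diagQuot z z' ξ s k u) (𝓝[≠] (k : ℂ))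
        (𝓝 (HypKernel.diagBlock z z' ξ s k k))) ∧
    -- `K = L (1 + L)⁻¹`
    (∃ L K : HypKernel.Ell2 →L[ℂ] HypKernel.Ell2,
      (∀ x y, HypKernel.entry L x y = HypKernel.matL z z' ξ x y) ∧
      (∀ x y, HypKernel.entry K x y = HypKernel.hypKernel z z' ξ x y) ∧
      IsUnit (1 + L) ∧ K = L * Ring.inverse (1 + L)) ∧
    -- the mixed measure is a probability measure, with the correlation functions `det K_X`
    (∀ lam : YoungDiagram, (HypKernel.mixedMeasure z z' ξ lam).im = 0 ∧
      0 < (HypKernel.mixedMeasure z z' ξ lam).re) ∧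
    HasSum (fun lam : YoungDiagram => HypKernel.mixedMeasure z z' ξ lam) 1 ∧
    (∀ X : Finset HypKernel.HalfInt,
      HasSum (fun lam : {lam : YoungDiagram // X ⊆ HypKernel.config lam} =>
          HypKernel.mixedMeasure z z' ξ lam.1)
        (Matrix.of fun x y : {x // x ∈ X} => HypKernel.hypKernel z z' ξ x.1 y.1).det) := by
  refine ⟨fun a b c hc => ⟨_, HypKernel.isGaussBranch_pfaff a b c hc hξ0 hξ1⟩,
    fun s hs k => ?_, fun s hs k => HypKernel.tendsto_diagQuot hz hs hξ0 hξ1 k, ?_,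
    fun lam => ?_, HypKernel.hasSum_mixedMeasure hz hξ0 hξ1,
    fun X => HypKernel.hasSum_mixedMeasure_of_subset hz hξ0 hξ1 X⟩
  · have h := Complex.pos_iff.1 (HypKernel.psi_pos hz hs hξ0 hξ1 k)
    exact ⟨h.2.symm, h.1⟩
  · obtain ⟨L, hL, -, hu, hK⟩ := HypKernel.exists_operator_resolvent hz hξ0 hξ1
    exact ⟨L, L * Ring.inverse (1 + L), hL, hK, hu, rfl⟩
  · have h := Complex.pos_iff.1 (HypKernel.mixedMeasure_pos hz hξ0 hξ1 lam)
    exact ⟨h.2.symm, h.1⟩
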